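/- **Setting.** For an open set $\Omega\subset\mathbb R^2$ and a part $S\subseteq\Omega$ (up to null sets) write $|v|_{W^{1,p}(S)}=\|\,|\nabla v|\,\|_{L^p(S)}$ and $|v|_{W^{2,p}(S)}=\|\,|D^2v|\,\|_{L^p(S)}$, with weak derivatives, the Euclidean norm of the gradient and the Frobenius norm of the Hessian; $H^k=W^{k,2}$. For a triangle $K$ let $h_K$ be its longest edge, $R_K$ its circumradius, $J_K=2|K|$, and $\Pi_K$ the linear Lagrange interpolation at the vertices of $K$. *Interpolation constants.* (i) There is a constant $C_c$ such that $|u-\Pi_Ku|_{W^{1,\infty}(K)}\le C_cR_K|u|_{W^{2,\infty}(K)}$ for all triangles $K$ and all $u\in W^{2,\infty}(K)$. (ii) For every $\alpha_0<\pi$ there is a constant $C_I$, depending only on $\alpha_0$, such that $|u-\Pi_Ku|_{H^1(K)}\le C_Ih_K|u|_{H^2(K)}$ for all triangles $K$ with all angles at most $\alpha_0$ and all $u\in H^2(K)$. *Mesh and band.* Let $\alpha_0<\pi$ and let $C_c$, $C_I$ be any constants as in (i) and (ii). Let $h,\bar h,L>0$. Let $\mathcal T_h$ be a finite conforming triangulation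 by nondegenerate triangles of a closed polygon with interior $\Omega$. Let some of its triangles form a band of length $L$ and width $\bar h$: they lie in a rectangle with side lengths $L$ and $\bar h$, and each has minimal altitude $\bar h$ and longest edge at most $h$ (for example, a row of alternating caps with base $h$ and altitude $\bar h$ between two parallel lines). Let $\mathcal B$ be the union of the band triangles. All triangles of $\mathcal T_h$ not in the band have longest edge at most $h$ and all angles at most $\alpha_0$. *Problem and method.* Let $f\in L^2(\Omega)$ and let $u\in H^1_0(\Omega)$ be the weak solution of $-\Delta u=f$ in $\Omega$, $u=0$ on $\partial\Omega$. Assume $u\in W^{2,\infty}(\Omega)$ and $|u|_{W^{2,\infty}(\mathcal B)}>0$. Let $V_h$ be the space of continuous functions on $\overline\Omega$ that are affine on each triangle of $\mathcal T_h$ and vanish on $\partial\Omega$. Put $$D=\min\left(\frac{\bar h}{h^2}\,\frac{|u|_{W^{1,\infty}(\mathcal B)}}{|u|_{W^{2,\infty}(\mathcal B)}}\sqrt{\frac{2}{3C_c}}\,,\ 1\right),\qquad d=D\ \text{on }\mathcal B,\quad d=1\ \text{on }\Omega\setminus\mathcal B,$$ and let the tempered finite element solution $\tilde u_h\in V_h$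 satisfy $\int_\Omega d\,\nabla\tilde u_h\cdot\nabla v_h\,dx=\int_\Omega f v_h\,dx$ for all $v_h\in V_h$. **Theorem.** Constants $C_c$ and $C_I$ as in (i) and (ii) exist, and for any such constants, in the above setting, $$|u-\tilde u_h|_{H^1(\Omega\setminus\mathcal B)}+\sqrt D\,|u-\tilde u_h|_{H^1(\mathcal B)}\le C(u,L)\,h,$$ $$C(u,L)=2\sqrt2\,C_I\,|u|_{H^2(\Omega\setminus\mathcal B)}+2\sqrt2\,\sqrt[4]{6}\,\sqrt{C_cL}\,\sqrt{|u|_{W^{1,\infty}(\mathcal B)}\,|u|_{W^{2,\infty}(\mathcal B)}}\,.$$ Moreover, this choice of $D$ corresponds to bounding the element Jacobians from below by a value $J_{\min}$ proportional to $h^3$: with $$J_{\min}=h^3\,\frac{|u|_{W^{2,\infty}(\mathcal B)}}{|u|_{W^{1,\infty}(\mathcal B)}}\sqrt{\frac{3C_c}{2}}$$ one has $J_K/\max(J_K,J_{\min})=D$ for every band triangle $K$ with longest edge equal to $h$. -/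

import Mathlib

open MeasureTheory Filter Topology Set
open scoped ENNReal ContDiff

noncomputable section

namespace TFEM

/-! ### Sobolev spaces on open subsets of the plane, through weak derivatives -/

/-- The Euclidean plane. -/
abbrev Plane : Type := EuclideanSpace ℝ (Fin 2)

/-- `φ ∈ C_c^∞(Ω)`. -/
def IsTestFunction (Ω : Set Plane) (φ : Plane → ℝ) : Prop :=
  ContDiff ℝ ∞ φ ∧ HasCompactSupport φ ∧ tsupport φ ⊆ Ω

/-- `g` is a weak partial derivative `∂_i u` on the open set `Ω`. -/
def HasWeakPartial (Ω : Set Plane) (i : Fin 2) (u g : Plane → ℝ) : Prop :=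
  LocallyIntegrableOn u Ω ∧ LocallyIntegrableOn g Ω ∧
    ∀ φ : Plane → ℝ, IsTestFunction Ω φ →
      ∫ x in Ω, u x * fderiv ℝ φ x (EuclideanSpace.single i 1) = -∫ x in Ω, g x * φ x

open Classical in
/-- A representative of the weak partial derivative `∂_i u` on `Ω` (unique up to null subsets of
`Ω`); by convention `0` if there is no weak derivative. -/
def weakPartial (Ω : Set Plane) (i : Fin 2) (u : Plane → ℝ) : Plane → ℝ :=
  if h : ∃ g, HasWeakPartial Ω i u g then h.choose else 0

/-- The weak gradient of `u` on `Ω`. -/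
def weakGrad (Ω : Set Plane) (u : Plane → ℝ) (x : Plane) : Plane :=
  WithLp.toLp 2 fun i => weakPartial Ω i u x

/-- The weak Hessian of `u` on `Ω`; its norm is the Frobenius norm. -/
def weakHess (Ω : Set Plane) (u : Plane → ℝ) (x : Plane) : EuclideanSpace ℝ (Fin 2 × Fin 2) :=
  WithLp.toLp 2 fun ij => weakPartial Ω ij.2 (weakPartial Ω ij.1 u) x

/-- `u ∈ W^{1,p}(Ω)`. -/
def MemW1 (p : ℝ≥0∞) (Ω : Set Plane) (u : Plane → ℝ) : Prop :=
  MemLp u p (volume.restrict Ω) ∧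
    ∀ i, (∃ g, HasWeakPartial Ω i u g) ∧ MemLp (weakPartial Ω i u) p (volume.restrict Ω)

/-- `u ∈ W^{2,p}(Ω)`. -/
def MemW2 (p : ℝ≥0∞) (Ω : Set Plane) (u : Plane → ℝ) : Prop :=
  MemW1 p Ω u ∧ ∀ i, MemW1 p Ω (weakPartial Ω i u)

/-- The seminorm `|u|_{W^{1,p}(S)} = ‖ |∇u| ‖_{L^p(S)}` for a part `S` of the open set `Ω` on which
`u` is defined. -/
def semiW1 (p : ℝ≥0∞) (Ω S : Set Plane) (u : Plane → ℝ) : ℝ :=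
  (eLpNorm (weakGrad Ω u) p (volume.restrict S)).toReal

/-- The seminorm `|u|_{W^{2,p}(S)} = ‖ |D²u| ‖_{L^p(S)}` for a part `S` of the open set `Ω` on which
`u` is defined. -/
def semiW2 (p : ℝ≥0∞) (Ω S : Set Plane) (u : Plane → ℝ) : ℝ :=
  (eLpNorm (weakHess Ω u) p (volume.restrict S)).toReal

/-- `v ∈ H¹_0(Ω)`, the closure of `C_c^∞(Ω)` in `H¹(Ω)`. -/
def MemH10 (Ω : Set Plane) (v : Plane → ℝ) : Prop :=
  MemW1 2 Ω v ∧ ∃ φ : ℕ → Plane → ℝ, (∀ n, IsTestFunction Ω (φ n)) ∧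
    Tendsto (fun n => eLpNorm (fun x => φ n x - v x) 2 (volume.restrict Ω)) atTop (𝓝 0) ∧
    Tendsto (fun n => eLpNorm (fun x => gradient (φ n) x - weakGrad Ω v x) 2
      (volume.restrict Ω)) atTop (𝓝 0)

/-- `u` is the weak solution of `-Δu = f` in `Ω`, `u = 0` on `∂Ω`. -/
def IsWeakSolution (Ω : Set Plane) (f u : Plane → ℝ) : Prop :=
  MemH10 Ω u ∧ ∀ v, MemH10 Ω v →
    ∫ x in Ω, inner ℝ (weakGrad Ω u x) (weakGrad Ω v x) = ∫ x in Ω, f x * v x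

/-! ### Triangles -/

/-- Nondegenerate triangles in the plane. -/
abbrev Tri : Type := Affine.Triangle ℝ Plane

/-- The closed triangle as a set of points. -/
def Tri.carrier (T : Tri) : Set Plane := convexHull ℝ (range T.points)

/-- The length of the longest edge. -/
def Tri.longestEdge (T : Tri) : ℝ := Metric.diam (range T.points)

/-- The smallest of the three altitudes. -/
def Tri.minAltitude (T : Tri) : ℝ := ⨅ i, Affine.Simplex.height T i

/-- The Jacobian determinant (in absolute value) of the affine map from the reference triangle with
vertices `(0,0), (1,0), (0,1)`, i.e. twice the area. -/
def Tri.jacobian (T : Tri) : ℝ := 2 * volume.real T.carrier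

/-- All angles of the triangle are at most `α₀`. -/
def Tri.AnglesLE (T : Tri) (α₀ : ℝ) : Prop :=
  ∀ i j k : Fin 3, i ≠ j → j ≠ k → i ≠ k →
    EuclideanGeometry.angle (T.points i) (T.points j) (T.points k) ≤ α₀

/-- The affine function `p` is the linear Lagrange interpolant of `u` on the triangle `T`. -/
def IsLagrangeInterpolant (T : Tri) (u : Plane → ℝ) (p : Plane →ᵃ[ℝ] ℝ) : Prop :=
  ∀ i, p (T.points i) = u (T.points i)

/-- `C` is a constant for the circumradius estimate of linear Lagrange interpolation on all
triangles `K`: `|u - Π_K u|_{W^{1,∞}(K)} ≤ C R_K |u|_{W^{2,∞}(K)}` for `u ∈ W^{2,∞}(K)`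
(the representative that is continuous on the closed triangle is used). -/
def IsCircumradiusConstant (C : ℝ) : Prop :=
  ∀ (K : Tri) (u : Plane → ℝ) (p : Plane →ᵃ[ℝ] ℝ),
    MemW2 ∞ (interior K.carrier) u → ContinuousOn u K.carrier → IsLagrangeInterpolant K u p →
    semiW1 ∞ (interior K.carrier) (interior K.carrier) (fun x => u x - p x) ≤
      C * Affine.Simplex.circumradius K *
        semiW2 ∞ (interior K.carrier) (interior K.carrier) u

/-- `C` is a constant for the linear Lagrange interpolation estimate on all triangles `K` whose
angles are at most `α₀`: `|u - Π_K u|_{H¹(K)} ≤ C h_K |u|_{H²(K)}` for `u ∈ H²(K)`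
(the representative that is continuous on the closed triangle is used). -/
def IsMaxAngleConstant (α₀ C : ℝ) : Prop :=
  ∀ (K : Tri) (u : Plane → ℝ) (p : Plane →ᵃ[ℝ] ℝ), K.AnglesLE α₀ →
    MemW2 2 (interior K.carrier) u → ContinuousOn u K.carrier → IsLagrangeInterpolant K u p →
    semiW1 2 (interior K.carrier) (interior K.carrier) (fun x => u x - p x) ≤
      C * K.longestEdge * semiW2 2 (interior K.carrier) (interior K.carrier) u

/-! ### Meshes, bands and the tempered finite element method -/

/-- The region covered by a finite set of closed triangles. -/
def region (𝒯 : Finset Tri) : Set Plane := ⋃ T ∈ 𝒯, T.carrier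

/-- `𝒯` is a conforming triangulation of the polygonal open set `Ω`. -/
structure IsTriangulation (𝒯 : Finset Tri) (Ω : Set Plane) : Prop where
  /-- The triangles cover exactly the closed polygon with interior `Ω`. -/
  interior_region : interior (region 𝒯) = Ω
  /-- Two triangles meet in a common face (empty, a vertex, an edge or the whole triangle). -/
  conforming : ∀ S ∈ 𝒯, ∀ T ∈ 𝒯,
    S.carrier ∩ T.carrier = convexHull ℝ (range S.points ∩ range T.points)
  /-- No triangle is listed twice with permuted vertices. -/
  distinct : ∀ S ∈ 𝒯, ∀ T ∈ 𝒯, range S.points = range T.points → S = T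

/-- The triangles of `ℬ` form a band of length `L` and width `hbar`, made of (typically
degenerating) elements of size `h`: they lie in a rectangle with side lengths `L` and `hbar`, and
each has minimal altitude `hbar` and longest edge at most `h`. The regular pattern of alternating
caps with base `h` and altitude `hbar` between two parallel lines is the model case; neither that
pattern nor the angles of the elements are prescribed. -/
structure IsBand (ℬ : Finset Tri) (L hbar h : ℝ) : Prop where
  longestEdge_le : ∀ T ∈ ℬ, T.longestEdge ≤ h
  minAltitude_eq : ∀ T ∈ ℬ, T.minAltitude = hbar
  subset_rectangle : ∃ a e n : Plane, ‖e‖ = 1 ∧ ‖n‖ = 1 ∧ inner ℝ e n = 0 ∧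
    ∀ x ∈ region ℬ, ∃ s ∈ Icc (0 : ℝ) L, ∃ t ∈ Icc (0 : ℝ) hbar, x = a + s • e + t • n

/-- `v ∈ V_h`: continuous on the closure of `Ω`, affine on each triangle, zero on `∂Ω`. -/
def MemVh (𝒯 : Finset Tri) (Ω : Set Plane) (v : Plane → ℝ) : Prop :=
  ContinuousOn v (closure Ω) ∧ (∀ T ∈ 𝒯, ∃ p : Plane →ᵃ[ℝ] ℝ, EqOn v p T.carrier) ∧
    ∀ x ∈ frontier Ω, v x = 0

open Classical in
/-- The tempered diffusion coefficient `d(x)`: `D` on `B` and `1` elsewhere. -/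
def diffusion (B : Set Plane) (D : ℝ) (x : Plane) : ℝ := if x ∈ B then D else 1

/-- `w` is a tempered finite element solution: `w ∈ V_h` and
`∫_Ω d ∇w · ∇v = ∫_Ω f v` for all `v ∈ V_h`. -/
def IsTFEMSolution (𝒯 : Finset Tri) (Ω B : Set Plane) (D : ℝ) (f w : Plane → ℝ) : Prop :=
  MemVh 𝒯 Ω w ∧ ∀ v, MemVh 𝒯 Ω v →
    ∫ x in Ω, diffusion B D x * inner ℝ (weakGrad Ω w x) (weakGrad Ω v x) = ∫ x in Ω, f x * v x

/-- The choice of the diffusion coefficient on the band,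
`min ((hbar / h²) (|u|_{W^{1,∞}(B)} / |u|_{W^{2,∞}(B)}) √(2 / (3 C_c)), 1)`. -/
def optD (Ω B : Set Plane) (u : Plane → ℝ) (Cc hbar h : ℝ) : ℝ :=
  min (hbar / h ^ 2 * (semiW1 ∞ Ω B u / semiW2 ∞ Ω B u) * √(2 / (3 * Cc))) 1

end TFEM

end

/-!
The tempered method replaces the diffusion coefficient `1` by `D ≤ 1` on a band of badly shaped
triangles. This costs a consistency error proportional to `1 / √D`, and it damps the interpolation
error on the band by `√D`. The theorem says that the chosen `D` keeps both contributions of order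
`h`.

*Interpolation constants.* A smooth function that vanishes at the vertices of a triangle has, on
each edge, a directional derivative along the edge which vanishes at some point of the edge (Rolle)
and has mean zero on the edge. The first fact bounds this directional derivative pointwise on the
triangle by the second derivatives; the second fact, together with a Poincaré inequality on the
square that is contracted to the triangle (`poincare_square`, `lintegral_fderiv_edge_le`), bounds it
in mean square. By Cramer's rule two directional derivatives control the gradient
(`norm_mul_abs_det2_le`); at the vertex opposite to the longest edge the resulting factor is a
multiple of the circumradius (`Tri.two_mul_circumradius_mul_det`), respectively bounded in terms of
the maximal angle. Sobolev functions are reached by mollification on slightly shrunk triangles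
(`eLpNorm_weakGrad_sub_le`). This gives `isCircumradiusConstant_four` and
`exists_isMaxAngleConstant`.

*Nodal interpolant.* The solution belongs to `H¹₀ ∩ W^{1,∞}`, so its extension by zero has a bounded
weak gradient on the whole plane and is Lipschitz up to a null set
(`MemH10.exists_lipschitzWith`). Its nodal interpolant vanishes on the boundary because the smallest
face of a triangle through a boundary point has its vertices on the boundary
(`IsTriangulation.point_notMem`). Functions in `V_h` are Lipschitz, and a Lipschitz function
vanishing outside `Ω` is a limit of mollified soft thresholds, which are test functions; hence `V_h`
is contained in `H¹₀` (`IsTriangulation.memH10_of_memVh`) and the weak equation may be tested with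
`V_h`.

*Error estimate.* Testing both equations with the difference of the discrete solution and the
interpolant gives `energy_estimate`: the error is bounded by the interpolation error in the weighted
norm plus `(1 - D) / √D` times the gradient of the solution on the band. Off the band the maximal
angle estimate is summed over the elements. On the band, whose area is at most `L * hbar`, the
circumradius is at most `h ^ 2 / (2 * hbar)`, since the Jacobian of a triangle is its longest edge
times its smallest altitude (`Tri.abs_det_eq`). It remains to insert `D`
(`band_contribution_le`). The constant in the theorem is large enough for every admissible `Cc`:
the function `|x|²` shows that `Cc ≥ 2 / 3` (`IsCircumradiusConstant.two_thirds_le`), and when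
`Cc > 4` the interpolation estimate may be used with the constant `4` instead.

The statement on Jacobians is the same formula for the Jacobian, inserted into the definition of `D`
(`jacobian_div_max`).
-/

noncomputable section

namespace TFEM

/-! ### Calculus of weak derivatives -/

/-- The `i`-th coordinate vector of the plane. -/
abbrev basisVec (i : Fin 2) : Plane := EuclideanSpace.single i 1

theorem integrable_mul_of_tsupport_subset {Ω : Set Plane} {u ψ : Plane → ℝ}
    (hu : LocallyIntegrableOn u Ω) (hψ : Continuous ψ) (hc : HasCompactSupport ψ)
    (hs : tsupport ψ ⊆ Ω) : Integrable (fun x => u x * ψ x) := by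
  have h1 : IntegrableOn u (tsupport ψ) := hu.integrableOn_compact_subset hs hc
  have h2 : IntegrableOn (fun x => u x * ψ x) (tsupport ψ) :=
    h1.mul_continuousOn hψ.continuousOn hc
  refine (integrableOn_iff_integrable_of_support_subset fun x hx => ?_).1 h2
  exact subset_tsupport ψ fun h => hx (by simp [h])

theorem setIntegral_mul_of_tsupport_subset {Ω : Set Plane} {u ψ : Plane → ℝ}
    (hs : tsupport ψ ⊆ Ω) : ∫ x in Ω, u x * ψ x = ∫ x, u x * ψ x :=
  setIntegral_eq_integral_of_forall_compl_eq_zero fun x hx => by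
    rw [image_eq_zero_of_notMem_tsupport fun h => hx (hs h), mul_zero]

namespace IsTestFunction

variable {Ω : Set Plane} {φ : Plane → ℝ}

theorem continuous_partial (h : IsTestFunction Ω φ) (v : Plane) :
    Continuous fun x => fderiv ℝ φ x v :=
  (h.1.continuous_fderiv (by simp)).clm_apply continuous_const

theorem tsupport_partial_subset (h : IsTestFunction Ω φ) (v : Plane) :
    tsupport (fun x => fderiv ℝ φ x v) ⊆ Ω :=
  (tsupport_fderiv_apply_subset ℝ v).trans h.2.2

theorem hasCompactSupport_partial (h : IsTestFunction Ω φ) (v : Plane) :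
    HasCompactSupport fun x => fderiv ℝ φ x v :=
  h.2.1.fderiv_apply ℝ v

theorem mono {Ω' : Set Plane} (h : IsTestFunction Ω φ) (hs : Ω ⊆ Ω') : IsTestFunction Ω' φ :=
  ⟨h.1, h.2.1, h.2.2.trans hs⟩

theorem exists_lipschitzWith (h : IsTestFunction Ω φ) : ∃ C, LipschitzWith C φ :=
  h.1.lipschitzWith_of_hasCompactSupport h.2.1 (by simp)

end IsTestFunction

namespace HasWeakPartial

variable {Ω : Set Plane} {i : Fin 2} {u v g g' : Plane → ℝ}

theorem integral_eq (h : HasWeakPartial Ω i u g) {φ : Plane → ℝ} (hφ : IsTestFunction Ω φ) :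
    ∫ x, u x * fderiv ℝ φ x (basisVec i) = -∫ x, g x * φ x := by
  have := h.2.2 φ hφ
  rwa [setIntegral_mul_of_tsupport_subset (hφ.tsupport_partial_subset _),
    setIntegral_mul_of_tsupport_subset hφ.2.2] at this

theorem of_integral_eq (hu : LocallyIntegrableOn u Ω) (hg : LocallyIntegrableOn g Ω)
    (h : ∀ φ, IsTestFunction Ω φ → ∫ x, u x * fderiv ℝ φ x (basisVec i) = -∫ x, g x * φ x) :
    HasWeakPartial Ω i u g := by
  refine ⟨hu, hg, fun φ hφ => ?_⟩
  rw [setIntegral_mul_of_tsupport_subset (hφ.tsupport_partial_subset _),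
    setIntegral_mul_of_tsupport_subset hφ.2.2]
  exact h φ hφ

theorem mono {Ω' : Set Plane} (h : HasWeakPartial Ω i u g) (hs : Ω' ⊆ Ω) :
    HasWeakPartial Ω' i u g :=
  of_integral_eq (h.1.mono_set hs) (h.2.1.mono_set hs) fun _ hφ => h.integral_eq (hφ.mono hs)

/-- Weak derivatives are unique almost everywhere: this identifies the representative chosen in
`weakPartial` with any other one. -/
theorem ae_unique (hΩ : IsOpen Ω) (h : HasWeakPartial Ω i u g) (h' : HasWeakPartial Ω i u g') :
    g =ᵐ[volume.restrict Ω] g' := by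
  have key : ∀ᵐ x, x ∈ Ω → (g - g') x = 0 := by
    refine hΩ.ae_eq_zero_of_integral_contDiff_smul_eq_zero (h.2.1.sub h'.2.1)
      fun φ h1 h2 h3 => ?_
    have hφ : IsTestFunction Ω φ := ⟨h1, h2, h3⟩
    have e := (h.integral_eq hφ).symm.trans (h'.integral_eq hφ)
    have i1 := integrable_mul_of_tsupport_subset h.2.1 h1.continuous h2 h3
    have i2 := integrable_mul_of_tsupport_subset h'.2.1 h1.continuous h2 h3
    calc ∫ x, φ x • (g - g') x = ∫ x, (g x * φ x - g' x * φ x) := by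
          congr 1; ext x; simp; ring
      _ = 0 := by rw [integral_sub i1 i2]; linarith
  rw [EventuallyEq, ae_restrict_iff' hΩ.measurableSet]
  filter_upwards [key] with x hx hxΩ
  have := hx hxΩ
  simpa [sub_eq_zero] using this

theorem congr (h : HasWeakPartial Ω i u g) (hu : u =ᵐ[volume.restrict Ω] v)
    (hg : g =ᵐ[volume.restrict Ω] g') : HasWeakPartial Ω i v g' := by
  refine ⟨h.1.congr hu, h.2.1.congr hg, fun φ hφ => ?_⟩
  have e1 : ∫ x in Ω, v x * fderiv ℝ φ x (EuclideanSpace.single i 1) =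
      ∫ x in Ω, u x * fderiv ℝ φ x (EuclideanSpace.single i 1) :=
    integral_congr_ae (hu.mono fun x hx => by simp only [hx])
  have e2 : ∫ x in Ω, g' x * φ x = ∫ x in Ω, g x * φ x :=
    integral_congr_ae (hg.mono fun x hx => by simp only [hx])
  rw [e1, e2, h.2.2 φ hφ]

theorem sub (hu : HasWeakPartial Ω i u g) (hv : HasWeakPartial Ω i v g') :
    HasWeakPartial Ω i (fun x => u x - v x) (fun x => g x - g' x) := by
  refine of_integral_eq (hu.1.sub hv.1) (hu.2.1.sub hv.2.1) fun φ hφ => ?_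
  have c := hφ.continuous_partial (basisVec i)
  have s := hφ.tsupport_partial_subset (basisVec i)
  have k := hφ.hasCompactSupport_partial (basisVec i)
  simp only [sub_mul]
  rw [integral_sub (integrable_mul_of_tsupport_subset hu.1 c k s)
      (integrable_mul_of_tsupport_subset hv.1 c k s),
    integral_sub (integrable_mul_of_tsupport_subset hu.2.1 hφ.1.continuous hφ.2.1 hφ.2.2)
      (integrable_mul_of_tsupport_subset hv.2.1 hφ.1.continuous hφ.2.1 hφ.2.2),
    hu.integral_eq hφ, hv.integral_eq hφ]
  ring

/-- The classical partial derivatives of a Lipschitz function, which exist almost everywhere, are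
its weak partial derivatives. -/
theorem of_lipschitzWith {C : NNReal} (hu : LipschitzWith C u) (Ω : Set Plane) (i : Fin 2) :
    HasWeakPartial Ω i u (fun x => lineDeriv ℝ u x (basisVec i)) := by
  refine of_integral_eq (hu.continuous.locallyIntegrable.locallyIntegrableOn _)
    ((hu.locallyIntegrable_lineDeriv _).locallyIntegrableOn _) fun φ hφ => ?_
  obtain ⟨D, hD⟩ := hφ.exists_lipschitzWith
  have := hu.integral_lineDeriv_mul_eq (μ := volume) hD hφ.2.1 (basisVec i)
  rw [this, ← integral_neg]
  congr 1
  ext x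
  have hd : DifferentiableAt ℝ φ x := hφ.1.differentiable (by simp) x
  rw [hd.lineDeriv_eq_fderiv, map_neg]
  ring

end HasWeakPartial

theorem hasWeakPartial_weakPartial {Ω : Set Plane} {i : Fin 2} {u : Plane → ℝ}
    (h : ∃ g, HasWeakPartial Ω i u g) : HasWeakPartial Ω i u (weakPartial Ω i u) := by
  rw [weakPartial, dif_pos h]
  exact h.choose_spec

theorem HasWeakPartial.weakPartial_ae_eq {Ω : Set Plane} {i : Fin 2} {u g : Plane → ℝ}
    (h : HasWeakPartial Ω i u g) (hΩ : IsOpen Ω) :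
    weakPartial Ω i u =ᵐ[volume.restrict Ω] g :=
  (hasWeakPartial_weakPartial ⟨g, h⟩).ae_unique hΩ h

/-- The chosen representative depends only on the class of the function, so that equality holds
here, and not only almost everywhere. -/
theorem weakPartial_congr {Ω : Set Plane} {u v : Plane → ℝ} (h : u =ᵐ[volume.restrict Ω] v)
    (i : Fin 2) : weakPartial Ω i u = weakPartial Ω i v := by
  have : HasWeakPartial Ω i u = HasWeakPartial Ω i v := by
    ext g
    exact ⟨fun H => H.congr h EventuallyEq.rfl, fun H => H.congr h.symm EventuallyEq.rfl⟩
  exact congrArg (fun P : (Plane → ℝ) → Prop =>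
    open Classical in if h : ∃ g, P g then h.choose else 0) this

theorem weakGrad_congr {Ω : Set Plane} {u v : Plane → ℝ} (h : u =ᵐ[volume.restrict Ω] v) :
    weakGrad Ω u = weakGrad Ω v := by
  ext x
  simp only [weakGrad, weakPartial_congr h]

theorem weakHess_congr {Ω : Set Plane} {u v : Plane → ℝ} (h : u =ᵐ[volume.restrict Ω] v) :
    weakHess Ω u = weakHess Ω v := by
  ext x
  simp only [weakHess, weakPartial_congr h]

/-- `G` is a weak gradient of `u` on `Ω`. -/
def HasWeakGrad (Ω : Set Plane) (u : Plane → ℝ) (G : Plane → Plane) : Prop :=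
  ∀ i, HasWeakPartial Ω i u fun x => G x i

namespace HasWeakGrad

variable {Ω : Set Plane} {u v : Plane → ℝ} {G G' : Plane → Plane}

theorem weakGrad_ae_eq (h : HasWeakGrad Ω u G) (hΩ : IsOpen Ω) :
    weakGrad Ω u =ᵐ[volume.restrict Ω] G := by
  have := fun i => (h i).weakPartial_ae_eq hΩ
  filter_upwards [this 0, this 1] with x h0 h1
  ext i
  fin_cases i
  · exact h0
  · exact h1

theorem mono {Ω' : Set Plane} (h : HasWeakGrad Ω u G) (hs : Ω' ⊆ Ω) : HasWeakGrad Ω' u G :=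
  fun i => (h i).mono hs

theorem congr (h : HasWeakGrad Ω u G) (hu : u =ᵐ[volume.restrict Ω] v) : HasWeakGrad Ω v G :=
  fun i => (h i).congr hu EventuallyEq.rfl

theorem sub (hu : HasWeakGrad Ω u G) (hv : HasWeakGrad Ω v G') :
    HasWeakGrad Ω (fun x => u x - v x) (fun x => G x - G' x) :=
  fun i => (hu i).sub (hv i)

end HasWeakGrad

/-- The almost everywhere defined classical gradient of a Lipschitz function. -/
def lineGrad (u : Plane → ℝ) (x : Plane) : Plane :=
  WithLp.toLp 2 fun i => lineDeriv ℝ u x (basisVec i)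

theorem hasWeakGrad_lineGrad {C : NNReal} {u : Plane → ℝ} (hu : LipschitzWith C u)
    (Ω : Set Plane) : HasWeakGrad Ω u (lineGrad u) :=
  fun i => HasWeakPartial.of_lipschitzWith hu Ω i

theorem MemW1.hasWeakGrad {p : ℝ≥0∞} {Ω : Set Plane} {u : Plane → ℝ} (h : MemW1 p Ω u) :
    HasWeakGrad Ω u (weakGrad Ω u) :=
  fun i => hasWeakPartial_weakPartial (h.2 i).1

theorem MemW1.memLp_weakGrad {p : ℝ≥0∞} {Ω : Set Plane} {u : Plane → ℝ} (h : MemW1 p Ω u) :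
    MemLp (weakGrad Ω u) p (volume.restrict Ω) :=
  memLp_piLp_iff.2 fun i => (h.2 i).2

theorem MemW2.memLp_weakHess {p : ℝ≥0∞} {Ω : Set Plane} {u : Plane → ℝ} (h : MemW2 p Ω u) :
    MemLp (weakHess Ω u) p (volume.restrict Ω) :=
  memLp_piLp_iff.2 fun ij => ((h.2 ij.1).2 ij.2).2

theorem ae_norm_le_eLpNorm_top {E : Type*} [NormedAddCommGroup E] {μ : Measure Plane}
    {G : Plane → E} (hG : eLpNorm G ∞ μ ≠ ⊤) : ∀ᵐ x ∂μ, ‖G x‖ ≤ (eLpNorm G ∞ μ).toReal := by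
  rw [eLpNorm_exponent_top] at hG ⊢
  filter_upwards [ae_le_eLpNormEssSup (f := G) (μ := μ)] with x hx
  rw [← toReal_enorm]
  exact ENNReal.toReal_mono hG hx

/-! ### Mollification -/

section Mollify

variable {F : Type*} [NormedAddCommGroup F] [NormedSpace ℝ F]

/-- The mollification of `u` by the normalized bump function of `φ`. -/
def mollify (φ : ContDiffBump (0 : Plane)) (u : Plane → F) : Plane → F :=
  convolution (φ.normed volume) u (ContinuousLinearMap.lsmul ℝ ℝ) volume

theorem mollify_apply (φ : ContDiffBump (0 : Plane)) (u : Plane → F) (x : Plane) :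
    mollify φ u x = ∫ t, φ.normed volume t • u (x - t) := rfl

theorem mollify_apply_swap (φ : ContDiffBump (0 : Plane)) (u : Plane → F) (x : Plane) :
    mollify φ u x = ∫ y, φ.normed volume (x - y) • u y :=
  convolution_eq_swap _

theorem contDiff_mollify (φ : ContDiffBump (0 : Plane)) {u : Plane → F}
    (hu : LocallyIntegrable u) : ContDiff ℝ ∞ (mollify φ u) :=
  φ.hasCompactSupport_normed.contDiff_convolution_left (n := ⊤) _ φ.contDiff_normed hu

theorem isTestFunction_translate_bump (φ : ContDiffBump (0 : Plane)) {Ω : Set Plane} {x : Plane}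
    (hx : Metric.closedBall x φ.rOut ⊆ Ω) :
    IsTestFunction Ω fun y => φ.normed volume (x - y) := by
  have hs : tsupport (fun y => φ.normed volume (x - y)) ⊆ Metric.closedBall x φ.rOut := by
    refine closure_minimal (fun y hy => ?_) Metric.isClosed_closedBall
    have : x - y ∈ Function.support (φ.normed volume) := hy
    rw [φ.support_normed_eq, mem_ball_zero_iff] at this
    rw [mem_closedBall_iff_norm']
    exact this.le
  refine ⟨φ.contDiff_normed.comp (contDiff_const.sub contDiff_id), ?_, hs.trans hx⟩
  exact (isCompact_closedBall x φ.rOut).of_isClosed_subset (isClosed_tsupport _) hs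

/-- Mollification commutes with weak differentiation at points whose distance to the boundary
exceeds the radius of the mollifier. -/
theorem fderiv_mollify (φ : ContDiffBump (0 : Plane)) {Ω : Set Plane} {i : Fin 2}
    {u g : Plane → ℝ} (hu : LocallyIntegrable u) (h : HasWeakPartial Ω i u g) {x : Plane}
    (hx : Metric.closedBall x φ.rOut ⊆ Ω) :
    fderiv ℝ (mollify φ u) x (basisVec i) = mollify φ g x := by
  have hc : HasCompactSupport (φ.normed (volume : Measure Plane)) := φ.hasCompactSupport_normed
  have hs : ContDiff ℝ 1 (φ.normed (volume : Measure Plane)) := φ.contDiff_normed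
  have hd := hc.hasFDerivAt_convolution_left (ContinuousLinearMap.lsmul ℝ ℝ) hs hu x
  have hex : ConvolutionExistsAt (fderiv ℝ (φ.normed volume)) u x
      (ContinuousLinearMap.precompL Plane (ContinuousLinearMap.lsmul ℝ ℝ : ℝ →L[ℝ] ℝ →L[ℝ] ℝ))
      volume :=
    (hc.fderiv ℝ).convolutionExists_left _ (hs.continuous_fderiv one_ne_zero) hu x
  rw [show mollify φ u = convolution (φ.normed volume) u (ContinuousLinearMap.lsmul ℝ ℝ) volume
    from rfl, hd.fderiv, convolution, ContinuousLinearMap.integral_apply hex]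
  have htest := isTestFunction_translate_bump φ hx
  have e := h.integral_eq htest
  have hder : ∀ y, fderiv ℝ (fun y => φ.normed volume (x - y)) y (basisVec i) =
      -fderiv ℝ (φ.normed volume) (x - y) (basisVec i) := by
    intro y
    have h1 : HasFDerivAt (fun y : Plane => x - y) (-ContinuousLinearMap.id ℝ Plane) y :=
      (hasFDerivAt_id y).const_sub x
    have h2 := ((hs.differentiable one_ne_zero) (x - y)).hasFDerivAt.comp y h1
    rw [show (fun y => φ.normed volume (x - y)) = φ.normed volume ∘ fun y => x - y from rfl,
      h2.fderiv]
    simp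
  have e1 : ∫ t, ((ContinuousLinearMap.precompL Plane
      (ContinuousLinearMap.lsmul ℝ ℝ : ℝ →L[ℝ] ℝ →L[ℝ] ℝ))
      (fderiv ℝ (φ.normed volume) t) (u (x - t))) (basisVec i) =
      ∫ y, fderiv ℝ (φ.normed volume) (x - y) (basisVec i) * u y := by
    rw [← integral_sub_left_eq_self _ volume x]
    simp [ContinuousLinearMap.precompL_apply]
  rw [e1, mollify_apply_swap]
  simp only [hder, mul_neg, integral_neg, neg_inj] at e
  simp only [smul_eq_mul, mul_comm] at e ⊢
  exact e

theorem norm_mollify_le_of_ae (φ : ContDiffBump (0 : Plane)) {u : Plane → F} {M : ℝ}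
    (hM : ∀ᵐ y, ‖u y‖ ≤ M) (x : Plane) : ‖mollify φ u x‖ ≤ M := by
  rw [mollify_apply_swap]
  have hi : Integrable fun y => φ.normed volume (x - y) :=
    φ.integrable_normed.comp_sub_left x
  have h1 : ∫ y, φ.normed volume (x - y) * M = M := by
    rw [integral_mul_const, integral_sub_left_eq_self (φ.normed volume) volume x,
      φ.integral_normed, one_mul]
  refine (norm_integral_le_of_norm_le (hi.mul_const M) ?_).trans h1.le
  filter_upwards [hM] with y hy
  rw [norm_smul, Real.norm_of_nonneg (φ.nonneg_normed _)]
  exact mul_le_mul_of_nonneg_left hy (φ.nonneg_normed _)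

theorem lintegral_bump (φ : ContDiffBump (0 : Plane)) :
    ∫⁻ t, ENNReal.ofReal (φ.normed volume t) = 1 := by
  rw [← ofReal_integral_eq_lintegral_ofReal φ.integrable_normed
    (Eventually.of_forall φ.nonneg_normed), φ.integral_normed, ENNReal.ofReal_one]

/-- Mollification does not increase the `L²` norm, by the Cauchy–Schwarz inequality for the
probability density of the mollifier. -/
theorem lintegral_sq_mollify_le (φ : ContDiffBump (0 : Plane)) {u : Plane → F}
    (hu : AEStronglyMeasurable u) :
    ∫⁻ x, ‖mollify φ u x‖ₑ ^ 2 ≤ ∫⁻ x, ‖u x‖ₑ ^ 2 := by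
  set ρ : Plane → ℝ≥0∞ := fun t => ENNReal.ofReal (φ.normed volume t) with hρ
  have hρm : Measurable ρ := φ.continuous_normed.measurable.ennreal_ofReal
  have hsub : ∀ x : Plane, MeasurePreserving (fun t : Plane => x - t) volume volume :=
    fun x => Measure.measurePreserving_sub_left volume x
  have hn : ∀ x : Plane, AEMeasurable (fun t => ‖u (x - t)‖ₑ) := fun x =>
    (hu.comp_measurePreserving (hsub x)).enorm
  have key : ∀ x, ‖mollify φ u x‖ₑ ^ 2 ≤ ∫⁻ t, ρ t * ‖u (x - t)‖ₑ ^ 2 := by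
    intro x
    have h1 : ‖mollify φ u x‖ₑ ≤ ∫⁻ t, ρ t * ‖u (x - t)‖ₑ := by
      rw [mollify_apply]
      refine (enorm_integral_le_lintegral_enorm _).trans (lintegral_mono fun t => ?_)
      rw [enorm_smul, Real.enorm_of_nonneg (φ.nonneg_normed _)]
    have h2 : ∫⁻ t, ρ t * ‖u (x - t)‖ₑ ≤ (∫⁻ t, ρ t * ‖u (x - t)‖ₑ ^ 2) ^ (1 / 2 : ℝ) := by
      have h3 := ENNReal.lintegral_mul_le_Lp_mul_Lq volume (p := 2) (q := 2)
        (Real.HolderConjugate.two_two) (f := fun t => ρ t ^ (1 / 2 : ℝ))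
        (g := fun t => ρ t ^ (1 / 2 : ℝ) * ‖u (x - t)‖ₑ) (hρm.pow_const _).aemeasurable
        ((hρm.pow_const _).aemeasurable.mul (hn x))
      have hh : ∀ a : ℝ≥0∞, a ^ (1 / 2 : ℝ) * a ^ (1 / 2 : ℝ) = a := fun a => by
        rw [← ENNReal.rpow_add_of_nonneg _ _ (by norm_num) (by norm_num)]; norm_num
      have hh2 : ∀ a : ℝ≥0∞, (a ^ (1 / 2 : ℝ)) ^ (2 : ℝ) = a := fun a => by
        rw [← ENNReal.rpow_mul]; norm_num
      simp only [Pi.mul_apply, ← mul_assoc, hh, ENNReal.mul_rpow_of_nonneg _ _ zero_le_two,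
        hh2, ENNReal.rpow_two] at h3
      rwa [lintegral_bump, ENNReal.one_rpow, one_mul] at h3
    calc ‖mollify φ u x‖ₑ ^ 2 ≤ ((∫⁻ t, ρ t * ‖u (x - t)‖ₑ ^ 2) ^ (1 / 2 : ℝ)) ^ 2 := by
          gcongr; exact h1.trans h2
      _ = _ := by rw [← ENNReal.rpow_two, ← ENNReal.rpow_mul]; norm_num
  have hjoint : AEMeasurable (fun p : Plane × Plane => ρ p.2 * ‖u (p.1 - p.2)‖ₑ ^ 2)
      (volume.prod volume) := by
    refine (hρm.comp measurable_snd).aemeasurable.mul (AEMeasurable.pow_const ?_ 2)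
    exact (hu.comp_quasiMeasurePreserving (quasiMeasurePreserving_sub volume volume)).enorm
  calc ∫⁻ x, ‖mollify φ u x‖ₑ ^ 2 ≤ ∫⁻ x, ∫⁻ t, ρ t * ‖u (x - t)‖ₑ ^ 2 := lintegral_mono key
    _ = ∫⁻ t, ∫⁻ x, ρ t * ‖u (x - t)‖ₑ ^ 2 := lintegral_lintegral_swap hjoint
    _ = ∫⁻ t, ρ t * ∫⁻ x, ‖u x‖ₑ ^ 2 := by
        congr 1; ext t
        rw [lintegral_const_mul' _ _ ENNReal.ofReal_ne_top,
          lintegral_sub_right_eq_self (fun x => ‖u x‖ₑ ^ 2) t]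
    _ = ∫⁻ x, ‖u x‖ₑ ^ 2 := by
        rw [lintegral_mul_const _ hρm, lintegral_bump, one_mul]

end Mollify

/-- The mollifier of radius `r`. -/
def bumpOfRadius (r : ℝ) (hr : 0 < r) : ContDiffBump (0 : Plane) :=
  ⟨r / 2, r, by positivity, by linarith⟩

/-- Lebesgue differentiation: mollifications converge almost everywhere when the radius tends to
zero. -/
theorem ae_tendsto_mollify {F : Type*} [NormedAddCommGroup F] [NormedSpace ℝ F] [CompleteSpace F]
    {u : Plane → F} (hu : LocallyIntegrable u) {r : ℕ → ℝ} (hr : ∀ n, 0 < r n)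
    (h0 : Tendsto r atTop (𝓝 0)) :
    ∀ᵐ x, Tendsto (fun n => mollify (bumpOfRadius (r n) (hr n)) u x) atTop (𝓝 (u x)) :=
  ContDiffBump.ae_convolution_tendsto_right_of_locallyIntegrable (K := 2) h0
    (Eventually.of_forall fun n => by simp only [bumpOfRadius]; linarith) hu

/-! ### Coordinates, areas and integrals over triangles -/

theorem inner_eq_coords (v w : Plane) : inner ℝ v w = v 0 * w 0 + v 1 * w 1 := by
  simp [PiLp.inner_apply, Fin.sum_univ_two, mul_comm]

theorem norm_sq_eq_coords (v : Plane) : ‖v‖ ^ 2 = v 0 ^ 2 + v 1 ^ 2 := by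
  rw [← real_inner_self_eq_norm_sq, inner_eq_coords]; ring

/-- The determinant of two vectors of the plane. -/
def det2 (b c : Plane) : ℝ := b 0 * c 1 - b 1 * c 0

/-- Cramer's rule as a norm estimate: a vector is controlled by its components in two directions. -/
theorem norm_mul_abs_det2_le (g b c : Plane) :
    ‖g‖ * |det2 b c| ≤ |inner ℝ g b| * ‖c‖ + |inner ℝ g c| * ‖b‖ := by
  have h1 : (‖g‖ * |det2 b c|) ^ 2 = ‖inner ℝ g b • c - inner ℝ g c • b‖ ^ 2 := by
    rw [mul_pow, sq_abs, norm_sq_eq_coords, norm_sq_eq_coords]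
    simp only [inner_eq_coords, det2, PiLp.sub_apply, PiLp.smul_apply, smul_eq_mul]
    ring
  have h2 : ‖g‖ * |det2 b c| = ‖inner ℝ g b • c - inner ℝ g c • b‖ := by
    rwa [sq_eq_sq₀ (by positivity) (by positivity)] at h1
  rw [h2]
  refine (norm_sub_le _ _).trans_eq ?_
  rw [norm_smul, norm_smul, Real.norm_eq_abs, Real.norm_eq_abs]

/-- Integration over a rectangle in the plane, as an iterated integral. -/
theorem setLIntegral_rectangle {I J : Set ℝ} (hI : MeasurableSet I) (hJ : MeasurableSet J)
    {F : Plane → ℝ≥0∞} (hF : Measurable F) :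
    ∫⁻ y in {y : Plane | y 0 ∈ I ∧ y 1 ∈ J}, F y =
      ∫⁻ t in J, ∫⁻ s in I, F !₂[s, t] := by
  have e : MeasurePreserving (fun q : ℝ × ℝ => (!₂[q.1, q.2] : Plane)) volume volume :=
    (PiLp.volume_preserving_toLp (Fin 2)).comp (volume_preserving_finTwoArrow ℝ).symm
  have hm : MeasurableSet {y : Plane | y 0 ∈ I ∧ y 1 ∈ J} :=
    ((by fun_prop : Measurable fun y : Plane => y 0) hI).inter
      ((by fun_prop : Measurable fun y : Plane => y 1) hJ)
  have hp : (fun q : ℝ × ℝ => (!₂[q.1, q.2] : Plane)) ⁻¹' {y : Plane | y 0 ∈ I ∧ y 1 ∈ J} =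
      I ×ˢ J := by
    ext q; simp
  rw [← e.setLIntegral_comp_preimage hm hF, hp, Measure.volume_eq_prod]
  exact setLIntegral_prod_symm (fun q : ℝ × ℝ => F !₂[q.1, q.2])
    (hF.comp e.measurable).aemeasurable

/-- The open triangle with vertex `A` and edge vectors `b`, `c`. -/
def openTri (A b c : Plane) : Set Plane :=
  {x | ∃ s t : ℝ, 0 < s ∧ 0 < t ∧ s + t < 1 ∧ x = A + s • b + t • c}

/-- An open triangle is cut out by its barycentric coordinates, which are given by Cramer's rule. -/
theorem mem_openTri_iff {A b c : Plane} (h : det2 b c ≠ 0) {x : Plane} :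
    x ∈ openTri A b c ↔ 0 < det2 (x - A) c / det2 b c ∧ 0 < det2 b (x - A) / det2 b c ∧
      det2 (x - A) c / det2 b c + det2 b (x - A) / det2 b c < 1 := by
  have hd : b 0 * c 1 - b 1 * c 0 ≠ 0 := h
  constructor
  · rintro ⟨s, t, hs, ht, hst, rfl⟩
    have e1 : det2 (A + s • b + t • c - A) c / det2 b c = s := by
      rw [div_eq_iff h]; simp [det2]; ring
    have e2 : det2 b (A + s • b + t • c - A) / det2 b c = t := by
      rw [div_eq_iff h]; simp [det2]; ring
    rw [e1, e2]
    exact ⟨hs, ht, hst⟩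
  · rintro ⟨h1, h2, h3⟩
    refine ⟨_, _, h1, h2, h3, ?_⟩
    ext i
    fin_cases i
    · simp only [det2, PiLp.add_apply, PiLp.smul_apply, PiLp.sub_apply, smul_eq_mul, Fin.zero_eta]
      generalize hD : b 0 * c 1 - b 1 * c 0 = D at hd ⊢
      field_simp
      rw [← hD]
      ring
    · simp only [det2, PiLp.add_apply, PiLp.smul_apply, PiLp.sub_apply, smul_eq_mul, Fin.mk_one]
      generalize hD : b 0 * c 1 - b 1 * c 0 = D at hd ⊢
      field_simp
      rw [← hD]
      ring

theorem isOpen_openTri (A : Plane) {b c : Plane} (h : det2 b c ≠ 0) : IsOpen (openTri A b c) := by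
  have : openTri A b c = {x | 0 < det2 (x - A) c / det2 b c} ∩
      ({x | 0 < det2 b (x - A) / det2 b c} ∩
      {x | det2 (x - A) c / det2 b c + det2 b (x - A) / det2 b c < 1}) := by
    ext x; exact mem_openTri_iff h
  rw [this]
  refine (isOpen_lt continuous_const ?_).inter ((isOpen_lt continuous_const ?_).inter
    (isOpen_lt ?_ continuous_const)) <;> simp only [det2] <;> fun_prop

/-- The parametrization of a triangle by the unit square which contracts one side to a vertex. -/
def duffy (A b c y : Plane) : Plane := A + (y 0 * (1 - y 1)) • b + y 1 • c

theorem duffy_image (A b c : Plane) :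
    duffy A b c '' {y : Plane | y 0 ∈ Ioo 0 1 ∧ y 1 ∈ Ioo 0 1} = openTri A b c := by
  ext x
  constructor
  · rintro ⟨y, ⟨⟨h1, h2⟩, h3, h4⟩, rfl⟩
    exact ⟨_, _, mul_pos h1 (by linarith), h3, by nlinarith, rfl⟩
  · rintro ⟨s, t, hs, ht, hst, rfl⟩
    have h1 : 0 < 1 - t := by linarith
    refine ⟨!₂[s / (1 - t), t], ⟨⟨?_, ?_⟩, ?_, ?_⟩, ?_⟩
    · simpa using div_pos hs h1
    · simp only [Matrix.cons_val_zero]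
      rw [div_lt_one h1]; linarith
    · simpa using ht
    · simp; linarith
    · simp [duffy, div_mul_cancel₀ _ h1.ne']

/-- The derivative of `duffy`. -/
def duffyDeriv (b c y : Plane) : Plane →L[ℝ] Plane :=
  ((1 - y 1) • EuclideanSpace.proj (𝕜 := ℝ) (0 : Fin 2) -
    y 0 • EuclideanSpace.proj (𝕜 := ℝ) (1 : Fin 2)).smulRight b +
    (EuclideanSpace.proj (𝕜 := ℝ) (1 : Fin 2) : Plane →L[ℝ] ℝ).smulRight c

theorem hasFDerivAt_duffy (A b c y : Plane) :
    HasFDerivAt (duffy A b c) (duffyDeriv b c y) y := by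
  have p0 : HasFDerivAt (fun y : Plane => y 0) (EuclideanSpace.proj (𝕜 := ℝ) (0 : Fin 2)) y :=
    (EuclideanSpace.proj (𝕜 := ℝ) (0 : Fin 2) : Plane →L[ℝ] ℝ).hasFDerivAt
  have p1 : HasFDerivAt (fun y : Plane => y 1) (EuclideanSpace.proj (𝕜 := ℝ) (1 : Fin 2)) y :=
    (EuclideanSpace.proj (𝕜 := ℝ) (1 : Fin 2) : Plane →L[ℝ] ℝ).hasFDerivAt
  have h := ((hasFDerivAt_const A y).add ((p0.mul (p1.const_sub 1)).smul_const b)).add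
    (p1.smul_const c)
  refine h.congr_fderiv ?_
  ext v i
  simp [duffyDeriv]
  exact Or.inl (by ring)

theorem det_duffyDeriv (b c y : Plane) : (duffyDeriv b c y).det = (1 - y 1) * det2 b c := by
  rw [ContinuousLinearMap.det,
    ← LinearMap.det_toMatrix (EuclideanSpace.basisFun (Fin 2) ℝ).toBasis, Matrix.det_fin_two]
  simp [LinearMap.toMatrix_apply, duffyDeriv, det2]
  ring

theorem duffy_injOn {A b c : Plane} (h : det2 b c ≠ 0) :
    InjOn (duffy A b c) {y : Plane | y 0 ∈ Ioo 0 1 ∧ y 1 ∈ Ioo 0 1} := by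
  intro y hy z hz hyz
  have h0 := congrArg (fun v : Plane => v 0) hyz
  have h1 := congrArg (fun v : Plane => v 1) hyz
  simp only [duffy, PiLp.add_apply, PiLp.smul_apply, smul_eq_mul] at h0 h1
  have e1 : (y 1 - z 1) * det2 b c = 0 := by
    simp only [det2]; linear_combination b 0 * h1 - b 1 * h0
  have e1' : y 1 = z 1 := by
    rcases mul_eq_zero.1 e1 with e | e
    · linarith
    · exact absurd e h
  have e2 : (y 0 - z 0) * (1 - z 1) * det2 b c = 0 := by
    rw [e1'] at h0 h1
    simp only [det2]; linear_combination c 1 * h0 - c 0 * h1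
  have hz1 : 1 - z 1 ≠ 0 := by have := hz.2.2; linarith
  have e2' : y 0 = z 0 := by
    rcases mul_eq_zero.1 e2 with e | e
    · rcases mul_eq_zero.1 e with e | e
      · linarith
      · exact absurd e hz1
    · exact absurd e h
  ext i
  fin_cases i
  · exact e2'
  · exact e1'

/-- Integration over a triangle by iterated integrals. -/
theorem setLIntegral_openTri {A b c : Plane} (h : det2 b c ≠ 0) {F : Plane → ℝ≥0∞}
    (hF : Measurable F) :
    ∫⁻ x in openTri A b c, F x = ENNReal.ofReal |det2 b c| *
      ∫⁻ t in Ioo (0 : ℝ) 1, ∫⁻ s in Ioo (0 : ℝ) 1,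
        ENNReal.ofReal (1 - t) * F (A + (s * (1 - t)) • b + t • c) := by
  have hd : Measurable (duffy A b c) :=
    (continuous_iff_continuousAt.2 fun y => (hasFDerivAt_duffy A b c y).continuousAt).measurable
  have hm : MeasurableSet {y : Plane | y 0 ∈ Ioo (0 : ℝ) 1 ∧ y 1 ∈ Ioo (0 : ℝ) 1} :=
    ((by fun_prop : Measurable fun y : Plane => y 0) measurableSet_Ioo).inter
      ((by fun_prop : Measurable fun y : Plane => y 1) measurableSet_Ioo)
  rw [← duffy_image, lintegral_image_eq_lintegral_abs_det_fderiv_mul volume hm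
    (fun y _ => (hasFDerivAt_duffy A b c y).hasFDerivWithinAt) (duffy_injOn h)]
  simp only [det_duffyDeriv]
  have hm2 : Measurable fun y : Plane => ENNReal.ofReal (1 - y 1) * F (duffy A b c y) := by
    refine Measurable.mul ?_ (hF.comp hd)
    fun_prop
  have e1 : ∫⁻ y in {y : Plane | y 0 ∈ Ioo (0 : ℝ) 1 ∧ y 1 ∈ Ioo (0 : ℝ) 1},
      ENNReal.ofReal |(1 - y 1) * det2 b c| * F (duffy A b c y) =
      ∫⁻ y in {y : Plane | y 0 ∈ Ioo (0 : ℝ) 1 ∧ y 1 ∈ Ioo (0 : ℝ) 1},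
        ENNReal.ofReal |det2 b c| * (ENNReal.ofReal (1 - y 1) * F (duffy A b c y)) := by
    refine setLIntegral_congr_fun hm fun y hy => ?_
    have : 0 ≤ 1 - y 1 := by have := hy.2.2; linarith
    simp only
    rw [abs_mul, abs_of_nonneg this, mul_comm (1 - y 1), ENNReal.ofReal_mul (abs_nonneg _),
      mul_assoc]
  rw [e1, lintegral_const_mul _ hm2, setLIntegral_rectangle measurableSet_Ioo measurableSet_Ioo hm2]
  simp [duffy]

theorem volume_openTri {A b c : Plane} (h : det2 b c ≠ 0) :
    volume (openTri A b c) = ENNReal.ofReal (|det2 b c| / 2) := by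
  have := setLIntegral_openTri (A := A) h (F := fun _ => 1) measurable_const
  simp only [lintegral_const, mul_one, one_mul, Measure.restrict_apply MeasurableSet.univ,
    univ_inter, Real.volume_Ioo, sub_zero, ENNReal.ofReal_one] at this
  rw [this, ← ofReal_integral_eq_lintegral_ofReal, ← ENNReal.ofReal_mul (abs_nonneg _)]
  · congr 1
    rw [← integral_Ioc_eq_integral_Ioo, ← intervalIntegral.integral_of_le zero_le_one]
    have hI : ∫ t in (0 : ℝ)..1, (1 - t) = 1 / 2 := by
      rw [intervalIntegral.integral_sub (by simp) (by simp)]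
      norm_num
    rw [hI]
    ring
  · exact (by fun_prop : Continuous fun t : ℝ => 1 - t).integrableOn_Icc.mono_set
      Ioo_subset_Icc_self
  · refine (ae_restrict_iff' measurableSet_Ioo).2 (Eventually.of_forall fun t ht => ?_)
    simp only [Pi.zero_apply]
    linarith [ht.2]

/-! ### A Poincaré inequality with vanishing mean on one edge -/

theorem sq_lintegral_le_of_measure_univ_le_one {α : Type*} [MeasurableSpace α] {μ : Measure α}
    (hμ : μ univ ≤ 1) {f : α → ℝ≥0∞} (hf : AEMeasurable f μ) :
    (∫⁻ x, f x ∂μ) ^ 2 ≤ ∫⁻ x, f x ^ 2 ∂μ := by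
  have h := ENNReal.lintegral_mul_le_Lp_mul_Lq μ Real.HolderConjugate.two_two hf
    (aemeasurable_const (b := 1))
  simp only [Pi.mul_apply, mul_one, ENNReal.rpow_two, one_pow, lintegral_const, one_mul] at h
  calc (∫⁻ x, f x ∂μ) ^ 2
      ≤ ((∫⁻ x, f x ^ 2 ∂μ) ^ (1 / 2 : ℝ) * μ univ ^ (1 / 2 : ℝ)) ^ 2 := by gcongr
    _ ≤ ((∫⁻ x, f x ^ 2 ∂μ) ^ (1 / 2 : ℝ) * 1) ^ 2 := by
        gcongr
        exact ENNReal.rpow_le_one hμ (by norm_num)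
    _ = ∫⁻ x, f x ^ 2 ∂μ := by
        rw [mul_one, ← ENNReal.rpow_two, ← ENNReal.rpow_mul]; norm_num

/-- The fundamental theorem of calculus as an estimate, with values in `ℝ≥0∞`. -/
theorem enorm_sub_le_lintegral_Ioo {f f' : ℝ → ℝ} (hf : ∀ x, HasDerivAt f (f' x) x)
    (hc : Continuous f') {a b x y : ℝ} (hx : x ∈ Icc a b) (hy : y ∈ Icc a b) :
    ‖f x - f y‖ₑ ≤ ∫⁻ r in Ioo a b, ‖f' r‖ₑ := by
  have hd : deriv f = f' := funext fun x => (hf x).deriv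
  have hC : ContDiff ℝ 1 f := contDiff_one_iff_deriv.2 ⟨fun x => (hf x).differentiableAt, hd ▸ hc⟩
  wlog hxy : y ≤ x generalizing x y
  · rw [← enorm_neg, neg_sub]
    exact this hy hx (le_of_not_ge hxy)
  refine (enorm_sub_le_lintegral_deriv_of_contDiffOn_Icc hC.contDiffOn hxy).trans ?_
  rw [hd, restrict_Ioo_eq_restrict_Icc]
  exact lintegral_mono_set (Icc_subset_Icc hy.1 hx.2)

theorem add_sq_le_two_mul (a b : ℝ≥0∞) : (a + b) ^ 2 ≤ 2 * a ^ 2 + 2 * b ^ 2 := by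
  have := ENNReal.rpow_add_le_mul_rpow_add_rpow a b (p := 2) (by norm_num)
  norm_num at this
  simpa [mul_add] using this

/-- A weighted Poincaré inequality on the unit square for functions with mean zero on the bottom
side. A point is joined to the bottom side by a horizontal and a vertical segment; the weight
decreases along the vertical one. -/
theorem poincare_square {V Vs Vt : ℝ → ℝ → ℝ}
    (hs : ∀ s t, HasDerivAt (fun s => V s t) (Vs s t) s)
    (ht : ∀ s t, HasDerivAt (fun t => V s t) (Vt s t) t)
    (hcs : Continuous fun q : ℝ × ℝ => Vs q.1 q.2) (hct : Continuous fun q : ℝ × ℝ => Vt q.1 q.2)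
    (hmean : ∫ s in Ioo (0 : ℝ) 1, V s 0 = 0) :
    ∫⁻ t in Ioo (0 : ℝ) 1, ∫⁻ s in Ioo (0 : ℝ) 1, ENNReal.ofReal (1 - t) * ‖V s t‖ₑ ^ 2 ≤
      2 * (∫⁻ t in Ioo (0 : ℝ) 1, ∫⁻ s in Ioo (0 : ℝ) 1,
        ENNReal.ofReal (1 - t) * ‖Vs s t‖ₑ ^ 2) +
      2 * (∫⁻ t in Ioo (0 : ℝ) 1, ∫⁻ s in Ioo (0 : ℝ) 1,
        ENNReal.ofReal (1 - t) * ‖Vt s t‖ₑ ^ 2) := by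
  have hprob : IsProbabilityMeasure (volume.restrict (Ioo (0 : ℝ) 1)) := ⟨by simp⟩
  set ν := volume.restrict (Ioo (0 : ℝ) 1) with hν
  have hV0 : Integrable (fun s => V s 0) ν :=
    ((continuous_iff_continuousAt.2 fun s => (hs s 0).continuousAt).integrableOn_Icc).mono_set
      Ioo_subset_Icc_self
  have hctρ : ∀ ρ, Continuous fun τ => Vt ρ τ := fun ρ =>
    hct.comp (by fun_prop : Continuous fun τ : ℝ => (ρ, τ))
  have hcst : ∀ t, Continuous fun s => Vs s t := fun t =>
    hcs.comp (by fun_prop : Continuous fun s : ℝ => (s, t))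
  have hmt : Measurable fun q : ℝ × ℝ => ‖Vt q.1 q.2‖ₑ := hct.measurable.enorm
  have hms : Measurable fun q : ℝ × ℝ => ‖Vs q.1 q.2‖ₑ := hcs.measurable.enorm
  set B := ∫⁻ t, ∫⁻ s, ENNReal.ofReal (1 - t) * ‖Vt s t‖ₑ ^ 2 ∂ν ∂ν with hB
  have key : ∀ t ∈ Ioo (0 : ℝ) 1, ∀ σ ∈ Ioo (0 : ℝ) 1,
      ENNReal.ofReal (1 - t) * ‖V σ t‖ₑ ^ 2 ≤
        2 * ∫⁻ s, ENNReal.ofReal (1 - t) * ‖Vs s t‖ₑ ^ 2 ∂ν + 2 * B := by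
    intro t ht' σ hσ
    have hmb : Measurable fun ρ => ∫⁻ τ in Ioo 0 t, ‖Vt ρ τ‖ₑ := hmt.lintegral_prod_right'
    have h1 : ‖V σ t‖ₑ ≤ (∫⁻ r, ‖Vs r t‖ₑ ∂ν) + ∫⁻ ρ, (∫⁻ τ in Ioo 0 t, ‖Vt ρ τ‖ₑ) ∂ν := by
      -- subtract the mean on the bottom side and pass from `(σ, t)` to `(ρ, 0)` through `(ρ, t)`
      have e : V σ t = ∫ ρ, (V σ t - V ρ 0) ∂ν := by
        rw [integral_sub (integrable_const _) hV0, hmean]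
        simp
      rw [e]
      refine (enorm_integral_le_lintegral_enorm _).trans ?_
      have e2 : ∫⁻ r, ‖Vs r t‖ₑ ∂ν = ∫⁻ _, ∫⁻ r, ‖Vs r t‖ₑ ∂ν ∂ν := by simp
      rw [e2, ← lintegral_add_left measurable_const]
      refine setLIntegral_mono' measurableSet_Ioo fun ρ hρ => ?_
      calc ‖V σ t - V ρ 0‖ₑ = ‖(V σ t - V ρ t) + (V ρ t - V ρ 0)‖ₑ := by congr 1; ring
        _ ≤ ‖V σ t - V ρ t‖ₑ + ‖V ρ t - V ρ 0‖ₑ := enorm_add_le _ _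
        _ ≤ _ := add_le_add
          (enorm_sub_le_lintegral_Ioo (hs · t) (hcst t) (Ioo_subset_Icc_self hσ)
            (Ioo_subset_Icc_self hρ))
          (enorm_sub_le_lintegral_Ioo (ht ρ) (hctρ ρ) (right_mem_Icc.2 ht'.1.le)
            (left_mem_Icc.2 ht'.1.le))
    have ha : (∫⁻ r, ‖Vs r t‖ₑ ∂ν) ^ 2 ≤ ∫⁻ r, ‖Vs r t‖ₑ ^ 2 ∂ν :=
      sq_lintegral_le_of_measure_univ_le_one (by simp) (hcst t).measurable.enorm.aemeasurable
    have hb : (∫⁻ ρ, (∫⁻ τ in Ioo 0 t, ‖Vt ρ τ‖ₑ) ∂ν) ^ 2 ≤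
        ∫⁻ ρ, (∫⁻ τ in Ioo 0 t, ‖Vt ρ τ‖ₑ ^ 2) ∂ν := by
      refine (sq_lintegral_le_of_measure_univ_le_one prob_le_one hmb.aemeasurable).trans
        (lintegral_mono fun ρ => ?_)
      exact sq_lintegral_le_of_measure_univ_le_one (by simp [ht'.2.le])
        (hctρ ρ).measurable.enorm.aemeasurable
    -- the weight at height `t` is below the weight at every height `τ < t`
    have hB' : ENNReal.ofReal (1 - t) * ∫⁻ ρ, (∫⁻ τ in Ioo 0 t, ‖Vt ρ τ‖ₑ ^ 2) ∂ν ≤ B := by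
      have hsw : B = ∫⁻ s, ∫⁻ t, ENNReal.ofReal (1 - t) * ‖Vt s t‖ₑ ^ 2 ∂ν ∂ν :=
        lintegral_lintegral_swap (f := fun t s => ENNReal.ofReal (1 - t) * ‖Vt s t‖ₑ ^ 2)
          (Measurable.mul (by fun_prop) ((hmt.comp measurable_swap).pow_const 2)).aemeasurable
      rw [hsw, ← lintegral_const_mul' _ _ ENNReal.ofReal_ne_top]
      refine lintegral_mono fun ρ => ?_
      rw [← lintegral_const_mul' _ _ ENNReal.ofReal_ne_top]
      calc ∫⁻ τ in Ioo 0 t, ENNReal.ofReal (1 - t) * ‖Vt ρ τ‖ₑ ^ 2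
          ≤ ∫⁻ τ in Ioo 0 t, ENNReal.ofReal (1 - τ) * ‖Vt ρ τ‖ₑ ^ 2 := by
            refine setLIntegral_mono' measurableSet_Ioo fun τ hτ => ?_
            gcongr
            exact hτ.2.le
        _ ≤ _ := lintegral_mono_set (Ioo_subset_Ioo_right ht'.2.le)
    calc ENNReal.ofReal (1 - t) * ‖V σ t‖ₑ ^ 2
        ≤ ENNReal.ofReal (1 - t) * (2 * (∫⁻ r, ‖Vs r t‖ₑ ∂ν) ^ 2 +
            2 * (∫⁻ ρ, (∫⁻ τ in Ioo 0 t, ‖Vt ρ τ‖ₑ) ∂ν) ^ 2) := by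
          gcongr
          exact (pow_le_pow_left' h1 2).trans (add_sq_le_two_mul _ _)
      _ ≤ ENNReal.ofReal (1 - t) * (2 * (∫⁻ r, ‖Vs r t‖ₑ ^ 2 ∂ν) +
            2 * (∫⁻ ρ, (∫⁻ τ in Ioo 0 t, ‖Vt ρ τ‖ₑ ^ 2) ∂ν)) := by gcongr
      _ = 2 * (ENNReal.ofReal (1 - t) * ∫⁻ r, ‖Vs r t‖ₑ ^ 2 ∂ν) +
            2 * (ENNReal.ofReal (1 - t) * ∫⁻ ρ, (∫⁻ τ in Ioo 0 t, ‖Vt ρ τ‖ₑ ^ 2) ∂ν) := by ring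
      _ ≤ _ := by
          gcongr
          rw [lintegral_const_mul' _ _ ENNReal.ofReal_ne_top]
  have hA : Measurable fun t => ∫⁻ s, ENNReal.ofReal (1 - t) * ‖Vs s t‖ₑ ^ 2 ∂ν :=
    Measurable.lintegral_prod_right' (f := fun q : ℝ × ℝ =>
      ENNReal.ofReal (1 - q.1) * ‖Vs q.2 q.1‖ₑ ^ 2)
      (Measurable.mul (by fun_prop) ((hms.comp measurable_swap).pow_const 2))
  calc ∫⁻ t, ∫⁻ s, ENNReal.ofReal (1 - t) * ‖V s t‖ₑ ^ 2 ∂ν ∂ν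
      ≤ ∫⁻ t, ∫⁻ _, (2 * ∫⁻ s, ENNReal.ofReal (1 - t) * ‖Vs s t‖ₑ ^ 2 ∂ν + 2 * B) ∂ν ∂ν :=
        setLIntegral_mono' measurableSet_Ioo fun t ht' =>
          setLIntegral_mono' measurableSet_Ioo fun σ hσ => key t ht' σ hσ
    _ = _ := by
        simp only [lintegral_const, measure_univ, mul_one]
        rw [lintegral_add_right _ measurable_const, lintegral_const_mul _ hA]
        simp

/-! ### Interpolation errors of smooth functions -/

section Smooth

variable {e : Plane → ℝ} {A b c : Plane}

theorem hasDerivAt_line (he : ContDiff ℝ 2 e) (A b : Plane) (t : ℝ) :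
    HasDerivAt (fun t : ℝ => e (A + t • b)) (fderiv ℝ e (A + t • b) b) t := by
  have h1 : HasDerivAt (fun t : ℝ => A + t • b) b t := by
    simpa using ((hasDerivAt_id t).smul_const b).const_add A
  exact ((he.differentiable (by norm_num)) _).hasFDerivAt.comp_hasDerivAt t h1

/-- Pointwise bound for the derivative along an edge at whose end points the function vanishes: by
Rolle's theorem this derivative has a zero on the edge. -/
theorem abs_fderiv_edge_le (he : ContDiff ℝ 2 e) {S : Set Plane} (hS : Convex ℝ S)
    {d M : ℝ} (hd : ∀ x ∈ S, ∀ y ∈ S, ‖x - y‖ ≤ d) (hM0 : 0 ≤ M)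
    (hM : ∀ x ∈ S, ‖fderiv ℝ (fderiv ℝ e) x‖ ≤ M) (hA : A ∈ S) (hB : A + b ∈ S)
    (h0 : e A = 0) (h1 : e (A + b) = 0) {x : Plane} (hx : x ∈ S) :
    |fderiv ℝ e x b| ≤ M * d * ‖b‖ := by
  obtain ⟨t, ht, ht0⟩ := exists_hasDerivAt_eq_zero (f := fun t : ℝ => e (A + t • b))
    (f' := fun t => fderiv ℝ e (A + t • b) b) (a := 0) (b := 1) one_pos
    (continuousOn_of_forall_continuousAt fun t _ => (hasDerivAt_line he A b t).continuousAt)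
    (by simp [h0, h1]) (fun t _ => hasDerivAt_line he A b t)
  have hy : A + t • b ∈ S := by
    have := hS.add_smul_sub_mem hA hB (Ioo_subset_Icc_self ht)
    simpa using this
  have hdiff : Differentiable ℝ (fderiv ℝ e) :=
    (he.fderiv_right (m := 1) (by norm_num)).differentiable (by norm_num)
  have hlip := hS.norm_image_sub_le_of_norm_fderiv_le (f := fderiv ℝ e)
    (fun x _ => hdiff x) hM hy hx
  calc |fderiv ℝ e x b| = ‖(fderiv ℝ e x - fderiv ℝ e (A + t • b)) b‖ := by
        rw [sub_apply, ht0, sub_zero, Real.norm_eq_abs]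
    _ ≤ ‖fderiv ℝ e x - fderiv ℝ e (A + t • b)‖ * ‖b‖ := ContinuousLinearMap.le_opNorm _ _
    _ ≤ M * d * ‖b‖ := by
        gcongr
        exact hlip.trans (mul_le_mul_of_nonneg_left (hd _ hx _ hy) hM0)

/-- Pointwise bound for the gradient of a smooth function vanishing at the vertices of a triangle:
the derivatives along two edges are controlled, and they determine the gradient. -/
theorem norm_gradient_mul_det2_le (he : ContDiff ℝ 2 e) {S : Set Plane} (hS : Convex ℝ S)
    {d M : ℝ} (hd : ∀ x ∈ S, ∀ y ∈ S, ‖x - y‖ ≤ d) (hM0 : 0 ≤ M)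
    (hM : ∀ x ∈ S, ‖fderiv ℝ (fderiv ℝ e) x‖ ≤ M) (hA : A ∈ S) (hB : A + b ∈ S)
    (hC : A + c ∈ S) (h0 : e A = 0) (h1 : e (A + b) = 0) (h2 : e (A + c) = 0)
    {x : Plane} (hx : x ∈ S) :
    ‖gradient e x‖ * |det2 b c| ≤ 2 * M * d * (‖b‖ * ‖c‖) := by
  refine (norm_mul_abs_det2_le _ b c).trans ?_
  rw [inner_gradient_left, inner_gradient_left]
  have hb := abs_fderiv_edge_le he hS hd hM0 hM hA hB h0 h1 hx
  have hc := abs_fderiv_edge_le he hS hd hM0 hM hA hC h0 h2 hx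
  nlinarith [mul_le_mul_of_nonneg_right hb (norm_nonneg c),
    mul_le_mul_of_nonneg_right hc (norm_nonneg b)]

/-- Mean square bound for the derivative along an edge at whose end points the function vanishes:
this derivative has mean zero on the edge. -/
theorem lintegral_fderiv_edge_le (he : ContDiff ℝ 2 e) (hdet : det2 b c ≠ 0)
    (h0 : e A = 0) (h1 : e (A + b) = 0) :
    ∫⁻ x in openTri A b c, ‖fderiv ℝ e x b‖ₑ ^ 2 ≤
      6 * ∫⁻ x in openTri A b c,
        (‖fderiv ℝ (fderiv ℝ e) x b b‖ₑ ^ 2 + ‖fderiv ℝ (fderiv ℝ e) x c b‖ₑ ^ 2) := by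
  have hC1 : ContDiff ℝ 1 (fderiv ℝ e) := he.fderiv_right (by norm_num)
  have hdiff : Differentiable ℝ (fderiv ℝ e) := hC1.differentiable (by norm_num)
  have hcont2 : Continuous (fderiv ℝ (fderiv ℝ e)) := hC1.continuous_fderiv (by norm_num)
  have hcontW : ∀ v w, Continuous fun x => fderiv ℝ (fderiv ℝ e) x v w := fun v w =>
    (hcont2.clm_apply continuous_const).clm_apply continuous_const
  have hcontE : Continuous fun x => fderiv ℝ e x b := hC1.continuous.clm_apply continuous_const
  -- the coordinates in which the bottom side of the unit square becomes the edge `b`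
  set X : ℝ → ℝ → Plane := fun s t => A + (s * (1 - t)) • b + t • c with hX
  have hXc : Continuous fun q : ℝ × ℝ => X q.1 q.2 := by
    simp only [hX]; fun_prop
  have hXs : ∀ s t, HasDerivAt (fun s => X s t) ((1 - t) • b) s := fun s t => by
    have := ((((hasDerivAt_id s).mul_const (1 - t)).smul_const b).const_add A).add_const (t • c)
    simpa [hX] using this
  have hXt : ∀ s t, HasDerivAt (fun t => X s t) (c - s • b) t := fun s t => by
    have := (((((hasDerivAt_id t).const_sub 1).const_mul s).smul_const b).const_add A).add
      ((hasDerivAt_id t).smul_const c)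
    refine this.congr_deriv ?_
    simp; abel
  have hW : ∀ (Y : ℝ → Plane) (Y' : Plane) (r : ℝ), HasDerivAt Y Y' r →
      HasDerivAt (fun r => fderiv ℝ e (Y r) b) (fderiv ℝ (fderiv ℝ e) (Y r) Y' b) r := by
    intro Y Y' r hY
    have := (hdiff (Y r)).hasFDerivAt.comp_hasDerivAt r hY
    simpa using this.clm_apply (hasDerivAt_const r b)
  have hP := poincare_square (V := fun s t => fderiv ℝ e (X s t) b)
    (Vs := fun s t => fderiv ℝ (fderiv ℝ e) (X s t) ((1 - t) • b) b)
    (Vt := fun s t => fderiv ℝ (fderiv ℝ e) (X s t) (c - s • b) b)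
    (fun s t => hW _ _ _ (hXs s t)) (fun s t => hW _ _ _ (hXt s t))
    (((hcont2.comp hXc).clm_apply (by fun_prop)).clm_apply continuous_const)
    (((hcont2.comp hXc).clm_apply (by fun_prop)).clm_apply continuous_const)
    -- the mean over the edge is `e (A + b) - e A = 0`
    (by
      rw [← integral_Ioc_eq_integral_Ioo, ← intervalIntegral.integral_of_le zero_le_one]
      have hder : ∀ s : ℝ, HasDerivAt (fun s : ℝ => e (A + s • b)) (fderiv ℝ e (X s 0) b) s :=
        fun s => by simpa [hX] using hasDerivAt_line he A b s
      rw [intervalIntegral.integral_eq_sub_of_hasDerivAt (fun s _ => hder s)]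
      · simp [h0, h1]
      · exact (hcontE.comp (hXc.comp (by fun_prop : Continuous fun s : ℝ => (s, (0 : ℝ))))
          ).intervalIntegrable _ _)
  set G : Plane → ℝ≥0∞ := fun x =>
    ‖fderiv ℝ (fderiv ℝ e) x b b‖ₑ ^ 2 + ‖fderiv ℝ (fderiv ℝ e) x c b‖ₑ ^ 2 with hG
  have hGm : Measurable G := (((hcontW b b).measurable.enorm).pow_const 2).add
    (((hcontW c b).measurable.enorm).pow_const 2)
  rw [setLIntegral_openTri hdet (hcontE.measurable.enorm.pow_const 2),
    setLIntegral_openTri hdet hGm, mul_left_comm]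
  gcongr
  refine hP.trans ?_
  have hs' : ∀ t ∈ Ioo (0 : ℝ) 1, ∀ s ∈ Ioo (0 : ℝ) 1,
      ENNReal.ofReal (1 - t) * ‖fderiv ℝ (fderiv ℝ e) (X s t) ((1 - t) • b) b‖ₑ ^ 2 ≤
        ENNReal.ofReal (1 - t) * G (X s t) := by
    intro t ht s hs
    gcongr
    rw [map_smul, smul_apply, enorm_smul]
    have : ‖1 - t‖ₑ ≤ 1 := by
      rw [Real.enorm_of_nonneg (by linarith [ht.2])]
      exact ENNReal.ofReal_le_one.2 (by linarith [ht.1])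
    calc (‖1 - t‖ₑ * ‖fderiv ℝ (fderiv ℝ e) (X s t) b b‖ₑ) ^ 2
        ≤ (1 * ‖fderiv ℝ (fderiv ℝ e) (X s t) b b‖ₑ) ^ 2 := by gcongr
      _ ≤ G (X s t) := by rw [one_mul]; exact le_self_add
  have ht' : ∀ t ∈ Ioo (0 : ℝ) 1, ∀ s ∈ Ioo (0 : ℝ) 1,
      ENNReal.ofReal (1 - t) * ‖fderiv ℝ (fderiv ℝ e) (X s t) (c - s • b) b‖ₑ ^ 2 ≤
        2 * (ENNReal.ofReal (1 - t) * G (X s t)) := by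
    intro t ht s hs
    rw [mul_left_comm]
    gcongr
    rw [map_sub, sub_apply, map_smul, smul_apply]
    have : ‖s‖ₑ ≤ 1 := by
      rw [Real.enorm_of_nonneg hs.1.le]
      exact ENNReal.ofReal_le_one.2 hs.2.le
    calc ‖fderiv ℝ (fderiv ℝ e) (X s t) c b - s • fderiv ℝ (fderiv ℝ e) (X s t) b b‖ₑ ^ 2
        ≤ (‖fderiv ℝ (fderiv ℝ e) (X s t) c b‖ₑ +
            ‖s‖ₑ * ‖fderiv ℝ (fderiv ℝ e) (X s t) b b‖ₑ) ^ 2 := by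
          gcongr
          rw [← enorm_smul]
          exact enorm_sub_le
      _ ≤ (‖fderiv ℝ (fderiv ℝ e) (X s t) c b‖ₑ +
            1 * ‖fderiv ℝ (fderiv ℝ e) (X s t) b b‖ₑ) ^ 2 := by gcongr
      _ ≤ 2 * G (X s t) := by
          rw [one_mul]
          refine (add_sq_le_two_mul _ _).trans_eq ?_
          simp only [hG]; ring
  calc _ ≤ 2 * (∫⁻ t in Ioo (0 : ℝ) 1, ∫⁻ s in Ioo (0 : ℝ) 1,
          ENNReal.ofReal (1 - t) * G (X s t)) +
        2 * (∫⁻ t in Ioo (0 : ℝ) 1, ∫⁻ s in Ioo (0 : ℝ) 1,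
          2 * (ENNReal.ofReal (1 - t) * G (X s t))) := by
        gcongr 2 * ?_ + 2 * ?_
        · exact setLIntegral_mono' measurableSet_Ioo fun t ht =>
            setLIntegral_mono' measurableSet_Ioo fun s hs => hs' t ht s hs
        · exact setLIntegral_mono' measurableSet_Ioo fun t ht =>
            setLIntegral_mono' measurableSet_Ioo fun s hs => ht' t ht s hs
    _ = _ := by
        simp_rw [lintegral_const_mul' 2 _ ENNReal.ofNat_ne_top]
        rw [← mul_assoc, ← add_mul]
        norm_num [hX]

theorem openTri_swap (A b c : Plane) : openTri A c b = openTri A b c := by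
  ext x
  constructor <;>
  · rintro ⟨s, t, hs, ht, hst, rfl⟩
    exact ⟨t, s, ht, hs, by linarith, by abel⟩

theorem det2_swap (b c : Plane) : det2 c b = -det2 b c := by
  simp only [det2]; ring

/-- Mean square bound for the gradient of a smooth function vanishing at the vertices of a
triangle, in terms of a bound `N` for its second derivatives. The number `κ` bounds the square of
the sine of the angle between the edges `b` and `c` from below. -/
theorem lintegral_gradient_le (he : ContDiff ℝ 2 e) (hdet : det2 b c ≠ 0)
    (h0 : e A = 0) (h1 : e (A + b) = 0) (h2 : e (A + c) = 0) {h κ : ℝ} (hb : ‖b‖ ≤ h)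
    (hc : ‖c‖ ≤ h) (hκ : 0 < κ) (hκd : κ * (‖b‖ * ‖c‖) ^ 2 ≤ det2 b c ^ 2) {N : Plane → ℝ≥0∞}
    (hN : ∀ x ∈ openTri A b c, ‖fderiv ℝ (fderiv ℝ e) x‖ₑ ≤ N x) :
    ∫⁻ x in openTri A b c, ‖gradient e x‖ₑ ^ 2 ≤
      ENNReal.ofReal (48 * h ^ 2 / κ) * ∫⁻ x in openTri A b c, N x ^ 2 := by
  have hh : 0 ≤ h := (norm_nonneg b).trans hb
  have hE : ∀ v w : Plane, Measurable fun x => ENNReal.ofReal (‖v‖ ^ 2) * ‖fderiv ℝ e x w‖ₑ ^ 2 :=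
    fun v w => ((((he.continuous_fderiv (by norm_num)).clm_apply
      continuous_const).measurable.enorm.pow_const 2).const_mul _)
  have edge : ∀ b c : Plane, det2 b c ≠ 0 → e (A + b) = 0 → ‖b‖ ≤ h → ‖c‖ ≤ h →
      (∀ x ∈ openTri A b c, ‖fderiv ℝ (fderiv ℝ e) x‖ₑ ≤ N x) →
      ∫⁻ x in openTri A b c, ‖fderiv ℝ e x b‖ₑ ^ 2 ≤
        ENNReal.ofReal (12 * ‖b‖ ^ 2 * h ^ 2) * ∫⁻ x in openTri A b c, N x ^ 2 := by
    intro b c hdet h1 hb hc hN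
    refine (lintegral_fderiv_edge_le he hdet h0 h1).trans ?_
    rw [← lintegral_const_mul' _ _ ENNReal.ofReal_ne_top,
      ← lintegral_const_mul' _ _ (by norm_num : (6 : ℝ≥0∞) ≠ ⊤)]
    refine setLIntegral_mono' (isOpen_openTri A hdet).measurableSet fun x hx => ?_
    have hop : ∀ v : Plane, ‖v‖ ≤ h → ‖fderiv ℝ (fderiv ℝ e) x v b‖ₑ ^ 2 ≤
        ENNReal.ofReal (h ^ 2 * ‖b‖ ^ 2) * N x ^ 2 := by
      intro v hv
      have h3 : ‖fderiv ℝ (fderiv ℝ e) x v b‖ₑ ≤ ENNReal.ofReal (h * ‖b‖) * N x := by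
        calc ‖fderiv ℝ (fderiv ℝ e) x v b‖ₑ
            ≤ ENNReal.ofReal (h * ‖b‖ * ‖fderiv ℝ (fderiv ℝ e) x‖) := by
              rw [← ofReal_norm]
              refine ENNReal.ofReal_le_ofReal (((fderiv ℝ (fderiv ℝ e) x).le_opNorm₂ v b).trans ?_)
              calc ‖fderiv ℝ (fderiv ℝ e) x‖ * ‖v‖ * ‖b‖
                  = ‖v‖ * (‖b‖ * ‖fderiv ℝ (fderiv ℝ e) x‖) := by ring
                _ ≤ h * (‖b‖ * ‖fderiv ℝ (fderiv ℝ e) x‖) := by gcongr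
                _ = _ := by ring
          _ ≤ _ := by
              rw [ENNReal.ofReal_mul (by positivity)]
              gcongr
              exact (ofReal_norm (fderiv ℝ (fderiv ℝ e) x)).trans_le (hN x hx)
      calc _ ≤ (ENNReal.ofReal (h * ‖b‖) * N x) ^ 2 := by gcongr
        _ = _ := by rw [mul_pow, ← ENNReal.ofReal_pow (by positivity), mul_pow]
    calc 6 * (‖fderiv ℝ (fderiv ℝ e) x b b‖ₑ ^ 2 + ‖fderiv ℝ (fderiv ℝ e) x c b‖ₑ ^ 2)
        ≤ 6 * (ENNReal.ofReal (h ^ 2 * ‖b‖ ^ 2) * N x ^ 2 +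
            ENNReal.ofReal (h ^ 2 * ‖b‖ ^ 2) * N x ^ 2) := by
          gcongr
          · exact hop b hb
          · exact hop c hc
      _ = ENNReal.ofReal (12 * ‖b‖ ^ 2 * h ^ 2) * N x ^ 2 := by
          rw [show 12 * ‖b‖ ^ 2 * h ^ 2 = 12 * (h ^ 2 * ‖b‖ ^ 2) by ring,
            ENNReal.ofReal_mul (p := 12) (by norm_num), ENNReal.ofReal_ofNat]
          ring
  have htwo : ∀ x : ℝ, 2 * ENNReal.ofReal x = ENNReal.ofReal (2 * x) := fun x => by
    rw [ENNReal.ofReal_mul zero_le_two, ENNReal.ofReal_ofNat]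
  have eb := edge b c hdet h1 hb hc hN
  have ec := edge c b (by rw [det2_swap]; exact neg_ne_zero.2 hdet) h2 hc hb
    (by rwa [openTri_swap])
  rw [openTri_swap] at ec
  have hD : 0 < det2 b c ^ 2 := by positivity
  have hpt : ∀ x, ENNReal.ofReal (det2 b c ^ 2) * ‖gradient e x‖ₑ ^ 2 ≤
      2 * (ENNReal.ofReal (‖c‖ ^ 2) * ‖fderiv ℝ e x b‖ₑ ^ 2) +
      2 * (ENNReal.ofReal (‖b‖ ^ 2) * ‖fderiv ℝ e x c‖ₑ ^ 2) := by
    intro x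
    have h3 := norm_mul_abs_det2_le (gradient e x) b c
    rw [inner_gradient_left, inner_gradient_left] at h3
    have e1 : ∀ r : ℝ, ‖r‖ₑ ^ 2 = ENNReal.ofReal (|r| ^ 2) := fun r => by
      rw [← ofReal_norm, ← ENNReal.ofReal_pow (norm_nonneg _), Real.norm_eq_abs]
    rw [e1, e1, ← ofReal_norm, ← ENNReal.ofReal_pow (norm_nonneg _),
      ← ENNReal.ofReal_mul (by positivity), ← ENNReal.ofReal_mul (by positivity),
      ← ENNReal.ofReal_mul (by positivity), htwo, htwo,
      ← ENNReal.ofReal_add (by positivity) (by positivity)]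
    refine ENNReal.ofReal_le_ofReal ?_
    have h4 : (‖gradient e x‖ * |det2 b c|) ^ 2 ≤ _ := pow_le_pow_left₀ (by positivity) h3 2
    rw [mul_pow, sq_abs] at h4
    nlinarith [sq_nonneg (|fderiv ℝ e x b| * ‖c‖ - |fderiv ℝ e x c| * ‖b‖)]
  set I := ∫⁻ x in openTri A b c, N x ^ 2 with hI
  have h5 : ENNReal.ofReal (det2 b c ^ 2) * ∫⁻ x in openTri A b c, ‖gradient e x‖ₑ ^ 2 ≤
      ENNReal.ofReal (48 * (‖b‖ * ‖c‖) ^ 2 * h ^ 2) * I := by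
    rw [← lintegral_const_mul' _ _ ENNReal.ofReal_ne_top]
    calc _ ≤ ∫⁻ x in openTri A b c, (2 * (ENNReal.ofReal (‖c‖ ^ 2) * ‖fderiv ℝ e x b‖ₑ ^ 2) +
          2 * (ENNReal.ofReal (‖b‖ ^ 2) * ‖fderiv ℝ e x c‖ₑ ^ 2)) := lintegral_mono hpt
      _ = 2 * (ENNReal.ofReal (‖c‖ ^ 2) * ∫⁻ x in openTri A b c, ‖fderiv ℝ e x b‖ₑ ^ 2) +
          2 * (ENNReal.ofReal (‖b‖ ^ 2) * ∫⁻ x in openTri A b c, ‖fderiv ℝ e x c‖ₑ ^ 2) := by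
          have e3 : ∀ v w : Plane, ∫⁻ x in openTri A b c,
              2 * (ENNReal.ofReal (‖v‖ ^ 2) * ‖fderiv ℝ e x w‖ₑ ^ 2) =
              2 * (ENNReal.ofReal (‖v‖ ^ 2) * ∫⁻ x in openTri A b c, ‖fderiv ℝ e x w‖ₑ ^ 2) :=
            fun v w => by
              rw [lintegral_const_mul' _ _ (by norm_num),
                lintegral_const_mul' _ _ ENNReal.ofReal_ne_top]
          rw [lintegral_add_left ((hE c b).const_mul 2), e3, e3]
      _ ≤ 2 * (ENNReal.ofReal (‖c‖ ^ 2) * (ENNReal.ofReal (12 * ‖b‖ ^ 2 * h ^ 2) * I)) +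
          2 * (ENNReal.ofReal (‖b‖ ^ 2) * (ENNReal.ofReal (12 * ‖c‖ ^ 2 * h ^ 2) * I)) := by
          gcongr
      _ = _ := by
          have e2 : ∀ x y : ℝ, 0 ≤ x → 2 * (ENNReal.ofReal x * (ENNReal.ofReal y * I)) =
              ENNReal.ofReal (2 * (x * y)) * I := fun x y hx => by
            rw [← htwo, ENNReal.ofReal_mul hx]
            ring
          rw [e2 _ _ (by positivity), e2 _ _ (by positivity), ← add_mul,
            ← ENNReal.ofReal_add (by positivity) (by positivity)]
          congr 2
          ring
  have h6 : ENNReal.ofReal (det2 b c ^ 2) * ∫⁻ x in openTri A b c, ‖gradient e x‖ₑ ^ 2 ≤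
      ENNReal.ofReal (det2 b c ^ 2) * (ENNReal.ofReal (48 * h ^ 2 / κ) * I) := by
    refine h5.trans ?_
    rw [← mul_assoc, ← ENNReal.ofReal_mul hD.le]
    gcongr ENNReal.ofReal ?_ * I
    rw [mul_div_assoc', le_div_iff₀ hκ]
    nlinarith [mul_le_mul_of_nonneg_left hκd (by positivity : 0 ≤ 48 * h ^ 2)]
  exact (ENNReal.mul_le_mul_iff_right (by simpa using hdet) ENNReal.ofReal_ne_top).1 h6

end Smooth

/-! ### From smooth to Sobolev functions on a triangle -/

theorem gradient_apply (f : Plane → ℝ) (x : Plane) (i : Fin 2) :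
    gradient f x i = fderiv ℝ f x (basisVec i) := by
  rw [← inner_gradient_left, inner_eq_coords]
  fin_cases i <;> simp

theorem eq_sum_basisVec (v : Plane) : v = v 0 • basisVec 0 + v 1 • basisVec 1 := by
  ext i
  fin_cases i <;> simp

/-- The operator norm of a bilinear form is at most the Frobenius norm of its matrix. -/
theorem opNorm_le_frobenius (B : Plane →L[ℝ] Plane →L[ℝ] ℝ) (H : EuclideanSpace ℝ (Fin 2 × Fin 2))
    (h : ∀ i j, B (basisVec j) (basisVec i) = H (i, j)) : ‖B‖ ≤ ‖H‖ := by
  refine B.opNorm_le_bound₂ (norm_nonneg _) fun v w => ?_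
  have hH : ‖H‖ ^ 2 = H (0, 0) ^ 2 + H (0, 1) ^ 2 + H (1, 0) ^ 2 + H (1, 1) ^ 2 := by
    rw [EuclideanSpace.norm_sq_eq, Fintype.sum_prod_type]
    simp [Fin.sum_univ_two]
    ring
  have hB : B v w = v 0 * (w 0 * H (0, 0)) + v 0 * (w 1 * H (1, 0)) + v 1 * (w 0 * H (0, 1)) +
      v 1 * (w 1 * H (1, 1)) := by
    conv_lhs => rw [eq_sum_basisVec v, eq_sum_basisVec w]
    simp only [map_add, map_smul, add_apply, smul_apply, h, smul_eq_mul]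
    ring
  refine abs_le_of_sq_le_sq ?_ (by positivity)
  rw [hB, mul_pow, mul_pow, hH, norm_sq_eq_coords, norm_sq_eq_coords]
  nlinarith [sq_nonneg (v 0 * w 0 * H (1, 0) - v 0 * w 1 * H (0, 0)),
    sq_nonneg (v 0 * w 0 * H (0, 1) - v 1 * w 0 * H (0, 0)),
    sq_nonneg (v 0 * w 0 * H (1, 1) - v 1 * w 1 * H (0, 0)),
    sq_nonneg (v 0 * w 1 * H (0, 1) - v 1 * w 0 * H (1, 0)),
    sq_nonneg (v 0 * w 1 * H (1, 1) - v 1 * w 1 * H (1, 0)),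
    sq_nonneg (v 1 * w 0 * H (1, 1) - v 1 * w 1 * H (0, 1))]

theorem mollify_coord {ι : Type*} [Fintype ι] (φ : ContDiffBump (0 : Plane))
    {F : Plane → EuclideanSpace ℝ ι} (hF : LocallyIntegrable F) (x : Plane) (i : ι) :
    mollify φ F x i = mollify φ (fun y => F y i) x := by
  have hex : ConvolutionExistsAt (φ.normed volume) F x (ContinuousLinearMap.lsmul ℝ ℝ) volume :=
    φ.hasCompactSupport_normed.convolutionExists_left _ φ.continuous_normed hF x
  have := (EuclideanSpace.proj i : EuclideanSpace ℝ ι →L[ℝ] ℝ).integral_comp_comm hex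
  rw [mollify_apply, mollify_apply]
  exact this.symm

/-- The first vector of the dual basis of `b, c`. -/
def dualFst (b c : Plane) : Plane := (det2 b c)⁻¹ • !₂[c 1, -c 0]

/-- The second vector of the dual basis of `b, c`. -/
def dualSnd (b c : Plane) : Plane := (det2 b c)⁻¹ • !₂[-b 1, b 0]

theorem inner_dual (b c : Plane) (h : det2 b c ≠ 0) (β γ : ℝ) :
    inner ℝ (β • dualFst b c + γ • dualSnd b c) b = β ∧
      inner ℝ (β • dualFst b c + γ • dualSnd b c) c = γ := by
  constructor <;>
  · simp [inner_eq_coords, dualFst, dualSnd]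
    field_simp
    simp [det2]
    ring

/-- A vector is recovered from its inner products with a basis. -/
theorem eq_dual_of_inner {b c g : Plane} (h : det2 b c ≠ 0) :
    g = inner ℝ g b • dualFst b c + inner ℝ g c • dualSnd b c := by
  have e := inner_dual b c h (inner ℝ g b) (inner ℝ g c)
  set g' := inner ℝ g b • dualFst b c + inner ℝ g c • dualSnd b c
  have h1 := norm_mul_abs_det2_le (g - g') b c
  rw [inner_sub_left, inner_sub_left, e.1, e.2] at h1
  simp only [sub_self, abs_zero, zero_mul, add_zero] at h1
  have h2 : ‖g - g'‖ = 0 := by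
    have : 0 < |det2 b c| := abs_pos.2 h
    have := norm_nonneg (g - g')
    nlinarith
  exact sub_eq_zero.1 (norm_eq_zero.1 h2)

theorem combo_three_mem_of_convex {S : Set Plane} (hS : Convex ℝ S) {x y z : Plane} (hx : x ∈ S)
    (hy : y ∈ S) (hz : z ∈ S) {r s t : ℝ} (hr : 0 ≤ r) (hs : 0 ≤ s) (ht : 0 ≤ t)
    (h : r + s + t = 1) : r • x + s • y + t • z ∈ S := by
  have := hS.sum_mem (t := Finset.univ) (w := ![r, s, t]) (z := ![x, y, z])
    (by intro i _; fin_cases i <;> simpa) (by simpa [Fin.sum_univ_three] using h)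
    (by intro i _; fin_cases i <;> simpa)
  simpa [Fin.sum_univ_three] using this

theorem openTri_subset_of_convex {A b c : Plane} {S : Set Plane} (hS : Convex ℝ S) (hA : A ∈ S)
    (hB : A + b ∈ S) (hC : A + c ∈ S) : openTri A b c ⊆ S := by
  rintro x ⟨s, t, hs, ht, hst, rfl⟩
  have := combo_three_mem_of_convex hS hA hB hC (by linarith : 0 ≤ 1 - s - t) hs.le ht.le (by ring)
  convert this using 1
  module

theorem convex_openTri (A b c : Plane) : Convex ℝ (openTri A b c) := by
  rintro x ⟨s, t, hs, ht, hst, rfl⟩ y ⟨s', t', hs', ht', hst', rfl⟩ α β hα hβ hαβ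
  have h1 := convex_Ioi (0 : ℝ) hs hs' hα hβ hαβ
  have h2 := convex_Ioi (0 : ℝ) ht ht' hα hβ hαβ
  have h3 := convex_Iio (1 : ℝ) hst hst' hα hβ hαβ
  simp only [smul_eq_mul, mem_Ioi, mem_Iio] at h1 h2 h3
  refine ⟨_, _, h1, h2, by linarith, ?_⟩
  have : α = 1 - β := by linarith
  subst this
  module

/-- The first vertex of the triangle `A, A + b, A + c` shrunk by the factor `ρ` towards its
centroid. -/
def shrinkVertex (A b c : Plane) (ρ : ℝ) : Plane := A + ((1 - ρ) / 3) • (b + c)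

theorem convexHull_shrink_subset {A b c : Plane} {ρ : ℝ} (h0 : 0 < ρ) (h1 : ρ < 1) :
    convexHull ℝ {shrinkVertex A b c ρ, shrinkVertex A b c ρ + ρ • b,
      shrinkVertex A b c ρ + ρ • c} ⊆ openTri A b c := by
  refine convexHull_min ?_ (convex_openTri A b c)
  rintro x (rfl | rfl | rfl)
  · exact ⟨(1 - ρ) / 3, (1 - ρ) / 3, by linarith, by linarith, by linarith,
      by simp only [shrinkVertex]; module⟩
  · exact ⟨(1 - ρ) / 3 + ρ, (1 - ρ) / 3, by linarith, by linarith, by linarith,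
      by simp only [shrinkVertex]; module⟩
  · exact ⟨(1 - ρ) / 3, (1 - ρ) / 3 + ρ, by linarith, by linarith, by linarith,
      by simp only [shrinkVertex]; module⟩

/-- Every point of the open triangle lies in the triangles shrunk by a factor close to one. -/
theorem eventually_mem_openTri_shrink {A b c x : Plane} (hx : x ∈ openTri A b c)
    {ρ : ℕ → ℝ} (hρ : Tendsto ρ atTop (𝓝 1)) :
    ∀ᶠ n in atTop, x ∈ openTri (shrinkVertex A b c (ρ n)) (ρ n • b) (ρ n • c) := by
  obtain ⟨s, t, hs, ht, hst, rfl⟩ := hx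
  have hlim : ∀ r : ℝ, Tendsto (fun n => (r - (1 - ρ n) / 3) / ρ n) atTop (𝓝 r) := fun r => by
    have := ((tendsto_const_nhds (x := r)).sub ((hρ.const_sub 1).div_const 3)).div hρ one_ne_zero
    rw [show (r - (1 - 1) / 3) / 1 = r by ring] at this
    exact this
  filter_upwards [(hlim s).eventually_const_lt hs, (hlim t).eventually_const_lt ht,
    ((hlim s).add (hlim t)).eventually_lt_const hst, hρ.eventually_const_lt one_pos]
    with n h1 h2 h3 h4
  refine ⟨_, _, h1, h2, h3, ?_⟩
  rw [smul_smul, smul_smul, div_mul_cancel₀ _ h4.ne', div_mul_cancel₀ _ h4.ne', shrinkVertex]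
  module

/-- The mollified weak gradient and weak Hessian are the derivatives of the mollified function in
the compactly contained part of the domain. -/
theorem derivatives_mollify {T : Set Plane} {u : Plane → ℝ} {p : ℝ≥0∞}
    (hp : 1 ≤ p) (hT : IsOpen T) (hu : MemW2 p T u) {S : Set Plane} {δ : ℝ}
    (hS : Metric.cthickening δ S ⊆ T) (φ : ContDiffBump (0 : Plane)) (hφ : φ.rOut < δ)
    {x : Plane} (hx : x ∈ S) :
    gradient (mollify φ (T.indicator u)) x = mollify φ (T.indicator (weakGrad T u)) x ∧
      ‖fderiv ℝ (fderiv ℝ (mollify φ (T.indicator u))) x‖ ≤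
        ‖mollify φ (T.indicator (weakHess T u)) x‖ := by
  have hloc : ∀ {v : Plane → ℝ}, MemLp v p (volume.restrict T) →
      LocallyIntegrable (T.indicator v) := fun hv =>
    ((memLp_indicator_iff_restrict hT.measurableSet).2 hv).locallyIntegrable hp
  have hext : ∀ v : Plane → ℝ, v =ᵐ[volume.restrict T] T.indicator v := fun v =>
    ((indicator_ae_eq_restrict hT.measurableSet).symm)
  have hO : IsOpen (Metric.thickening (δ - φ.rOut) S) := Metric.isOpen_thickening
  have hxO : x ∈ Metric.thickening (δ - φ.rOut) S :=
    Metric.self_subset_thickening (by linarith) S hx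
  have hball : ∀ y ∈ Metric.thickening (δ - φ.rOut) S, Metric.closedBall y φ.rOut ⊆ T := by
    intro y hy z hz
    apply hS
    obtain ⟨w, hw, hyw⟩ := Metric.mem_thickening_iff.1 hy
    refine Metric.mem_cthickening_of_dist_le z w δ S hw ?_
    calc dist z w ≤ dist z y + dist y w := dist_triangle _ _ _
      _ ≤ φ.rOut + (δ - φ.rOut) := add_le_add (Metric.mem_closedBall.1 hz) hyw.le
      _ = δ := by ring
  have hd1 : ∀ i, ∀ y ∈ Metric.thickening (δ - φ.rOut) S,
      fderiv ℝ (mollify φ (T.indicator u)) y (basisVec i) =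
        mollify φ (T.indicator (weakPartial T i u)) y := fun i y hy =>
    fderiv_mollify φ (hloc hu.1.1)
      ((hasWeakPartial_weakPartial (hu.1.2 i).1).congr (hext _) (hext _)) (hball y hy)
  have hd2 : ∀ i j, fderiv ℝ (mollify φ (T.indicator (weakPartial T i u))) x (basisVec j) =
        mollify φ (T.indicator (weakPartial T j (weakPartial T i u))) x := fun i j =>
    fderiv_mollify φ (hloc (hu.1.2 i).2)
      ((hasWeakPartial_weakPartial ((hu.2 i).2 j).1).congr (hext _) (hext _)) (hball x hxO)
  have hgrad := hu.1.memLp_weakGrad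
  have hhess := hu.memLp_weakHess
  have hcoord : ∀ {ι : Type} [Fintype ι] (F : Plane → EuclideanSpace ℝ ι) (i : ι),
      (fun y => T.indicator F y i) = T.indicator fun y => F y i := by
    intro ι _ F i
    ext y
    by_cases hy : y ∈ T <;> simp [hy]
  constructor
  · ext i
    rw [gradient_apply, hd1 i x hxO, mollify_coord φ
      (((memLp_indicator_iff_restrict hT.measurableSet).2 hgrad).locallyIntegrable hp), hcoord]
    rfl
  · refine opNorm_le_frobenius _ _ fun i j => ?_
    rw [mollify_coord φ
      (((memLp_indicator_iff_restrict hT.measurableSet).2 hhess).locallyIntegrable hp), hcoord]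
    have hsm : ContDiff ℝ 2 (mollify φ (T.indicator u)) :=
      (contDiff_mollify φ (hloc hu.1.1)).of_le (by norm_cast)
    have hdiff : DifferentiableAt ℝ (fderiv ℝ (mollify φ (T.indicator u))) x :=
      (hsm.fderiv_right (m := 1) (by norm_num)).differentiable (by norm_num) x
    have e1 : fderiv ℝ (fun y => fderiv ℝ (mollify φ (T.indicator u)) y (basisVec i)) x =
        fderiv ℝ (mollify φ (T.indicator (weakPartial T i u))) x :=
      Filter.EventuallyEq.fderiv_eq (by
        filter_upwards [hO.mem_nhds hxO] with y hy using hd1 i y hy)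
    have e2 := congrArg (fun ℓ : Plane →L[ℝ] ℝ => ℓ (basisVec j)) e1
    simp only [hd2] at e2
    rw [fderiv_clm_apply hdiff (differentiableAt_const _)] at e2
    refine Eq.trans ?_ (show mollify φ (T.indicator (weakPartial T j (weakPartial T i u))) x = _
      from rfl)
    simpa using e2

theorem exists_seq_tendsto_one :
    ∃ ρ : ℕ → ℝ, (∀ n, 0 < ρ n) ∧ (∀ n, ρ n < 1) ∧ Tendsto ρ atTop (𝓝 1) := by
  set ρ : ℕ → ℝ := fun n => 1 - 1 / ((n : ℝ) + 2) with hρdef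
  have hρ0 : ∀ n, 0 < ρ n := fun n => by
    have : 1 / ((n : ℝ) + 2) < 1 := by
      rw [div_lt_one (by positivity)]; linarith [(n.cast_nonneg : (0 : ℝ) ≤ n)]
    simp only [hρdef]; linarith
  have hρ1 : ∀ n, ρ n < 1 := fun n => by
    have : 0 < 1 / ((n : ℝ) + 2) := by positivity
    simp only [hρdef]; linarith
  have hinv : Tendsto (fun n : ℕ => 1 / ((n : ℝ) + 1)) atTop (𝓝 0) :=
    tendsto_one_div_add_atTop_nhds_zero_nat
  have hρ : Tendsto ρ atTop (𝓝 1) := by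
    have h2 : Tendsto (fun n : ℕ => 1 / ((n : ℝ) + 2)) atTop (𝓝 0) := by
      have := hinv.comp (tendsto_add_atTop_nat 1)
      refine this.congr fun n => ?_
      simp only [Function.comp, Nat.cast_add, Nat.cast_one]
      ring
    have := h2.const_sub 1
    rw [sub_zero] at this
    exact this
  exact ⟨ρ, hρ0, hρ1, hρ⟩

theorem exists_seq_tendsto_zero_lt {δ : ℕ → ℝ} (hδ0 : ∀ n, 0 < δ n) :
    ∃ r : ℕ → ℝ, (∀ n, 0 < r n) ∧ (∀ n, r n < δ n) ∧ Tendsto r atTop (𝓝 0) := by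
  have hinv : Tendsto (fun n : ℕ => 1 / ((n : ℝ) + 1)) atTop (𝓝 0) :=
    tendsto_one_div_add_atTop_nhds_zero_nat
  set r : ℕ → ℝ := fun n => min (δ n) (1 / ((n : ℝ) + 1)) / 2 with hr
  have hrpos : ∀ n, 0 < min (δ n) (1 / ((n : ℝ) + 1)) := fun n =>
    lt_min (hδ0 n) (by positivity)
  have hr0 : ∀ n, 0 < r n := fun n => half_pos (hrpos n)
  have hrδ : ∀ n, r n < δ n := fun n => (half_lt_self (hrpos n)).trans_le (min_le_left _ _)
  have hrlim : Tendsto r atTop (𝓝 0) :=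
    squeeze_zero (fun n => (hr0 n).le)
      (fun n => (half_le_self (hrpos n).le).trans (min_le_right _ _)) hinv
  exact ⟨r, hr0, hrδ, hrlim⟩

/-- Mollifications of a continuous function converge along sequences of points, also up to the
boundary, if the mollification only sees interior points. -/
theorem tendsto_mollify_of_continuousOn {T hull : Set Plane} {u : Plane → ℝ} (hTh : T ⊆ hull)
    (huloc : LocallyIntegrable (T.indicator u)) (hc : ContinuousOn u hull) {Q : ℕ → Plane}
    {Q0 : Plane} (hQ0 : Q0 ∈ hull) (hQ : Tendsto Q atTop (𝓝 Q0)) {r : ℕ → ℝ} (hr0 : ∀ n, 0 < r n)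
    (hrlim : Tendsto r atTop (𝓝 0)) (hin : ∀ n, ∀ x ∈ Metric.ball (Q n) (r n), x ∈ T) :
    Tendsto (fun n => mollify (bumpOfRadius (r n) (hr0 n)) (T.indicator u) (Q n)) atTop
      (𝓝 (u Q0)) := by
  rw [Metric.tendsto_atTop]
  intro ε hε
  obtain ⟨η, hη, hηc⟩ := Metric.continuousWithinAt_iff.1 (hc Q0 hQ0) (ε / 4) (by positivity)
  have ev : ∀ᶠ n in atTop, dist (Q n) Q0 < η / 2 ∧ r n < η / 2 :=
    ((Metric.tendsto_nhds.1 hQ) _ (half_pos hη)).and (hrlim.eventually_lt_const (half_pos hη))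
  obtain ⟨N, hN⟩ := eventually_atTop.1 ev
  refine ⟨N, fun n hn => ?_⟩
  obtain ⟨h1, h2⟩ := hN n hn
  have hval : ∀ x ∈ T, dist x Q0 < η → dist (T.indicator u x) (u Q0) < ε / 4 := by
    intro x hx hd
    rw [indicator_of_mem hx]
    exact hηc (hTh hx) hd
  have hQn := hval (Q n) (hin n _ (Metric.mem_ball_self (hr0 n))) (by linarith)
  have h3 : dist (mollify (bumpOfRadius (r n) (hr0 n)) (T.indicator u) (Q n))
      (T.indicator u (Q n)) ≤ ε / 2 := by
    refine ContDiffBump.dist_normed_convolution_le huloc.aestronglyMeasurable fun x hx => ?_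
    have hx' : dist x Q0 < η := by
      have : dist x (Q n) < r n := Metric.mem_ball.1 hx
      linarith [dist_triangle x (Q n) Q0]
    have := hval x (hin n x hx) hx'
    have := dist_triangle_right (T.indicator u x) (T.indicator u (Q n)) (u Q0)
    linarith
  have := dist_triangle (mollify (bumpOfRadius (r n) (hr0 n)) (T.indicator u) (Q n))
    (T.indicator u (Q n)) (u Q0)
  linarith

/-- Reduction of interpolation estimates for Sobolev functions to smooth functions: if the gradients
of all smooth functions which vanish at the vertices of a shrunk copy of the triangle and whose
second derivatives are bounded by a mollification of the weak Hessian are bounded in `L^p` by `K`,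
then so is the interpolation error. The triangle is shrunk so that mollification is possible, and
the limit is taken by Fatou's lemma. -/
theorem eLpNorm_weakGrad_sub_le {A b c : Plane} (hdet : det2 b c ≠ 0) {u : Plane → ℝ} {p : ℝ≥0∞}
    (hp : 1 ≤ p) (hu : MemW2 p (openTri A b c) u)
    (hc : ContinuousOn u (convexHull ℝ {A, A + b, A + c})) {g : Plane}
    (hgb : inner ℝ g b = u (A + b) - u A) (hgc : inner ℝ g c = u (A + c) - u A) {K : ℝ≥0∞}
    (hK : ∀ (ρ : ℝ) (A' : Plane) (e : Plane → ℝ) (φ : ContDiffBump (0 : Plane)), 0 < ρ → ρ < 1 →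
      ContDiff ℝ 2 e → e A' = 0 → e (A' + ρ • b) = 0 → e (A' + ρ • c) = 0 →
      (∀ x ∈ convexHull ℝ {A', A' + ρ • b, A' + ρ • c}, ‖fderiv ℝ (fderiv ℝ e) x‖ ≤
        ‖mollify φ ((openTri A b c).indicator (weakHess (openTri A b c) u)) x‖) →
      eLpNorm (gradient e) p (volume.restrict (openTri A' (ρ • b) (ρ • c))) ≤ K) :
    eLpNorm (fun x => weakGrad (openTri A b c) u x - g) p (volume.restrict (openTri A b c)) ≤
      K := by
  set T := openTri A b c with hTdef
  set hull := convexHull ℝ {A, A + b, A + c} with hhull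
  have hT : IsOpen T := isOpen_openTri A hdet
  have hTh : T ⊆ hull := openTri_subset_of_convex (convex_convexHull ℝ _)
    (subset_convexHull ℝ _ (by simp)) (subset_convexHull ℝ _ (by simp))
    (subset_convexHull ℝ _ (by simp))
  obtain ⟨ρ, hρ0, hρ1, hρ⟩ := exists_seq_tendsto_one
  obtain ⟨P, hP⟩ : ∃ P : ℕ → Plane, P = fun n => shrinkVertex A b c (ρ n) := ⟨_, rfl⟩
  set S : ℕ → Set Plane := fun n => convexHull ℝ {P n, P n + ρ n • b, P n + ρ n • c} with hSdef
  have hST : ∀ n, S n ⊆ T := fun n => by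
    simp only [hSdef, hP]; exact convexHull_shrink_subset (hρ0 n) (hρ1 n)
  have hScomp : ∀ n, IsCompact (S n) := fun n => Set.Finite.isCompact_convexHull ℝ
    (((Set.finite_singleton _).insert _).insert _)
  choose δ hδ0 hδ using fun n => (hScomp n).exists_cthickening_subset_open hT (hST n)
  obtain ⟨r, hr0, hrδ, hrlim⟩ := exists_seq_tendsto_zero_lt hδ0
  set φ : ℕ → ContDiffBump (0 : Plane) := fun n => bumpOfRadius (r n) (hr0 n) with hφ
  have hφr : ∀ n, (φ n).rOut = r n := fun n => rfl
  have huloc : LocallyIntegrable (T.indicator u) :=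
    ((memLp_indicator_iff_restrict hT.measurableSet).2 hu.1.1).locallyIntegrable hp
  have hgloc : LocallyIntegrable (T.indicator (weakGrad T u)) :=
    ((memLp_indicator_iff_restrict hT.measurableSet).2 hu.1.memLp_weakGrad).locallyIntegrable hp
  obtain ⟨f, hf⟩ : ∃ f : ℕ → Plane → ℝ, f = fun n => mollify (φ n) (T.indicator u) := ⟨_, rfl⟩
  have hfs : ∀ n, ContDiff ℝ 2 (f n) := fun n => by
    rw [hf]; exact (contDiff_mollify (φ n) huloc).of_le (by norm_cast)
  have hvert : ∀ (Q : ℕ → Plane) (Q0 : Plane), Q0 ∈ hull → Tendsto Q atTop (𝓝 Q0) →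
      (∀ n, Q n ∈ S n) → Tendsto (fun n => f n (Q n)) atTop (𝓝 (u Q0)) :=
    fun Q Q0 hQ0 hQ hQS => by
      rw [hf]
      refine tendsto_mollify_of_continuousOn hTh huloc hc hQ0 hQ hr0 hrlim fun n x hx => ?_
      exact hδ n (Metric.mem_cthickening_of_dist_le x (Q n) _ _ (hQS n)
        ((Metric.mem_ball.1 hx).le.trans (hrδ n).le))
  have hPlim : Tendsto P atTop (𝓝 A) := by
    have : Tendsto (fun n => A + ((1 - ρ n) / 3) • (b + c)) atTop
        (𝓝 (A + ((1 - 1) / 3 : ℝ) • (b + c))) :=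
      tendsto_const_nhds.add (((hρ.const_sub 1).div_const 3).smul_const _)
    rw [sub_self, zero_div, zero_smul, add_zero] at this
    rw [hP]
    exact this
  -- the vertex values of the mollified functions converge to those of `u`
  have lA := hvert P A (subset_convexHull ℝ _ (by simp)) hPlim
    (fun n => subset_convexHull ℝ _ (by simp))
  have lB := hvert (fun n => P n + ρ n • b) (A + b) (subset_convexHull ℝ _ (by simp))
    (by simpa using hPlim.add (hρ.smul_const b)) (fun n => subset_convexHull ℝ _ (by simp))
  have lC := hvert (fun n => P n + ρ n • c) (A + c) (subset_convexHull ℝ _ (by simp))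
    (by simpa using hPlim.add (hρ.smul_const c)) (fun n => subset_convexHull ℝ _ (by simp))
  -- the gradient of the affine interpolant of `f n` on the shrunk triangle
  obtain ⟨G, hG⟩ : ∃ G : ℕ → Plane, G = fun n =>
    ((f n (P n + ρ n • b) - f n (P n)) / ρ n) • dualFst b c +
      ((f n (P n + ρ n • c) - f n (P n)) / ρ n) • dualSnd b c := ⟨_, rfl⟩
  have hGlim : Tendsto G atTop (𝓝 g) := by
    have h1 := ((lB.sub lA).div hρ one_ne_zero).smul_const (dualFst b c)
    have h2 := ((lC.sub lA).div hρ one_ne_zero).smul_const (dualSnd b c)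
    have := h1.add h2
    rw [div_one, div_one, ← hgb, ← hgc, ← eq_dual_of_inner hdet] at this
    rw [hG]
    exact this
  -- the interpolation error of `f n` on the shrunk triangle
  obtain ⟨e, he⟩ : ∃ e : ℕ → Plane → ℝ, e = fun n x =>
      f n x - (f n (P n) + inner ℝ (G n) (x - P n)) := ⟨_, rfl⟩
  have hes : ∀ n, ContDiff ℝ 2 (e n) := fun n => by
    rw [he]
    exact (hfs n).sub
      (contDiff_const.add (contDiff_const.inner ℝ (contDiff_id.sub contDiff_const)))
  have hed : ∀ n x, fderiv ℝ (e n) x = fderiv ℝ (f n) x - innerSL ℝ (G n) := by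
    intro n x
    have h1 : HasFDerivAt (fun x => f n (P n) + inner ℝ (G n) (x - P n)) (innerSL ℝ (G n)) x :=
      ((innerSL ℝ (G n)).hasFDerivAt.comp x ((hasFDerivAt_id x).sub_const (P n))).const_add _
    rw [he]
    exact (((hfs n).differentiable (by norm_num) x).hasFDerivAt.sub h1).fderiv
  have heg : ∀ n x, gradient (e n) x = gradient (f n) x - G n := by
    intro n x
    ext i
    rw [gradient_apply, hed, PiLp.sub_apply, gradient_apply]
    fin_cases i <;> simp [inner_eq_coords]
  have hedd : ∀ n x, fderiv ℝ (fderiv ℝ (e n)) x = fderiv ℝ (fderiv ℝ (f n)) x := by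
    intro n x
    rw [show fderiv ℝ (e n) = fun x => fderiv ℝ (f n) x - innerSL ℝ (G n) from funext (hed n),
      fderiv_sub_const]
  have heA : ∀ n, e n (P n) = 0 := fun n => by simp [he]
  have heB : ∀ n, e n (P n + ρ n • b) = 0 := fun n => by
    simp only [he, add_sub_cancel_left, inner_smul_right, hG]
    rw [(inner_dual b c hdet _ _).1]
    field_simp [(hρ0 n).ne']
    ring
  have heC : ∀ n, e n (P n + ρ n • c) = 0 := fun n => by
    simp only [he, add_sub_cancel_left, inner_smul_right, hG]
    rw [(inner_dual b c hdet _ _).2]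
    field_simp [(hρ0 n).ne']
    ring
  set T' : ℕ → Set Plane := fun n => openTri (P n) (ρ n • b) (ρ n • c) with hT'
  have hdet' : ∀ n, det2 (ρ n • b) (ρ n • c) ≠ 0 := fun n => by
    have : det2 (ρ n • b) (ρ n • c) = ρ n ^ 2 * det2 b c := by simp [det2]; ring
    rw [this]
    exact mul_ne_zero (pow_ne_zero 2 (hρ0 n).ne') hdet
  have hT'S : ∀ n, T' n ⊆ S n := fun n => openTri_subset_of_convex (convex_convexHull ℝ _)
    (subset_convexHull ℝ _ (by simp)) (subset_convexHull ℝ _ (by simp))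
    (subset_convexHull ℝ _ (by simp))
  have hT'm : ∀ n, MeasurableSet (T' n) := fun n => (isOpen_openTri _ (hdet' n)).measurableSet
  have hder := fun n x (hx : x ∈ S n) =>
    derivatives_mollify hp hT hu (hδ n) (φ n) (hrδ n) hx
  have hcontg : ∀ n, Continuous (gradient (e n)) := fun n =>
    (InnerProductSpace.toDual ℝ Plane).symm.continuous.comp
      ((hes n).continuous_fderiv (by norm_num))
  have hlim : ∀ᵐ x ∂(volume.restrict T),
      Tendsto (fun n => (T' n).indicator (gradient (e n)) x) atTop (𝓝 (weakGrad T u x - g)) := by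
    rw [ae_restrict_iff' hT.measurableSet]
    filter_upwards [ae_tendsto_mollify hgloc hr0 hrlim] with x hx hxT
    rw [indicator_of_mem hxT] at hx
    refine (hx.sub hGlim).congr' ?_
    filter_upwards [eventually_mem_openTri_shrink hxT hρ] with n hn'
    have hn : x ∈ T' n := by rw [hT', hP]; exact hn'
    rw [indicator_of_mem hn, heg, hf, (hder n x (hT'S n hn)).1]
  refine (Lp.eLpNorm_lim_le_liminf_eLpNorm (fun n =>
    ((hcontg n).aestronglyMeasurable.indicator (hT'm n))) _ hlim).trans ?_
  refine liminf_le_of_le (by isBoundedDefault) fun B hB => ?_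
  obtain ⟨n, hn⟩ := hB.exists
  refine hn.trans ?_
  rw [eLpNorm_indicator_eq_eLpNorm_restrict (hT'm n)]
  refine (eLpNorm_mono_measure _ (Measure.restrict_mono le_rfl Measure.restrict_le_self)).trans ?_
  refine hK (ρ n) (P n) (e n) (φ n) (hρ0 n) (hρ1 n) (hes n) (heA n) (heB n) (heC n) fun x hx => ?_
  rw [hedd, hf]
  exact (hder n x hx).2

/-! ### Interpolation estimates for Sobolev functions -/

theorem eLpNorm_indicator_weakHess {p : ℝ≥0∞} {T : Set Plane} (hT : IsOpen T) (u : Plane → ℝ) :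
    eLpNorm (T.indicator (weakHess T u)) p volume =
      eLpNorm (weakHess T u) p (volume.restrict T) :=
  eLpNorm_indicator_eq_eLpNorm_restrict hT.measurableSet

theorem norm_sub_le_of_mem_convexHull {A b c : Plane} {d : ℝ} (hb : ‖b‖ ≤ d) (hc : ‖c‖ ≤ d)
    (hbc : ‖b - c‖ ≤ d) {x y : Plane} (hx : x ∈ convexHull ℝ {A, A + b, A + c})
    (hy : y ∈ convexHull ℝ {A, A + b, A + c}) : ‖x - y‖ ≤ d := by
  have hd : 0 ≤ d := (norm_nonneg b).trans hb
  obtain ⟨x', hx', y', hy', h⟩ := convexHull_exists_dist_ge2 hx hy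
  rw [← dist_eq_norm]
  refine h.trans ?_
  rw [dist_eq_norm]
  have hcb : ‖c - b‖ ≤ d := by rwa [norm_sub_rev]
  rcases hx' with rfl | rfl | rfl <;> rcases hy' with rfl | rfl | rfl <;> simpa

/-- The interpolation error of a `W^{2,∞}` function on a triangle of diameter at most `d`; `g` is
the gradient of the interpolant. -/
theorem eLpNorm_top_interpolation_error_le {A b c : Plane} (hdet : det2 b c ≠ 0) {u : Plane → ℝ}
    (hu : MemW2 ∞ (openTri A b c) u) (hc : ContinuousOn u (convexHull ℝ {A, A + b, A + c}))
    {g : Plane} (hgb : inner ℝ g b = u (A + b) - u A) (hgc : inner ℝ g c = u (A + c) - u A)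
    {d : ℝ} (hbd : ‖b‖ ≤ d) (hcd : ‖c‖ ≤ d) (hbc : ‖b - c‖ ≤ d) :
    eLpNorm (fun x => weakGrad (openTri A b c) u x - g) ∞ (volume.restrict (openTri A b c)) ≤
      ENNReal.ofReal (2 * d * (‖b‖ * ‖c‖) / |det2 b c| *
        semiW2 ∞ (openTri A b c) (openTri A b c) u) := by
  have hd : 0 ≤ d := (norm_nonneg b).trans hbd
  have hT := isOpen_openTri A hdet
  have hH := hu.memLp_weakHess
  set M := semiW2 ∞ (openTri A b c) (openTri A b c) u with hM
  have hM0 : 0 ≤ M := ENNReal.toReal_nonneg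
  have hae : ∀ᵐ y, ‖(openTri A b c).indicator (weakHess (openTri A b c) u) y‖ ≤ M := by
    have hfin : eLpNorm ((openTri A b c).indicator (weakHess (openTri A b c) u)) ∞ volume ≠ ⊤ := by
      rw [eLpNorm_indicator_weakHess hT]; exact hH.eLpNorm_ne_top
    rw [hM, semiW2, ← eLpNorm_indicator_weakHess hT]
    exact ae_norm_le_eLpNorm_top hfin
  refine eLpNorm_weakGrad_sub_le hdet le_top hu hc hgb hgc
    fun ρ A' e φ hρ0 hρ1 he h0 h1 h2 hHess => ?_
  have hdet' : |det2 (ρ • b) (ρ • c)| = ρ ^ 2 * |det2 b c| := by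
    have : det2 (ρ • b) (ρ • c) = ρ ^ 2 * det2 b c := by simp [det2]; ring
    rw [this, abs_mul, abs_of_pos (pow_pos hρ0 2)]
  have hpos : 0 < |det2 b c| := abs_pos.2 hdet
  have hle : ∀ v : Plane, ‖v‖ ≤ d → ‖ρ • v‖ ≤ d := fun v hv => by
    rw [norm_smul, Real.norm_of_nonneg hρ0.le]
    nlinarith [norm_nonneg v]
  rw [eLpNorm_exponent_top]
  refine eLpNormEssSup_le_of_ae_bound ?_
  have hopen : MeasurableSet (openTri A' (ρ • b) (ρ • c)) :=
    (isOpen_openTri A' (abs_pos.1 (by rw [hdet']; positivity))).measurableSet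
  refine (ae_restrict_iff' hopen).2 (Eventually.of_forall fun x hx => ?_)
  have hsub := openTri_subset_of_convex (A := A') (b := ρ • b) (c := ρ • c)
    (convex_convexHull ℝ {A', A' + ρ • b, A' + ρ • c})
    (subset_convexHull ℝ _ (by simp)) (subset_convexHull ℝ _ (by simp))
    (subset_convexHull ℝ _ (by simp))
  have key := norm_gradient_mul_det2_le (M := M) he
    (convex_convexHull ℝ {A', A' + ρ • b, A' + ρ • c})
    (fun x hx y hy => norm_sub_le_of_mem_convexHull (hle b hbd) (hle c hcd)
      (by rw [← smul_sub]; exact hle _ hbc) hx hy) hM0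
    (fun x hx => (hHess x hx).trans (norm_mollify_le_of_ae φ hae x))
    (subset_convexHull ℝ _ (by simp)) (subset_convexHull ℝ _ (by simp))
    (subset_convexHull ℝ _ (by simp)) h0 h1 h2 (hsub hx)
  rw [hdet', norm_smul, norm_smul, Real.norm_of_nonneg hρ0.le] at key
  rw [div_mul_eq_mul_div, le_div_iff₀ hpos]
  have hρ2 : 0 < ρ ^ 2 := by positivity
  refine le_of_mul_le_mul_left ?_ hρ2
  nlinarith [key]

/-- The interpolation error of an `H²` function on a triangle two of whose edges have length at most
`h` and enclose an angle with squared sine at least `κ`; `g` is the gradient of the interpolant. -/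
theorem eLpNorm_two_interpolation_error_le {A b c : Plane} (hdet : det2 b c ≠ 0) {u : Plane → ℝ}
    (hu : MemW2 2 (openTri A b c) u) (hc : ContinuousOn u (convexHull ℝ {A, A + b, A + c}))
    {g : Plane} (hgb : inner ℝ g b = u (A + b) - u A) (hgc : inner ℝ g c = u (A + c) - u A)
    {h κ : ℝ} (hbh : ‖b‖ ≤ h) (hch : ‖c‖ ≤ h) (hκ : 0 < κ)
    (hκd : κ * (‖b‖ * ‖c‖) ^ 2 ≤ det2 b c ^ 2) :
    eLpNorm (fun x => weakGrad (openTri A b c) u x - g) 2 (volume.restrict (openTri A b c)) ≤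
      ENNReal.ofReal (√(48 / κ) * h * semiW2 2 (openTri A b c) (openTri A b c) u) := by
  have hh : 0 ≤ h := (norm_nonneg b).trans hbh
  have hT := isOpen_openTri A hdet
  have hH := hu.memLp_weakHess
  have hsq : ∀ {F : Type} [NormedAddCommGroup F] (f : Plane → F) (μ : Measure Plane),
      eLpNorm f 2 μ = (∫⁻ x, ‖f x‖ₑ ^ 2 ∂μ) ^ (1 / 2 : ℝ) := fun f μ => by
    rw [eLpNorm_eq_lintegral_rpow_enorm_toReal (by norm_num) (by norm_num)]
    simp
  refine eLpNorm_weakGrad_sub_le hdet (by norm_num) hu hc hgb hgc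
    fun ρ A' e φ hρ0 hρ1 he h0 h1 h2 hHess => ?_
  have hdet' : det2 (ρ • b) (ρ • c) = ρ ^ 2 * det2 b c := by simp [det2]; ring
  have hle : ∀ v : Plane, ‖v‖ ≤ h → ‖ρ • v‖ ≤ h := fun v hv => by
    rw [norm_smul, Real.norm_of_nonneg hρ0.le]
    nlinarith [norm_nonneg v]
  have hsub := openTri_subset_of_convex (A := A') (b := ρ • b) (c := ρ • c)
    (convex_convexHull ℝ {A', A' + ρ • b, A' + ρ • c})
    (subset_convexHull ℝ _ (by simp)) (subset_convexHull ℝ _ (by simp))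
    (subset_convexHull ℝ _ (by simp))
  have key := lintegral_gradient_le he (by rw [hdet']; exact mul_ne_zero (by positivity) hdet)
    h0 h1 h2 (hle b hbh) (hle c hch) hκ
    (by
      rw [hdet', norm_smul, norm_smul, Real.norm_of_nonneg hρ0.le]
      nlinarith [mul_le_mul_of_nonneg_left hκd (by positivity : 0 ≤ ρ ^ 4)])
    (N := fun x => ‖mollify φ ((openTri A b c).indicator (weakHess (openTri A b c) u)) x‖ₑ)
    (fun x hx => enorm_le_iff_norm_le.2 (hHess x (hsub hx)))
  have hmol : ∫⁻ x in openTri A' (ρ • b) (ρ • c),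
      ‖mollify φ ((openTri A b c).indicator (weakHess (openTri A b c) u)) x‖ₑ ^ 2 ≤
      ∫⁻ x, ‖(openTri A b c).indicator (weakHess (openTri A b c) u) x‖ₑ ^ 2 :=
    (setLIntegral_le_lintegral _ _).trans (lintegral_sq_mollify_le φ
      ((memLp_indicator_iff_restrict hT.measurableSet).2 hH).aestronglyMeasurable)
  rw [hsq]
  calc _ ≤ (ENNReal.ofReal (48 * h ^ 2 / κ) *
        ∫⁻ x, ‖(openTri A b c).indicator (weakHess (openTri A b c) u) x‖ₑ ^ 2) ^ (1 / 2 : ℝ) := by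
        gcongr
        exact key.trans (by gcongr)
    _ = ENNReal.ofReal (√(48 / κ) * h) *
        eLpNorm (weakHess (openTri A b c) u) 2 (volume.restrict (openTri A b c)) := by
        rw [ENNReal.mul_rpow_of_nonneg _ _ (by norm_num), ← hsq, eLpNorm_indicator_weakHess hT,
          ENNReal.ofReal_rpow_of_nonneg (by positivity) (by norm_num), ← Real.sqrt_eq_rpow,
          show 48 * h ^ 2 / κ = 48 / κ * h ^ 2 by ring, Real.sqrt_mul (by positivity),
          Real.sqrt_sq hh]
    _ = _ := by
        rw [ENNReal.ofReal_mul (p := √(48 / κ) * h) (by positivity), semiW2,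
          ENNReal.ofReal_toReal hH.eLpNorm_ne_top]

/-! ### Affine functions -/

/-- The gradient of an affine function. -/
def affGrad (p : Plane →ᵃ[ℝ] ℝ) : Plane := WithLp.toLp 2 fun i => p.linear (basisVec i)

theorem inner_affGrad (p : Plane →ᵃ[ℝ] ℝ) (v : Plane) : inner ℝ (affGrad p) v = p.linear v := by
  conv_rhs => rw [eq_sum_basisVec v]
  simp only [map_add, map_smul, inner_eq_coords, affGrad, smul_eq_mul]
  ring

theorem affine_eq (p : Plane →ᵃ[ℝ] ℝ) (x y : Plane) :
    p x = p y + inner ℝ (affGrad p) (x - y) := by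
  rw [inner_affGrad, ← vsub_eq_sub, p.linearMap_vsub, vsub_eq_sub]
  ring

theorem hasFDerivAt_affine (p : Plane →ᵃ[ℝ] ℝ) (x : Plane) :
    HasFDerivAt p (innerSL ℝ (affGrad p)) x := by
  have : (p : Plane → ℝ) = fun y => p 0 + innerSL ℝ (affGrad p) y := by
    ext y
    rw [affine_eq p y 0]
    simp
  rw [this]
  exact (innerSL ℝ (affGrad p)).hasFDerivAt.const_add _

theorem lipschitzWith_affine (p : Plane →ᵃ[ℝ] ℝ) : LipschitzWith ‖affGrad p‖₊ p := by
  refine LipschitzWith.of_dist_le_mul fun x y => ?_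
  rw [Real.dist_eq, affine_eq p x y, add_sub_cancel_left, dist_eq_norm]
  exact abs_real_inner_le_norm _ _

/-- The gradient `lineGrad` is the classical one at points of differentiability. -/
theorem lineGrad_eq_of_hasFDerivAt {u : Plane → ℝ} {g x : Plane}
    (h : HasFDerivAt u (innerSL ℝ g) x) : lineGrad u x = g := by
  ext i
  simp only [lineGrad]
  rw [h.differentiableAt.lineDeriv_eq_fderiv, h.fderiv]
  fin_cases i <;> simp [inner_eq_coords]

theorem hasWeakGrad_affine (Ω : Set Plane) (p : Plane →ᵃ[ℝ] ℝ) :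
    HasWeakGrad Ω p fun _ => affGrad p := by
  have := hasWeakGrad_lineGrad (lipschitzWith_affine p) Ω
  rwa [show lineGrad p = fun _ => affGrad p from
    funext fun x => lineGrad_eq_of_hasFDerivAt (hasFDerivAt_affine p x)] at this

/-! ### Geometry of triangles -/

/-- Lagrange's identity in the plane. -/
theorem det2_sq (b c : Plane) : det2 b c ^ 2 = (‖b‖ * ‖c‖) ^ 2 - inner ℝ b c ^ 2 := by
  rw [mul_pow, norm_sq_eq_coords, norm_sq_eq_coords, inner_eq_coords, det2]
  ring

theorem det2_ne_zero_of_linearIndependent {b c : Plane} (h : LinearIndependent ℝ ![b, c]) :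
    det2 b c ≠ 0 := by
  intro hd
  rw [LinearIndependent.pair_iff] at h
  have hd' : b 0 * c 1 - b 1 * c 0 = 0 := hd
  have h1 := h (c 1) (-b 1) (by ext i; fin_cases i <;> simp <;> linarith)
  have h2 := h (c 0) (-b 0) (by ext i; fin_cases i <;> simp <;> linarith)
  have hb : b = 0 := by
    ext i
    fin_cases i
    · simpa using h2.2
    · simpa using h1.2
  have := h 1 0 (by simp [hb])
  exact one_ne_zero this.1

namespace Tri

variable (K : Tri)

/-- The edge vector from the vertex `i` to the vertex `j`. -/
def edge (i j : Fin 3) : Plane := K.points j - K.points i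

/-- Twice the signed area of a triangle. -/
def det : ℝ := det2 (K.edge 0 1) (K.edge 0 2)

variable {K} {i j k : Fin 3}

theorem abs_det2_edge (hij : i ≠ j) (hjk : j ≠ k) (hik : i ≠ k) :
    |det2 (K.edge i j) (K.edge i k)| = |K.det| := by
  rw [abs_eq_abs, det]
  simp only [det2, edge, PiLp.sub_apply]
  fin_cases i <;> fin_cases j <;> fin_cases k <;> simp at hij hjk hik <;>
    simp only [Fin.zero_eta, Fin.mk_one, Fin.reduceFinMk] <;>
    first | (left; ring1) | (right; ring1) | (left; simp)

variable (K) in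
theorem det_ne_zero : K.det ≠ 0 := by
  refine det2_ne_zero_of_linearIndependent ?_
  have h := (affineIndependent_iff_linearIndependent_vsub ℝ K.points 0).1 K.independent
  let f : Fin 2 → {x : Fin 3 // x ≠ 0} := fun i => ⟨i.succ, Fin.succ_ne_zero i⟩
  have hf : Function.Injective f := fun a b hab => by
    simpa [f] using hab
  have e : ![K.edge 0 1, K.edge 0 2] =
      (fun i : {x : Fin 3 // x ≠ 0} => (K.points i -ᵥ K.points 0 : Plane)) ∘ f := by
    ext i
    fin_cases i <;> simp [f, edge]
  rw [e]
  exact h.comp f hf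

theorem det2_edge_ne_zero (hij : i ≠ j) (hjk : j ≠ k) (hik : i ≠ k) :
    det2 (K.edge i j) (K.edge i k) ≠ 0 := by
  rw [← abs_pos, abs_det2_edge hij hjk hik, abs_pos]
  exact K.det_ne_zero

theorem range_points (hij : i ≠ j) (hjk : j ≠ k) (hik : i ≠ k) :
    range K.points = {K.points i, K.points i + K.edge i j, K.points i + K.edge i k} := by
  simp only [edge, add_sub_cancel]
  ext x
  simp only [mem_range, mem_insert_iff, mem_singleton_iff]
  constructor
  · rintro ⟨l, rfl⟩
    have : l = i ∨ l = j ∨ l = k := by omega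
    rcases this with rfl | rfl | rfl <;> simp
  · rintro (rfl | rfl | rfl) <;> exact ⟨_, rfl⟩

theorem carrier_eq (hij : i ≠ j) (hjk : j ≠ k) (hik : i ≠ k) : K.carrier =
    convexHull ℝ {K.points i, K.points i + K.edge i j, K.points i + K.edge i k} := by
  rw [carrier, range_points hij hjk hik]

variable (K) in
theorem convex_carrier : Convex ℝ K.carrier := convex_convexHull ℝ _

variable (K) in
theorem isCompact_carrier : IsCompact K.carrier :=
  Set.Finite.isCompact_convexHull ℝ (finite_range _)

variable (K) in
theorem point_mem_carrier (i : Fin 3) : K.points i ∈ K.carrier :=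
  subset_convexHull ℝ _ (mem_range_self i)

end Tri

theorem convexHull_subset_closure_openTri (A b c : Plane) :
    convexHull ℝ {A, A + b, A + c} ⊆ closure (openTri A b c) := by
  refine convexHull_min ?_ (convex_openTri A b c).closure
  obtain ⟨ρ, h0, h1, hρ⟩ := exists_seq_tendsto_one
  have hσ : Tendsto (fun n => (1 - ρ n) / 3) atTop (𝓝 0) := by
    have := (hρ.const_sub 1).div_const 3
    rwa [sub_self, zero_div] at this
  have hlim : ∀ s t : ℝ, Tendsto (fun n => A + ((1 - ρ n) / 3 + ρ n * s) • b +
      ((1 - ρ n) / 3 + ρ n * t) • c) atTop (𝓝 (A + s • b + t • c)) := fun s t => by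
    have := ((tendsto_const_nhds (x := A)).add ((hσ.add (hρ.mul_const s)).smul_const b)).add
      ((hσ.add (hρ.mul_const t)).smul_const c)
    simp only [zero_add, one_mul] at this
    exact this
  have hmem : ∀ s t : ℝ, 0 ≤ s → 0 ≤ t → s + t ≤ 1 → A + s • b + t • c ∈ closure (openTri A b c) :=
    fun s t hs ht hst => mem_closure_of_tendsto (hlim s t) (Eventually.of_forall fun n => by
      have := h0 n
      have := h1 n
      have a1 := mul_nonneg (h0 n).le hs
      have a2 := mul_nonneg (h0 n).le ht
      exact ⟨_, _, by linarith, by linarith, by nlinarith, rfl⟩)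
  rintro x (rfl | rfl | rfl)
  · simpa using hmem 0 0 le_rfl le_rfl (by norm_num)
  · simpa using hmem 1 0 (by norm_num) le_rfl (by norm_num)
  · simpa using hmem 0 1 le_rfl (by norm_num) (by norm_num)

theorem interior_convexHull_eq_openTri {A b c : Plane} (h : det2 b c ≠ 0) :
    interior (convexHull ℝ {A, A + b, A + c}) = openTri A b c := by
  have hsub : openTri A b c ⊆ convexHull ℝ {A, A + b, A + c} :=
    openTri_subset_of_convex (convex_convexHull ℝ _)
    (subset_convexHull ℝ _ (by simp)) (subset_convexHull ℝ _ (by simp))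
    (subset_convexHull ℝ _ (by simp))
  refine Subset.antisymm ?_ (interior_maximal hsub (isOpen_openTri A h))
  have hne : (interior (openTri A b c)).Nonempty := by
    rw [(isOpen_openTri A h).interior_eq]
    exact ⟨_, 1 / 3, 1 / 3, by norm_num, by norm_num, by norm_num, rfl⟩
  calc interior (convexHull ℝ {A, A + b, A + c}) ⊆ interior (closure (openTri A b c)) :=
        interior_mono (convexHull_subset_closure_openTri A b c)
    _ = openTri A b c := by
        rw [(convex_openTri A b c).interior_closure_eq_interior_of_nonempty_interior hne,
          (isOpen_openTri A h).interior_eq]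

namespace Tri

variable {K : Tri} {i j k : Fin 3}

theorem interior_carrier_eq (hij : i ≠ j) (hjk : j ≠ k) (hik : i ≠ k) :
    interior K.carrier = openTri (K.points i) (K.edge i j) (K.edge i k) := by
  rw [carrier_eq hij hjk hik, interior_convexHull_eq_openTri (det2_edge_ne_zero hij hjk hik)]

variable (K) in
theorem carrier_subset_closure_interior : K.carrier ⊆ closure (interior K.carrier) := by
  have h1 : (0 : Fin 3) ≠ 1 := by decide
  have h2 : (1 : Fin 3) ≠ 2 := by decide
  have h3 : (0 : Fin 3) ≠ 2 := by decide
  rw [interior_carrier_eq h1 h2 h3, carrier_eq h1 h2 h3]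
  exact convexHull_subset_closure_openTri _ _ _

variable (K) in
/-- The boundary of a triangle is a null set. -/
theorem interior_carrier_ae_eq : interior K.carrier =ᵐ[volume] K.carrier :=
  interior_ae_eq_of_null_frontier (K.convex_carrier.addHaar_frontier volume)

variable (K) in
theorem jacobian_eq : K.jacobian = |K.det| := by
  have h1 : (0 : Fin 3) ≠ 1 := by decide
  have h2 : (1 : Fin 3) ≠ 2 := by decide
  have h3 : (0 : Fin 3) ≠ 2 := by decide
  rw [jacobian, Measure.real, ← measure_congr K.interior_carrier_ae_eq,
    interior_carrier_eq h1 h2 h3, volume_openTri (det2_edge_ne_zero h1 h2 h3),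
    abs_det2_edge h1 h2 h3, ENNReal.toReal_ofReal (by positivity)]
  ring

variable (K) in
theorem dist_le_longestEdge (x y : Fin 3) : ‖K.points x - K.points y‖ ≤ K.longestEdge := by
  rw [← dist_eq_norm]
  exact Metric.dist_le_diam_of_mem (finite_range _).isBounded (mem_range_self _) (mem_range_self _)

variable (K) in
/-- The vertices can be numbered so that the longest edge is opposite to the first one. -/
theorem exists_longest_edge : ∃ i j k : Fin 3, i ≠ j ∧ j ≠ k ∧ i ≠ k ∧
    ‖K.edge i j - K.edge i k‖ = K.longestEdge ∧ ‖K.edge i j‖ ≤ K.longestEdge ∧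
      ‖K.edge i k‖ ≤ K.longestEdge := by
  obtain ⟨⟨x, y⟩, hxy⟩ := Finite.exists_max
    fun q : Fin 3 × Fin 3 => dist (K.points q.1) (K.points q.2)
  have hd : dist (K.points x) (K.points y) = K.longestEdge := by
    refine le_antisymm (by rw [dist_eq_norm]; exact K.dist_le_longestEdge x y) ?_
    refine Metric.diam_le_of_forall_dist_le dist_nonneg ?_
    rintro _ ⟨a, rfl⟩ _ ⟨b, rfl⟩
    exact hxy (a, b)
  have hne : x ≠ y := by
    rintro rfl
    have h1 := hxy (0, 1)
    simp only [dist_self] at h1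
    have h2 := K.independent.injective (dist_le_zero.1 h1)
    exact absurd h2 (by decide)
  obtain ⟨i, hix, hiy⟩ : ∃ i : Fin 3, i ≠ x ∧ i ≠ y :=
    (by decide : ∀ x y : Fin 3, x ≠ y → ∃ i : Fin 3, i ≠ x ∧ i ≠ y) x y hne
  refine ⟨i, x, y, hix, hne, hiy, ?_, K.dist_le_longestEdge _ _, K.dist_le_longestEdge _ _⟩
  rw [← hd, dist_eq_norm]
  simp [edge]

/-- Altitude times opposite edge is twice the area. -/
theorem height_mul_edge (hij : i ≠ j) (hjk : j ≠ k) (hik : i ≠ k) :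
    Affine.Simplex.height K i * ‖K.points j - K.points k‖ = |K.det| := by
  set F := Affine.Simplex.altitudeFoot K i with hF
  have hj := Affine.Simplex.inner_vsub_altitudeFoot_vsub_altitudeFoot_eq_zero K hij
  have hk := Affine.Simplex.inner_vsub_altitudeFoot_vsub_altitudeFoot_eq_zero K hik
  have hpos : 0 < Affine.Simplex.height K i := Affine.Simplex.height_pos K i
  have hv : Affine.Simplex.height K i = ‖K.points i - F‖ := by
    rw [Affine.Simplex.height, dist_eq_norm]
  rw [hv] at hpos ⊢
  obtain ⟨v, hvd⟩ : ∃ v, v = K.points i - F := ⟨_, rfl⟩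
  obtain ⟨x, hx⟩ : ∃ x, x = K.points j - F := ⟨_, rfl⟩
  obtain ⟨y, hy⟩ : ∃ y, y = K.points k - F := ⟨_, rfl⟩
  replace hj : inner ℝ x v = 0 := by rw [hx, hvd]; exact hj
  replace hk : inner ℝ y v = 0 := by rw [hy, hvd]; exact hk
  rw [← hvd] at hpos ⊢
  have e1 : K.edge i j = x - v := by simp [edge, hx, hvd]
  have e2 : K.edge i k = y - v := by simp [edge, hy, hvd]
  have e3 : K.points j - K.points k = x - y := by simp [hx, hy]
  rw [← abs_det2_edge hij hjk hik, e1, e2, e3]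
  -- two vectors of the plane orthogonal to the altitude are parallel
  have hxy : det2 x y = 0 := by
    have h1 : ‖v‖ ^ 2 * det2 x y = 0 := by
      rw [norm_sq_eq_coords]
      rw [inner_eq_coords] at hj hk
      simp only [det2]
      linear_combination (v 0 * y 1 - v 1 * y 0) * hj - (v 0 * x 1 - v 1 * x 0) * hk
    rcases mul_eq_zero.1 h1 with h | h
    · exact absurd h (by positivity)
    · exact h
  have hdet : det2 (x - v) (y - v) = det2 v (x - y) := by
    have : det2 (x - v) (y - v) = det2 x y + det2 v (x - y) := by simp [det2]; ring
    rw [this, hxy, zero_add]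
  have hsq := det2_sq v (x - y)
  have hin : inner ℝ v (x - y) = 0 := by
    rw [inner_sub_right, real_inner_comm, hj, real_inner_comm, hk, sub_zero]
  rw [hin, zero_pow two_ne_zero, sub_zero] at hsq
  rw [hdet, ← abs_of_nonneg (by positivity : 0 ≤ ‖v‖ * ‖x - y‖)]
  exact (sq_eq_sq_iff_abs_eq_abs _ _).1 hsq.symm

/-- The product of the three edges is `4 R |K|`, where `2 |K|` is the determinant. -/
theorem two_mul_circumradius_mul_det (hij : i ≠ j) (hjk : j ≠ k) (hik : i ≠ k) :
    2 * Affine.Simplex.circumradius K * |K.det| =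
      ‖K.edge i j‖ * ‖K.edge i k‖ * ‖K.edge i j - K.edge i k‖ := by
  obtain ⟨o, ho⟩ : ∃ o, o = Affine.Simplex.circumcenter K - K.points i := ⟨_, rfl⟩
  obtain ⟨R, hRd⟩ : ∃ R, R = Affine.Simplex.circumradius K := ⟨_, rfl⟩
  have hR : 0 ≤ R := by rw [hRd]; exact Affine.Simplex.circumradius_nonneg K
  have h0 : ‖o‖ = R := by
    have := Affine.Simplex.dist_circumcenter_eq_circumradius' K i
    rw [dist_eq_norm] at this
    rw [ho, hRd, this]
  -- the circumcenter projects onto the midpoints of the edges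
  have hin : ∀ l, inner ℝ o (K.edge i l) = ‖K.edge i l‖ ^ 2 / 2 := by
    intro l
    have h1 : ‖o - K.edge i l‖ = R := by
      have := Affine.Simplex.dist_circumcenter_eq_circumradius' K l
      rw [dist_eq_norm] at this
      rw [hRd, ← this]
      simp [ho, edge]
    have := norm_sub_sq_real o (K.edge i l)
    rw [h1, h0] at this
    linarith
  rw [← hRd, ← abs_det2_edge hij hjk hik]
  have h1 := hin j
  have h2 := hin k
  generalize K.edge i j = b at h1 ⊢
  generalize K.edge i k = c at h2 ⊢
  have hsq : (2 * R * |det2 b c|) ^ 2 = (‖b‖ * ‖c‖ * ‖b - c‖) ^ 2 := by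
    have e1 : (‖o‖ * det2 b c) ^ 2 = ‖inner ℝ o b • c - inner ℝ o c • b‖ ^ 2 := by
      rw [mul_pow, norm_sq_eq_coords, norm_sq_eq_coords]
      simp only [inner_eq_coords, det2, PiLp.sub_apply, PiLp.smul_apply, smul_eq_mul]
      ring
    rw [h1, h2, h0, norm_sub_sq_real, norm_smul, norm_smul, inner_smul_left, inner_smul_right,
      real_inner_comm] at e1
    simp only [Real.norm_eq_abs, RCLike.conj_to_real, mul_pow, sq_abs] at e1
    rw [mul_pow, sq_abs, mul_pow _ ‖b - c‖, norm_sub_sq_real]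
    linear_combination 4 * e1
  exact (sq_eq_sq₀ (by positivity) (by positivity)).1 hsq

end Tri

/-! ### The interpolation constants -/

/-- The weak gradient of the interpolation error on a triangle. -/
theorem weakGrad_sub_affine_ae_eq {Ω : Set Plane} (hΩ : IsOpen Ω) {u : Plane → ℝ} {q : ℝ≥0∞}
    (hu : MemW1 q Ω u) (p : Plane →ᵃ[ℝ] ℝ) :
    weakGrad Ω (fun x => u x - p x) =ᵐ[volume.restrict Ω] fun x => weakGrad Ω u x - affGrad p :=
  (hu.hasWeakGrad.sub (hasWeakGrad_affine Ω p)).weakGrad_ae_eq hΩ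

theorem IsLagrangeInterpolant.inner_edge {K : Tri} {u : Plane → ℝ} {p : Plane →ᵃ[ℝ] ℝ}
    (h : IsLagrangeInterpolant K u p) (i j : Fin 3) :
    inner ℝ (affGrad p) (K.edge i j) = u (K.points i + K.edge i j) - u (K.points i) := by
  have := affine_eq p (K.points j) (K.points i)
  rw [h j, h i] at this
  rw [Tri.edge, add_sub_cancel, this]
  ring

/-- For the vertex opposite to the longest edge, the factor `2 h_K |b| |c| / |det|` of the smooth
estimate is exactly `4 R_K`. -/
theorem isCircumradiusConstant_four : IsCircumradiusConstant 4 := by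
  intro K u p hu hc hp
  obtain ⟨i, j, k, hij, hjk, hik, hlong, hb, hcc⟩ := K.exists_longest_edge
  have hdet := Tri.det2_edge_ne_zero (K := K) hij hjk hik
  have hsemi : semiW1 ∞ (interior K.carrier) (interior K.carrier) (fun x => u x - p x) =
      (eLpNorm (fun x => weakGrad (interior K.carrier) u x - affGrad p) ∞
        (volume.restrict (interior K.carrier))).toReal := by
    rw [semiW1, eLpNorm_congr_ae (weakGrad_sub_affine_ae_eq isOpen_interior hu.1 p)]
  rw [hsemi]
  have hR := Tri.two_mul_circumradius_mul_det (K := K) hij hjk hik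
  rw [Tri.interior_carrier_eq hij hjk hik] at hu ⊢
  rw [Tri.carrier_eq hij hjk hik] at hc
  rw [← hlong] at hb hcc
  have key := eLpNorm_top_interpolation_error_le hdet hu hc (hp.inner_edge i j)
    (hp.inner_edge i k) hb hcc le_rfl
  refine (ENNReal.toReal_mono ENNReal.ofReal_ne_top key).trans_eq ?_
  have hpos : 0 < |K.det| := abs_pos.2 K.det_ne_zero
  have hcoef : 2 * ‖K.edge i j - K.edge i k‖ * (‖K.edge i j‖ * ‖K.edge i k‖) /
      |det2 (K.edge i j) (K.edge i k)| = 4 * Affine.Simplex.circumradius K := by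
    rw [Tri.abs_det2_edge hij hjk hik, div_eq_iff hpos.ne']
    linear_combination -2 * hR
  rw [hcoef, ENNReal.toReal_ofReal]
  exact mul_nonneg (mul_nonneg (by norm_num) (Affine.Simplex.circumradius_nonneg K))
    ENNReal.toReal_nonneg

/-- The constant is `√(48 / κ)` with `κ = (1 + cos α₀) / 2`. At the vertex opposite to the longest
edge the angle is between `π / 3` and `α₀`, hence its squared sine is at least `κ`. -/
theorem exists_isMaxAngleConstant {α₀ : ℝ} (hα : α₀ < Real.pi) : ∃ C, IsMaxAngleConstant α₀ C := by
  rcases lt_or_ge α₀ 0 with hneg | hα0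
  · -- no triangle has a negative angle
    refine ⟨0, fun K u p hK => absurd (hK 0 1 2 (by decide) (by decide) (by decide)) ?_⟩
    exact not_le.2 (hneg.trans_le (EuclideanGeometry.angle_nonneg _ _ _))
  have hγ : 0 < 1 + Real.cos α₀ := by
    have := Real.cos_lt_cos_of_nonneg_of_le_pi hα0 le_rfl hα
    rw [Real.cos_pi] at this
    linarith
  set κ := (1 + Real.cos α₀) / 2 with hκ
  refine ⟨√(48 / κ), fun K u p hK hu hc hp => ?_⟩
  obtain ⟨i, j, k, hij, hjk, hik, hlong, hb, hcc⟩ := K.exists_longest_edge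
  have hdet := Tri.det2_edge_ne_zero (K := K) hij hjk hik
  have hsemi : semiW1 2 (interior K.carrier) (interior K.carrier) (fun x => u x - p x) =
      (eLpNorm (fun x => weakGrad (interior K.carrier) u x - affGrad p) 2
        (volume.restrict (interior K.carrier))).toReal := by
    rw [semiW1, eLpNorm_congr_ae (weakGrad_sub_affine_ae_eq isOpen_interior hu.1 p)]
  rw [hsemi]
  -- the sine of the angle opposite to the longest edge is bounded from below
  have hκd : κ * (‖K.edge i j‖ * ‖K.edge i k‖) ^ 2 ≤ det2 (K.edge i j) (K.edge i k) ^ 2 := by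
    have hang : Real.cos α₀ * (‖K.edge i j‖ * ‖K.edge i k‖) ≤
        inner ℝ (K.edge i j) (K.edge i k) := by
      have h1 := hK j i k hij.symm hik hjk
      have h2 := Real.cos_le_cos_of_nonneg_of_le_pi (EuclideanGeometry.angle_nonneg _ _ _)
        hα.le h1
      have h3 := InnerProductGeometry.cos_angle_mul_norm_mul_norm (K.edge i j) (K.edge i k)
      rw [← h3]
      exact mul_le_mul_of_nonneg_right h2 (by positivity)
    have hopp : 2 * inner ℝ (K.edge i j) (K.edge i k) ≤ ‖K.edge i j‖ * ‖K.edge i k‖ := by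
      have h1 := norm_sub_sq_real (K.edge i j) (K.edge i k)
      rw [hlong] at h1
      rcases le_total ‖K.edge i j‖ ‖K.edge i k‖ with h | h
      · nlinarith [norm_nonneg (K.edge i j), norm_nonneg (K.edge i k)]
      · nlinarith [norm_nonneg (K.edge i j), norm_nonneg (K.edge i k)]
    rw [det2_sq]
    have hn : 0 ≤ ‖K.edge i j‖ * ‖K.edge i k‖ := by positivity
    generalize ‖K.edge i j‖ * ‖K.edge i k‖ = n at *
    generalize inner ℝ (K.edge i j) (K.edge i k) = x at *
    have h1 : 0 ≤ n / 2 - x := by linarith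
    have h2 : 0 ≤ n + x - (1 + Real.cos α₀) * n := by linarith
    have h3 : 0 ≤ (1 + Real.cos α₀) * n := by positivity
    rw [hκ]
    nlinarith [mul_nonneg h1 h3, mul_nonneg h1 h2, mul_nonneg hn h2]
  rw [Tri.interior_carrier_eq hij hjk hik] at hu ⊢
  rw [Tri.carrier_eq hij hjk hik] at hc
  have key := eLpNorm_two_interpolation_error_le hdet hu hc (hp.inner_edge i j)
    (hp.inner_edge i k) hb hcc (by positivity : 0 < κ) hκd
  refine (ENNReal.toReal_mono ENNReal.ofReal_ne_top key).trans_eq (ENNReal.toReal_ofReal ?_)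
  exact mul_nonneg (mul_nonneg (by positivity) ((norm_nonneg _).trans hb)) ENNReal.toReal_nonneg

/-! ### A lower bound for the circumradius constant -/

theorem hasWeakPartial_of_contDiff {u : Plane → ℝ} (hu : ContDiff ℝ 1 u) (Ω : Set Plane)
    (i : Fin 2) : HasWeakPartial Ω i u fun x => fderiv ℝ u x (basisVec i) := by
  have hd : Continuous fun x => fderiv ℝ u x (basisVec i) :=
    (hu.continuous_fderiv (by norm_num)).clm_apply continuous_const
  refine HasWeakPartial.of_integral_eq (hu.continuous.locallyIntegrable.locallyIntegrableOn _)
    (hd.locallyIntegrable.locallyIntegrableOn _) fun φ hφ => ?_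
  have hint : ∀ {v : Plane → ℝ}, Continuous v → LocallyIntegrableOn v univ := fun hv =>
    hv.locallyIntegrable.locallyIntegrableOn _
  exact integral_mul_fderiv_eq_neg_fderiv_mul_of_integrable
    (integrable_mul_of_tsupport_subset (hint hd) hφ.1.continuous hφ.2.1 (subset_univ _))
    (integrable_mul_of_tsupport_subset (hint hu.continuous) (hφ.continuous_partial _)
      (hφ.hasCompactSupport_partial _) (subset_univ _))
    (integrable_mul_of_tsupport_subset (hint hu.continuous) hφ.1.continuous hφ.2.1
      (subset_univ _))
    (fun x _ => hu.differentiable (by norm_num) x) (fun x _ => hφ.1.differentiable (by simp) x)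

/-- A bound which holds almost everywhere on an open set, for a continuous function, holds on the
closure. -/
theorem le_of_ae_le_of_mem_closure {T : Set Plane} (hT : IsOpen T) {F : Plane → ℝ}
    (hF : Continuous F) {s : ℝ} (h : ∀ᵐ x ∂(volume.restrict T), F x ≤ s) {x : Plane}
    (hx : x ∈ closure T) : F x ≤ s := by
  have hsub : T ⊆ {y | F y ≤ s} := by
    intro y hy
    by_contra hlt
    have hopen : IsOpen (T ∩ {y | s < F y}) := hT.inter (isOpen_lt continuous_const hF)
    have hpos := hopen.measure_pos volume ⟨y, hy, show s < F y from not_le.1 hlt⟩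
    rw [ae_restrict_iff' hT.measurableSet, ae_iff] at h
    refine hpos.ne' (measure_mono_null (fun z hz => ?_) h)
    simpa using hz
  exact closure_minimal hsub (isClosed_le hF continuous_const) hx

/-- The function `|x|²` shows that the circumradius constant cannot be small: the gradient of its
interpolation error is twice the vector from the circumcenter. -/
theorem IsCircumradiusConstant.two_thirds_le {C : ℝ} (hC : IsCircumradiusConstant C) :
    2 / 3 ≤ C := by
  obtain ⟨b⟩ := AffineBasis.exists_affineBasis_of_finiteDimensional (k := ℝ) (P := Plane)
    (ι := Fin 3) (by simp)
  set K : Tri := ⟨b, b.ind⟩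
  set T := interior K.carrier
  have hT : IsOpen T := isOpen_interior
  obtain ⟨O, hO⟩ : ∃ O, O = Affine.Simplex.circumcenter K := ⟨_, rfl⟩
  have hR : ∀ l, ‖K.points l - O‖ = Affine.Simplex.circumradius K := fun l => by
    have := Affine.Simplex.dist_circumcenter_eq_circumradius K l
    rwa [dist_eq_norm, ← hO] at this
  have hRpos : 0 < Affine.Simplex.circumradius K := Affine.Simplex.circumradius_pos K
  obtain ⟨u, hu⟩ : ∃ u : Plane → ℝ, u = fun x => x 0 ^ 2 + x 1 ^ 2 := ⟨_, rfl⟩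
  have hus : ContDiff ℝ 1 u := by rw [hu]; fun_prop
  have hc : ∀ i : Fin 2, ContDiff ℝ 1 fun x : Plane => 2 * x i := fun i => by fun_prop
  have hproj : ∀ (i : Fin 2) (x : Plane), HasFDerivAt (fun x : Plane => x i)
      (innerSL ℝ (basisVec i)) x := fun i x => by
    have : (fun x : Plane => x i) = innerSL ℝ (basisVec i) := by
      ext y
      fin_cases i <;> simp [inner_eq_coords]
    rw [this]
    exact (innerSL ℝ (basisVec i)).hasFDerivAt
  have hw1 : ∀ i, HasWeakPartial T i u fun x => 2 * x i := fun i => by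
    have h := hasWeakPartial_of_contDiff hus T i
    have e : (fun x => fderiv ℝ u x (basisVec i)) = fun x => 2 * x i := by
      ext x
      have h1 := ((hproj 0 x).pow 2).add ((hproj 1 x).pow 2)
      rw [hu]
      erw [h1.fderiv]
      fin_cases i <;> simp [inner_eq_coords]
    rwa [e] at h
  have hw2 : ∀ i j : Fin 2, HasWeakPartial T j (fun x => 2 * x i)
      fun _ => if i = j then 2 else 0 := fun i j => by
    have h := hasWeakPartial_of_contDiff (hc i) T j
    have e : (fun x => fderiv ℝ (fun x : Plane => 2 * x i) x (basisVec j)) =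
        fun _ => if i = j then (2 : ℝ) else 0 := by
      ext x
      rw [((hproj i x).const_mul 2).fderiv]
      fin_cases i <;> fin_cases j <;> simp [inner_eq_coords]
    rwa [e] at h
  have hp1 : ∀ i, weakPartial T i u =ᵐ[volume.restrict T] fun x => 2 * x i := fun i =>
    (hw1 i).weakPartial_ae_eq hT
  have hw3 : ∀ i j, HasWeakPartial T j (weakPartial T i u) fun _ => if i = j then 2 else 0 :=
    fun i j => (hw2 i j).congr (hp1 i).symm EventuallyEq.rfl
  have hp2 : ∀ i j, weakPartial T j (weakPartial T i u) =ᵐ[volume.restrict T]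
      fun _ => if i = j then (2 : ℝ) else 0 := fun i j => (hw3 i j).weakPartial_ae_eq hT
  have hbdd : ∀ {v : Plane → ℝ}, Continuous v → MemLp v ∞ (volume.restrict T) := by
    intro v hv
    obtain ⟨M, hM⟩ := K.isCompact_carrier.exists_bound_of_continuousOn hv.continuousOn
    refine memLp_top_of_bound hv.aestronglyMeasurable M ?_
    exact (ae_restrict_iff' hT.measurableSet).2 (Eventually.of_forall fun x hx =>
      hM x (interior_subset hx))
  have hmem : MemW2 ∞ T u :=
    ⟨⟨hbdd hus.continuous, fun i => ⟨⟨_, hw1 i⟩, (memLp_congr_ae (hp1 i)).2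
        (hbdd (hc i).continuous)⟩⟩,
      fun i => ⟨(memLp_congr_ae (hp1 i)).2 (hbdd (hc i).continuous), fun j => ⟨⟨_, hw3 i j⟩,
        (memLp_congr_ae (hp2 i j)).2 (hbdd continuous_const)⟩⟩⟩
  obtain ⟨p, hp⟩ : ∃ p : Plane →ᵃ[ℝ] ℝ, ∀ x, p x = 2 * inner ℝ O (x - K.points 0) +
      u (K.points 0) := by
    refine ⟨((2 : ℝ) • (innerSL ℝ O).toLinearMap).toAffineMap +
      AffineMap.const ℝ Plane (u (K.points 0) - 2 * inner ℝ O (K.points 0)), fun x => ?_⟩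
    simp [inner_sub_right]
    ring
  have hpi : IsLagrangeInterpolant K u p := by
    intro l
    have h1 := norm_sub_sq_real (K.points l) O
    have h2 := norm_sub_sq_real (K.points 0) O
    rw [hR] at h1 h2
    rw [hp, inner_sub_right, hu]
    simp only
    rw [← norm_sq_eq_coords, ← norm_sq_eq_coords, real_inner_comm, real_inner_comm _ O]
    linarith
  have hg : affGrad p = (2 : ℝ) • O := by
    refine ext_inner_right ℝ fun v => ?_
    have h1 := affine_eq p v 0
    rw [hp, hp] at h1
    simp only [inner_sub_right, sub_zero, inner_zero_right] at h1
    rw [inner_smul_left]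
    simp only [RCLike.conj_to_real]
    linarith
  have key := hC K u p hmem hus.continuous.continuousOn hpi
  have hgrad : weakGrad T (fun x => u x - p x) =ᵐ[volume.restrict T]
      fun x => (2 : ℝ) • (x - O) := by
    filter_upwards [weakGrad_sub_affine_ae_eq hT hmem.1 p, hp1 0, hp1 1] with x hx h0 h1
    rw [hx, hg]
    ext i
    fin_cases i
    · simp [weakGrad, h0]; ring
    · simp [weakGrad, h1]; ring
  have hs1 : 2 * Affine.Simplex.circumradius K ≤ semiW1 ∞ T T (fun x => u x - p x) := by
    rw [semiW1, eLpNorm_congr_ae hgrad]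
    have hcont : Continuous fun x : Plane => (2 : ℝ) • (x - O) := by fun_prop
    have hfin : eLpNorm (fun x : Plane => (2 : ℝ) • (x - O)) ∞ (volume.restrict T) ≠ ⊤ := by
      obtain ⟨M, hM⟩ := K.isCompact_carrier.exists_bound_of_continuousOn hcont.continuousOn
      refine (memLp_top_of_bound hcont.aestronglyMeasurable M ?_).eLpNorm_ne_top
      exact (ae_restrict_iff' hT.measurableSet).2 (Eventually.of_forall fun x hx =>
        hM x (interior_subset hx))
    have hae : ∀ᵐ x ∂(volume.restrict T), ‖(2 : ℝ) • (x - O)‖ ≤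
        (eLpNorm (fun x : Plane => (2 : ℝ) • (x - O)) ∞ (volume.restrict T)).toReal :=
      ae_norm_le_eLpNorm_top hfin
    have := le_of_ae_le_of_mem_closure hT hcont.norm hae
      (K.carrier_subset_closure_interior (K.point_mem_carrier 0))
    rwa [norm_smul, hR, Real.norm_ofNat] at this
  have hs2 : semiW2 ∞ T T u ≤ 3 := by
    refine ENNReal.toReal_le_of_le_ofReal (by norm_num) ?_
    rw [eLpNorm_exponent_top]
    refine eLpNormEssSup_le_of_ae_bound ?_
    filter_upwards [hp2 0 0, hp2 0 1, hp2 1 0, hp2 1 1] with x h1 h2 h3 h4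
    refine abs_le_of_sq_le_sq' ?_ (by norm_num) |>.2
    rw [EuclideanSpace.norm_sq_eq, Fintype.sum_prod_type]
    simp [Fin.sum_univ_two, weakHess, h1, h2, h3, h4]
    norm_num
  have hs20 : 0 ≤ semiW2 ∞ T T u := ENNReal.toReal_nonneg
  have h5 : 2 * Affine.Simplex.circumradius K ≤
      C * Affine.Simplex.circumradius K * semiW2 ∞ T T u := hs1.trans key
  have h6 : 2 ≤ C * semiW2 ∞ T T u := by
    refine le_of_mul_le_mul_right ?_ hRpos
    linarith
  by_contra hlt
  rcases le_or_gt C 0 with h | h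
  · nlinarith
  · nlinarith

/-! ### Lipschitz functions -/

/-- A function on the plane which is Lipschitz with the same constant on each of finitely many
closed sets covering the plane is Lipschitz. -/
theorem lipschitzWith_of_finite_closed_cover {ι : Type*} [Finite ι] {S : ι → Set Plane}
    (hS : ∀ i, IsClosed (S i)) (hcov : ∀ x, ∃ i, x ∈ S i) {f : Plane → ℝ} {C : NNReal}
    (hf : ∀ i, LipschitzOnWith C f (S i)) : LipschitzWith C f := by
  refine LipschitzWith.of_dist_le_mul fun x y => ?_
  have hcont : Continuous f := (locallyFinite_of_finite S).continuous
    (iUnion_eq_univ_iff.2 hcov) hS fun i => (hf i).continuousOn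
  obtain ⟨γ, hγ⟩ : ∃ γ : ℝ → Plane, γ = fun t => AffineMap.lineMap x y t := ⟨_, rfl⟩
  have hγc : Continuous γ := by rw [hγ]; exact AffineMap.lineMap_continuous
  have hd : ∀ s t, dist (γ s) (γ t) = dist s t * dist x y := fun s t => by
    rw [hγ]; exact dist_lineMap_lineMap x y s t
  have hγ0 : γ 0 = x := by simp [hγ]
  have hγ1 : γ 1 = y := by simp [hγ]
  have hZ : IsClosed {t : ℝ | dist (f x) (f (γ t)) ≤ C * (t * dist x y)} :=
    isClosed_le (by fun_prop) (by fun_prop)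
  have h01 : Icc (0 : ℝ) 1 ⊆ {t : ℝ | dist (f x) (f (γ t)) ≤ C * (t * dist x y)} := by
    refine (hZ.inter isClosed_Icc).Icc_subset_of_forall_exists_gt (by simp [hγ0])
      fun t ht y' hy' => ?_
    -- some piece contains `γ s` for `s > t` arbitrarily close to `t`
    obtain ⟨i, hi⟩ : ∃ i, ∃ᶠ s in 𝓝[>] t, γ s ∈ S i := by
      by_contra hcon
      simp only [not_exists, not_frequently] at hcon
      obtain ⟨s, hs⟩ := (eventually_all.2 hcon).exists
      obtain ⟨i, hi⟩ := hcov (γ s)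
      exact hs i hi
    have hti : γ t ∈ S i := (hS i).mem_of_frequently_of_tendsto hi
      ((hγc.tendsto t).mono_left nhdsWithin_le_nhds)
    obtain ⟨s, hsi, hs⟩ := (hi.and_eventually (Ioc_mem_nhdsGT hy')).exists
    refine ⟨s, ?_, hs⟩
    have h1 := (hf i).dist_le_mul _ hti _ hsi
    rw [hd, dist_comm t s, Real.dist_eq s t, abs_of_pos (sub_pos.2 hs.1)] at h1
    have h2 : dist (f x) (f (γ t)) ≤ C * (t * dist x y) := ht.1
    calc dist (f x) (f (γ s)) ≤ dist (f x) (f (γ t)) + dist (f (γ t)) (f (γ s)) :=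
          dist_triangle _ _ _
      _ ≤ C * (t * dist x y) + C * ((s - t) * dist x y) := add_le_add h2 h1
      _ = C * (s * dist x y) := by ring
  have := h01 (right_mem_Icc.2 zero_le_one)
  simpa [hγ1] using this

/-- The factor `2` comes from estimating the two components separately. -/
theorem norm_lineGrad_le {C : NNReal} {u : Plane → ℝ} (hu : LipschitzWith C u) (x : Plane) :
    ‖lineGrad u x‖ ≤ 2 * C := by
  have h : ∀ i, |lineGrad u x i| ≤ C := fun i => by
    have := norm_lineDeriv_le_of_lipschitz ℝ (v := basisVec i) (x₀ := x) hu
    simpa [lineGrad, basisVec] using this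
  have h2 : ‖lineGrad u x‖ ^ 2 ≤ (2 * C) ^ 2 := by
    rw [norm_sq_eq_coords]
    have h0 := sq_le_sq' (neg_le_of_abs_le (h 0)) (le_of_abs_le (h 0))
    have h1 := sq_le_sq' (neg_le_of_abs_le (h 1)) (le_of_abs_le (h 1))
    nlinarith [sq_nonneg (C : ℝ)]
  exact abs_le_of_sq_le_sq' h2 (by positivity) |>.2

theorem measurable_lineGrad {u : Plane → ℝ} (hu : Continuous u) : Measurable (lineGrad u) :=
  (PiLp.continuous_toLp 2 _).measurable.comp
    (measurable_pi_lambda _ fun _ => measurable_lineDeriv hu)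

theorem locallyIntegrable_lineGrad {C : NNReal} {u : Plane → ℝ} (hu : LipschitzWith C u) :
    LocallyIntegrable (lineGrad u) :=
  (memLp_top_of_bound (measurable_lineGrad hu.continuous).aestronglyMeasurable (2 * C)
    (Eventually.of_forall (norm_lineGrad_le hu))).locallyIntegrable le_top

theorem mollify_congr (φ : ContDiffBump (0 : Plane)) {F : Type*} [NormedAddCommGroup F]
    [NormedSpace ℝ F] {u v : Plane → F} {x : Plane}
    (h : ∀ y ∈ Metric.ball x φ.rOut, u y = v y) : mollify φ u x = mollify φ v x := by
  rw [mollify_apply_swap, mollify_apply_swap]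
  congr 1
  ext y
  by_cases hy : y ∈ Metric.ball x φ.rOut
  · rw [h y hy]
  · have : x - y ∉ Function.support (φ.normed volume) := by
      rw [φ.support_normed_eq, mem_ball_zero_iff]
      rwa [mem_ball_iff_norm'] at hy
    rw [Function.notMem_support.1 this, zero_smul, zero_smul]

/-- The gradient form of `fderiv_mollify`. -/
theorem gradient_mollify (φ : ContDiffBump (0 : Plane)) {Ω : Set Plane} {u : Plane → ℝ}
    {H : Plane → Plane} (hu : LocallyIntegrable u) (hH : LocallyIntegrable H)
    (h : HasWeakGrad Ω u H) {x : Plane} (hx : Metric.closedBall x φ.rOut ⊆ Ω) :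
    gradient (mollify φ u) x = mollify φ H x := by
  ext i
  rw [gradient_apply, fderiv_mollify φ hu (h i) hx, mollify_coord φ hH]

theorem norm_gradient (f : Plane → ℝ) (x : Plane) : ‖gradient f x‖ = ‖fderiv ℝ f x‖ :=
  LinearIsometryEquiv.norm_map _ _

/-- A function on the plane with a bounded weak gradient coincides almost everywhere with a
Lipschitz function. -/
theorem exists_lipschitzWith_of_hasWeakGrad {g : Plane → ℝ} {H : Plane → Plane} {M : ℝ}
    (hg : LocallyIntegrable g) (hH : LocallyIntegrable H) (h : HasWeakGrad univ g H)
    (hM : ∀ᵐ x, ‖H x‖ ≤ M) : ∃ C U, LipschitzWith C U ∧ U =ᵐ[volume] g := by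
  have hr : ∀ n : ℕ, (0 : ℝ) < 1 / ((n : ℝ) + 1) := fun n => by positivity
  have hae := ae_tendsto_mollify hg hr tendsto_one_div_add_atTop_nhds_zero_nat
  have hlip : ∀ n, LipschitzWith M.toNNReal (mollify (bumpOfRadius _ (hr n)) g) := fun n => by
    refine lipschitzWith_of_nnnorm_fderiv_le
      ((contDiff_mollify _ hg).differentiable (by simp)) fun x => ?_
    rw [← NNReal.coe_le_coe, coe_nnnorm, Real.coe_toNNReal', ← norm_gradient,
      gradient_mollify _ hg hH h (subset_univ _)]
    exact le_max_of_le_left (norm_mollify_le_of_ae _ hM x)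
  have hS : LipschitzOnWith M.toNNReal g {x | Tendsto
      (fun n => mollify (bumpOfRadius _ (hr n)) g x) atTop (𝓝 (g x))} :=
    LipschitzOnWith.of_dist_le_mul fun x hx y hy =>
      le_of_tendsto (hx.dist hy) (Eventually.of_forall fun n => (hlip n).dist_le_mul x y)
  obtain ⟨U, hU, hUg⟩ := hS.extend_real
  exact ⟨_, U, hU, by filter_upwards [hae] with x hx using (hUg hx).symm⟩

/-! ### The space `H¹₀` -/

theorem tendsto_integral_mul_of_tendsto_eLpNorm {μ : Measure Plane} {f : ℕ → Plane → ℝ}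
    {F g : Plane → ℝ} (hf : ∀ n, MemLp (f n) 2 μ) (hF : MemLp F 2 μ) (hg : MemLp g 2 μ)
    (h : Tendsto (fun n => eLpNorm (fun x => f n x - F x) 2 μ) atTop (𝓝 0)) :
    Tendsto (fun n => ∫ x, f n x * g x ∂μ) atTop (𝓝 (∫ x, F x * g x ∂μ)) := by
  refine tendsto_integral_of_L1' _ (hF.integrable_mul hg).aestronglyMeasurable
    (Eventually.of_forall fun n => (hf n).integrable_mul hg) ?_
  have hlim : Tendsto (fun n => eLpNorm (fun x => f n x - F x) 2 μ * eLpNorm g 2 μ) atTop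
      (𝓝 0) := by
    simpa using ENNReal.Tendsto.mul_const h (Or.inr hg.eLpNorm_ne_top)
  refine tendsto_of_tendsto_of_tendsto_of_le_of_le tendsto_const_nhds hlim (fun _ => zero_le)
    fun n => ?_
  have := eLpNorm_smul_le_mul_eLpNorm (p := 2) (q := 2) (r := 1) hg.aestronglyMeasurable
    ((hf n).sub hF).aestronglyMeasurable
  refine le_trans (le_of_eq ?_) this
  congr 1
  ext x
  simp [sub_mul]

/-- The extension by zero of an `L²` limit of test functions has a weak gradient on the whole
plane. -/
theorem hasWeakGrad_indicator_of_tendsto {Ω : Set Plane} (hΩ : MeasurableSet Ω) {v : Plane → ℝ}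
    {G : Plane → Plane} (hv : MemLp v 2 (volume.restrict Ω)) (hG : MemLp G 2 (volume.restrict Ω))
    {φ : ℕ → Plane → ℝ} (hφ : ∀ n, IsTestFunction Ω (φ n))
    (h0 : Tendsto (fun n => eLpNorm (fun x => φ n x - v x) 2 (volume.restrict Ω)) atTop (𝓝 0))
    (h1 : Tendsto (fun n => eLpNorm (fun x => gradient (φ n) x - G x) 2 (volume.restrict Ω))
      atTop (𝓝 0)) :
    HasWeakGrad univ (Ω.indicator v) (Ω.indicator G) := by
  intro i
  have hloc : ∀ {f : Plane → ℝ}, MemLp f 2 (volume.restrict Ω) →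
      LocallyIntegrableOn (Ω.indicator f) univ := fun hf =>
    locallyIntegrableOn_univ.2
      (((memLp_indicator_iff_restrict hΩ).2 hf).locallyIntegrable one_le_two)
  have hGi : MemLp (fun x => G x i) 2 (volume.restrict Ω) := (memLp_piLp_iff.1 hG) i
  have hcomp : (fun x => Ω.indicator G x i) = Ω.indicator fun x => G x i := by
    ext x
    by_cases hx : x ∈ Ω <;> simp [hx]
  have hset : ∀ f ψ : Plane → ℝ, ∫ x, Ω.indicator f x * ψ x = ∫ x in Ω, f x * ψ x := fun f ψ => by
    rw [← integral_indicator hΩ]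
    simp only [indicator_mul_left]
  rw [hcomp]
  refine HasWeakPartial.of_integral_eq (hloc hv) (hloc hGi) fun ψ hψ => ?_
  rw [hset, hset]
  have l0 := tendsto_integral_mul_of_tendsto_eLpNorm
    (fun n => ((hφ n).1.continuous.memLp_of_hasCompactSupport (hφ n).2.1).restrict Ω) hv
    (((hψ.continuous_partial (basisVec i)).memLp_of_hasCompactSupport
      (hψ.hasCompactSupport_partial _)).restrict Ω) h0
  have hp : ∀ n, MemLp (fun x => fderiv ℝ (φ n) x (basisVec i)) 2 (volume.restrict Ω) := fun n =>
    (((hφ n).continuous_partial (basisVec i)).memLp_of_hasCompactSupport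
      ((hφ n).hasCompactSupport_partial _)).restrict Ω
  have l1 := tendsto_integral_mul_of_tendsto_eLpNorm hp hGi
    ((hψ.1.continuous.memLp_of_hasCompactSupport hψ.2.1).restrict Ω) (by
      refine tendsto_of_tendsto_of_tendsto_of_le_of_le tendsto_const_nhds h1 (fun _ => zero_le)
        fun n => eLpNorm_mono fun x => ?_
      have := PiLp.norm_apply_le (gradient (φ n) x - G x) i
      rwa [PiLp.sub_apply, gradient_apply] at this)
  refine tendsto_nhds_unique l0 (l1.neg.congr fun n => ?_)
  have e := (hasWeakPartial_of_contDiff ((hφ n).1.of_le (by simp)) univ i).integral_eq hψ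
  rw [setIntegral_eq_integral_of_forall_compl_eq_zero,
    setIntegral_eq_integral_of_forall_compl_eq_zero, e]
  · intro x hx
    rw [image_eq_zero_of_notMem_tsupport fun h => hx ((hφ n).2.2 h), zero_mul]
  · intro x hx
    rw [image_eq_zero_of_notMem_tsupport (f := fun x => fderiv ℝ (φ n) x (basisVec i))
      fun h => hx ((hφ n).tsupport_partial_subset _ h), zero_mul]

theorem MemH10.hasWeakGrad_indicator {Ω : Set Plane} (hΩ : IsOpen Ω) {u : Plane → ℝ}
    (h : MemH10 Ω u) : HasWeakGrad univ (Ω.indicator u) (Ω.indicator (weakGrad Ω u)) := by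
  obtain ⟨h1, φ, hφ, l0, l1⟩ := h
  exact hasWeakGrad_indicator_of_tendsto hΩ.measurableSet h1.1 h1.memLp_weakGrad hφ l0 l1

/-- A function in `H¹₀ ∩ W^{1,∞}` has a Lipschitz representative that vanishes outside `Ω`. -/
theorem MemH10.exists_lipschitzWith {Ω : Set Plane} (hΩ : IsOpen Ω)
    (hreg : closure (interior Ωᶜ) = Ωᶜ) {u : Plane → ℝ} (h : MemH10 Ω u) (hu : MemW1 ∞ Ω u) :
    ∃ C U, LipschitzWith C U ∧ U =ᵐ[volume.restrict Ω] u ∧ ∀ x ∉ Ω, U x = 0 := by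
  have hm := hΩ.measurableSet
  have hg : MemLp (Ω.indicator u) 2 := (memLp_indicator_iff_restrict hm).2 h.1.1
  have hH : MemLp (Ω.indicator (weakGrad Ω u)) ∞ :=
    (memLp_indicator_iff_restrict hm).2 hu.memLp_weakGrad
  obtain ⟨C, U, hU, hUu⟩ := exists_lipschitzWith_of_hasWeakGrad (hg.locallyIntegrable one_le_two)
    (hH.locallyIntegrable le_top) (h.hasWeakGrad_indicator hΩ)
    (ae_norm_le_eLpNorm_top hH.eLpNorm_ne_top)
  refine ⟨C, U, hU, ?_, fun x hx => ?_⟩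
  · rw [EventuallyEq, ae_restrict_iff' hm]
    filter_upwards [hUu] with x hx hxΩ
    rw [hx, indicator_of_mem hxΩ]
  · have := le_of_ae_le_of_mem_closure (T := interior Ωᶜ) isOpen_interior hU.continuous.norm
      (s := 0) (by
        rw [ae_restrict_iff' isOpen_interior.measurableSet]
        filter_upwards [hUu] with y hy hyΩ
        rw [hy, indicator_of_notMem (interior_subset hyΩ), norm_zero]) (x := x) (by
        rw [hreg]; exact hx)
    exact norm_le_zero_iff.1 this

/-- The soft threshold: it moves every number by `δ` towards zero, stopping at zero. -/
def softThreshold (δ s : ℝ) : ℝ := s - max (-δ) (min δ s)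

theorem softThreshold_of_abs_le {δ s : ℝ} (h : |s| ≤ δ) : softThreshold δ s = 0 := by
  rw [abs_le] at h
  rw [softThreshold, min_eq_right h.2, max_eq_right h.1, sub_self]

theorem softThreshold_of_lt {δ s : ℝ} (hδ : 0 ≤ δ) (h : δ < s) : softThreshold δ s = s - δ := by
  rw [softThreshold, min_eq_left h.le, max_eq_right (by linarith)]

theorem softThreshold_of_lt_neg {δ s : ℝ} (hδ : 0 ≤ δ) (h : s < -δ) :
    softThreshold δ s = s + δ := by
  rw [softThreshold, min_eq_right (by linarith), max_eq_left h.le, sub_neg_eq_add]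

theorem abs_softThreshold_sub_le {δ : ℝ} (hδ : 0 ≤ δ) (s : ℝ) : |softThreshold δ s - s| ≤ δ := by
  rw [softThreshold, sub_sub_cancel_left, abs_neg, abs_le]
  exact ⟨le_max_left _ _, max_le (by linarith) (min_le_left _ _)⟩

theorem lipschitzWith_softThreshold {δ : ℝ} (hδ : 0 ≤ δ) : LipschitzWith 1 (softThreshold δ) := by
  refine LipschitzWith.of_le_add fun s t => ?_
  have h1 := le_abs_self (s - t)
  have h2 := abs_nonneg (s - t)
  simp only [softThreshold, Real.dist_eq]
  rcases le_total s δ with a | a <;> rcases le_total t δ with b | b <;>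
    rcases le_total (-δ) s with c | c <;> rcases le_total (-δ) t with d | d <;>
    simp only [min_eq_left, min_eq_right, max_eq_left, max_eq_right, a, b, c, d,
      neg_le_self hδ] <;> linarith

/-- Where the threshold is exceeded, soft thresholding changes the function by a constant. -/
theorem lineGrad_softThreshold {δ : ℝ} (hδ : 0 ≤ δ) {V : Plane → ℝ} (hV : Continuous V)
    {x : Plane} (hx : δ < |V x|) : lineGrad (fun y => softThreshold δ (V y)) x = lineGrad V x := by
  have key : ∀ c : ℝ, (∀ᶠ y in 𝓝 x, softThreshold δ (V y) = V y + c) →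
      lineGrad (fun y => softThreshold δ (V y)) x = lineGrad V x := by
    intro c hc
    ext i
    simp only [lineGrad]
    rw [Filter.EventuallyEq.lineDeriv_eq (f := fun y => V y + c) hc]
    simp [lineDeriv]
  rcases lt_abs.1 hx with h | h
  · refine key (-δ) ?_
    filter_upwards [(isOpen_lt continuous_const hV).mem_nhds h] with y hy
    rw [softThreshold_of_lt hδ hy, sub_eq_add_neg]
  · refine key δ ?_
    filter_upwards [(isOpen_lt hV continuous_const).mem_nhds (lt_neg_of_lt_neg h)] with y hy
    exact softThreshold_of_lt_neg hδ hy

/-- A Lipschitz function vanishing outside a bounded open set is approximated by mollifications of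
its soft thresholds, which have compact support. -/
theorem exists_testFunction_approximation {Ω : Set Plane} (hb : Bornology.IsBounded Ω)
    {C : NNReal} {V : Plane → ℝ} (hV : LipschitzWith C V) (h0 : ∀ x ∉ Ω, V x = 0) :
    ∃ φ : ℕ → Plane → ℝ, (∀ n, IsTestFunction Ω (φ n)) ∧
      (∀ n x, ‖φ n x - V x‖ ≤ 3 * C + 2) ∧ (∀ x, Tendsto (fun n => φ n x) atTop (𝓝 (V x))) ∧
      (∀ n x, ‖gradient (φ n) x‖ ≤ 2 * C) ∧
      ∀ᵐ x, Tendsto (fun n => gradient (φ n) x) atTop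
        (𝓝 ({x | V x ≠ 0}.indicator (lineGrad V) x)) := by
  obtain ⟨r, hr⟩ : ∃ r : ℕ → ℝ, r = fun n : ℕ => 1 / ((n : ℝ) + 1) := ⟨_, rfl⟩
  have hr0 : ∀ n, 0 < r n := fun n => by rw [hr]; positivity
  have hr1 : ∀ n, r n ≤ 1 := fun n => by
    rw [hr]
    exact div_le_one_of_le₀ (by linarith [(n.cast_nonneg : (0 : ℝ) ≤ n)]) (by positivity)
  have hrlim : Tendsto r atTop (𝓝 0) := by
    rw [hr]; exact tendsto_one_div_add_atTop_nhds_zero_nat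
  have hC : (0 : ℝ) ≤ C := C.coe_nonneg
  -- the threshold exceeds the oscillation `C * r n` of `V` over the support of the mollifier
  obtain ⟨δ, hδ⟩ : ∃ δ : ℕ → ℝ, δ = fun n => 2 * (C + 1) * r n := ⟨_, rfl⟩
  have hδ0 : ∀ n, 0 ≤ δ n := fun n => by
    have := hr0 n
    rw [hδ]; positivity
  obtain ⟨W, hWdef⟩ : ∃ W : ℕ → Plane → ℝ, W = fun n x => softThreshold (δ n) (V x) := ⟨_, rfl⟩
  have hW : ∀ n, LipschitzWith C (W n) := fun n => by
    have := (lipschitzWith_softThreshold (hδ0 n)).comp hV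
    rwa [one_mul, show softThreshold (δ n) ∘ V = W n by rw [hWdef]; rfl] at this
  have hloc : ∀ n, LocallyIntegrable (W n) := fun n => (hW n).continuous.locallyIntegrable
  obtain ⟨φ, hφ⟩ : ∃ φ : ℕ → Plane → ℝ, φ = fun n => mollify (bumpOfRadius (r n) (hr0 n)) (W n) :=
    ⟨_, rfl⟩
  have hVnear : ∀ n x, ∀ y ∈ Metric.ball x (r n), |V y - V x| ≤ C * r n := fun n x y hy => by
    have := hV.dist_le_mul y x
    rw [Real.dist_eq] at this
    exact this.trans (mul_le_mul_of_nonneg_left (Metric.mem_ball.1 hy).le hC)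
  have hVnear' : ∀ n x, ∀ y ∈ Metric.ball x (r n), |V x| - C * r n ≤ |V y| := fun n x y hy => by
    have h1 := hVnear n x y hy
    have h2 := abs_sub_abs_le_abs_sub (V x) (V y)
    rw [abs_sub_comm] at h2
    linarith
  have hφV : ∀ n x, ‖φ n x - V x‖ ≤ (3 * C + 2) * r n := fun n x => by
    have h1 := ContDiffBump.dist_normed_convolution_le (φ := bumpOfRadius (r n) (hr0 n))
      (x₀ := x) (ε := C * r n) (μ := volume) (hW n).continuous.aestronglyMeasurable (fun y hy =>
        ((hW n).dist_le_mul y x).trans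
          (mul_le_mul_of_nonneg_left (Metric.mem_ball.1 hy).le hC))
    have h2 := abs_softThreshold_sub_le (hδ0 n) (V x)
    rw [← Real.dist_eq] at h2
    have h3 := dist_triangle (φ n x) (W n x) (V x)
    rw [← dist_eq_norm]
    have h4 : dist (φ n x) (W n x) ≤ C * r n := by rw [hφ]; exact h1
    have h5 : dist (W n x) (V x) ≤ δ n := by rw [hWdef]; exact h2
    have h6 : δ n = 2 * (C + 1) * r n := by rw [hδ]
    linarith
  have hgrad : ∀ n x, gradient (φ n) x =
      mollify (bumpOfRadius (r n) (hr0 n)) (lineGrad (W n)) x := fun n x => by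
    rw [hφ]
    exact gradient_mollify _ (hloc n) (locallyIntegrable_lineGrad (hW n))
      (hasWeakGrad_lineGrad (hW n) univ) (subset_univ _)
  -- where `|V|` is small, the soft threshold vanishes on the support of the mollifier
  have hzero : ∀ n x, ∀ y ∈ Metric.ball x (r n), |V x| ≤ δ n - C * r n → W n y = 0 :=
    fun n x y hy hx => by
      have h1 := hVnear n x y hy
      have h2 := abs_sub_abs_le_abs_sub (V y) (V x)
      rw [hWdef]
      exact softThreshold_of_abs_le (by linarith)
  refine ⟨φ, fun n => ?_, fun n x => (hφV n x).trans (mul_le_of_le_one_right (by positivity)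
    (hr1 n)), fun x => ?_, fun n x => ?_, ?_⟩
  · have hsub : tsupport (φ n) ⊆ {x | δ n - C * r n ≤ |V x|} := by
      refine closure_minimal (fun x hx => ?_) (isClosed_le continuous_const hV.continuous.abs)
      by_contra hlt
      refine hx ?_
      rw [hφ]
      simp only
      rw [mollify_congr (v := fun _ => 0) _ fun y hy => hzero n x y hy (not_le.1 hlt).le,
        mollify_apply]
      simp
    have hpos : 0 < δ n - C * r n := by
      have := hr0 n
      rw [hδ]
      nlinarith
    have hsupp : tsupport (φ n) ⊆ Ω := fun x hx => by
      by_contra hxΩ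
      have := hsub hx
      rw [mem_ofPred_eq, h0 x hxΩ, abs_zero] at this
      linarith
    refine ⟨by rw [hφ]; exact contDiff_mollify _ (hloc n), ?_, hsupp⟩
    exact Metric.isCompact_of_isClosed_isBounded (isClosed_tsupport _) (hb.subset hsupp)
  · rw [tendsto_iff_norm_sub_tendsto_zero]
    refine squeeze_zero (fun n => norm_nonneg _) (fun n => hφV n x) ?_
    simpa using hrlim.const_mul (3 * (C : ℝ) + 2)
  · rw [hgrad]
    exact norm_mollify_le_of_ae _ (Eventually.of_forall (norm_lineGrad_le (hW n))) x
  · filter_upwards [ae_tendsto_mollify (locallyIntegrable_lineGrad hV) hr0 hrlim] with x hx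
    by_cases hVx : V x = 0
    · rw [indicator_of_notMem (by simp [hVx])]
      refine tendsto_const_nhds.congr fun n => ?_
      have hxn : |V x| < δ n - C * r n := by
        have := hr0 n
        rw [hVx, abs_zero, hδ]
        nlinarith
      -- `φ n` vanishes near `x`
      have hev : φ n =ᶠ[𝓝 x] fun _ => 0 := by
        filter_upwards [(isOpen_lt hV.continuous.abs continuous_const).mem_nhds hxn] with z hz
        rw [hφ]
        simp only
        rw [mollify_congr (v := fun _ => 0) _ fun y hy => hzero n z y hy (le_of_lt hz),
          mollify_apply]
        simp
      rw [gradient, hev.fderiv_eq]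
      simp
    · rw [indicator_of_mem (by exact hVx)]
      refine hx.congr' ?_
      have hlim : Tendsto (fun n => δ n + C * r n) atTop (𝓝 0) := by
        have := hrlim.const_mul (2 * ((C : ℝ) + 1) + C)
        rw [mul_zero] at this
        refine this.congr fun n => ?_
        rw [hδ]
        ring
      filter_upwards [hlim.eventually (gt_mem_nhds (abs_pos.2 hVx))] with n hn
      rw [hgrad]
      refine mollify_congr _ fun y hy => ?_
      rw [hWdef]
      refine (lineGrad_softThreshold (hδ0 n) hV.continuous ?_).symm
      have := hVnear' n x y hy
      linarith

/-- Dominated convergence in `L²` of a finite measure. -/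
theorem tendsto_eLpNorm_two_of_bound {E : Type*} [NormedAddCommGroup E] {μ : Measure Plane}
    [IsFiniteMeasure μ] {f : ℕ → Plane → E} {F : Plane → E} {M : ℝ}
    (hf : ∀ n, AEStronglyMeasurable (f n) μ) (hF : AEStronglyMeasurable F μ)
    (hM : ∀ n, ∀ᵐ x ∂μ, ‖f n x - F x‖ ≤ M)
    (h : ∀ᵐ x ∂μ, Tendsto (fun n => f n x) atTop (𝓝 (F x))) :
    Tendsto (fun n => eLpNorm (fun x => f n x - F x) 2 μ) atTop (𝓝 0) := by
  have hl : Tendsto (fun n => ∫⁻ x, ‖f n x - F x‖ₑ ^ (2 : ℝ) ∂μ) atTop (𝓝 (∫⁻ _, 0 ∂μ)) := by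
    refine tendsto_lintegral_of_dominated_convergence' (fun _ => ENNReal.ofReal M ^ (2 : ℝ))
      (fun n => ((hf n).sub hF).enorm.pow_const _) (fun n => ?_) ?_ ?_
    · filter_upwards [hM n] with x hx
      gcongr
      rw [← ofReal_norm]
      exact ENNReal.ofReal_le_ofReal hx
    · rw [lintegral_const]
      exact ENNReal.mul_ne_top (by simp) (measure_ne_top _ _)
    · filter_upwards [h] with x hx
      have h1 : Tendsto (fun n => ‖f n x - F x‖ₑ) atTop (𝓝 0) := by
        have := (hx.sub_const (F x)).enorm
        simpa using this
      have h2 := (ENNReal.continuous_rpow_const (y := 2)).tendsto 0 |>.comp h1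
      simpa [Function.comp_def] using h2
  rw [lintegral_zero] at hl
  have h2 := (ENNReal.continuous_rpow_const (y := 1 / 2)).tendsto 0 |>.comp hl
  rw [ENNReal.zero_rpow_of_pos (by norm_num)] at h2
  refine h2.congr fun n => ?_
  rw [eLpNorm_eq_lintegral_rpow_enorm_toReal two_ne_zero ENNReal.ofNat_ne_top]
  simp

theorem memW1_of_lipschitzWith {Ω : Set Plane} (hΩ : IsOpen Ω) (hb : Bornology.IsBounded Ω)
    {C : NNReal} {V : Plane → ℝ} (hV : LipschitzWith C V) (p : ℝ≥0∞) : MemW1 p Ω V := by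
  have : IsFiniteMeasure (volume.restrict Ω) :=
    isFiniteMeasure_restrict.2 hb.measure_lt_top.ne
  refine ⟨?_, fun i => ⟨⟨_, hasWeakGrad_lineGrad hV Ω i⟩, ?_⟩⟩
  · obtain ⟨M, hM⟩ := hb.isCompact_closure.exists_bound_of_continuousOn hV.continuous.continuousOn
    refine MemLp.of_bound hV.continuous.aestronglyMeasurable M ?_
    exact (ae_restrict_iff' hΩ.measurableSet).2
      (Eventually.of_forall fun x hx => hM x (subset_closure hx))
  · refine (memLp_congr_ae ((hasWeakGrad_lineGrad hV Ω i).weakPartial_ae_eq hΩ)).2 ?_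
    refine MemLp.of_bound (C := 2 * C)
      (measurable_lineDeriv hV.continuous).aestronglyMeasurable ?_
    exact Eventually.of_forall fun x =>
      (PiLp.norm_apply_le (lineGrad V x) i).trans (norm_lineGrad_le hV x)

/-- A Lipschitz function vanishing outside a bounded open set `Ω` belongs to `H¹₀(Ω)`. -/
theorem memH10_of_lipschitzWith {Ω : Set Plane} (hΩ : IsOpen Ω) (hb : Bornology.IsBounded Ω)
    {C : NNReal} {V : Plane → ℝ} (hV : LipschitzWith C V) (h0 : ∀ x ∉ Ω, V x = 0) :
    MemH10 Ω V := by
  have : IsFiniteMeasure (volume.restrict Ω) :=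
    isFiniteMeasure_restrict.2 hb.measure_lt_top.ne
  obtain ⟨φ, hφ, hbd, hlim, hgbd, hglim⟩ := exists_testFunction_approximation hb hV h0
  have hW1 := memW1_of_lipschitzWith hΩ hb hV 2
  -- the limit of the gradients of the approximations turns out to be the weak gradient of `V`
  obtain ⟨G, hG⟩ : ∃ G, G = {x | V x ≠ 0}.indicator (lineGrad V) := ⟨_, rfl⟩
  have hGm : Measurable G := by
    rw [hG]
    exact (measurable_lineGrad hV.continuous).indicator
      (isOpen_ne_fun hV.continuous continuous_const).measurableSet
  have hGb : ∀ x, ‖G x‖ ≤ 2 * C := fun x => by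
    rw [hG]
    exact (norm_indicator_le_norm_self _ _).trans (norm_lineGrad_le hV x)
  have hφm : ∀ n, Continuous (gradient (φ n)) := fun n =>
    (InnerProductSpace.toDual ℝ Plane).symm.continuous.comp
      ((hφ n).1.continuous_fderiv (by simp))
  have l0 : Tendsto (fun n => eLpNorm (fun x => φ n x - V x) 2 (volume.restrict Ω)) atTop (𝓝 0) :=
    tendsto_eLpNorm_two_of_bound (fun n => (hφ n).1.continuous.aestronglyMeasurable)
      hV.continuous.aestronglyMeasurable (fun n => Eventually.of_forall (hbd n))
      (Eventually.of_forall hlim)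
  have l1 : Tendsto (fun n => eLpNorm (fun x => gradient (φ n) x - G x) 2 (volume.restrict Ω))
      atTop (𝓝 0) := by
    refine tendsto_eLpNorm_two_of_bound (M := 2 * C + 2 * C)
      (fun n => (hφm n).aestronglyMeasurable) hGm.aestronglyMeasurable
      (fun n => Eventually.of_forall fun x => (norm_sub_le _ _).trans
        (add_le_add (hgbd n x) (hGb x))) ?_
    rw [hG]
    exact ae_restrict_of_ae hglim
  have hGL : MemLp G 2 (volume.restrict Ω) :=
    MemLp.of_bound hGm.aestronglyMeasurable _ (Eventually.of_forall hGb)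
  have hGw : weakGrad Ω V =ᵐ[volume.restrict Ω] G := by
    have h1 := ((hasWeakGrad_indicator_of_tendsto hΩ.measurableSet hW1.1 hGL hφ l0 l1).mono
      (subset_univ Ω)).congr (indicator_ae_eq_restrict hΩ.measurableSet)
    exact (h1.weakGrad_ae_eq hΩ).trans (indicator_ae_eq_restrict hΩ.measurableSet)
  refine ⟨hW1, φ, hφ, l0, l1.congr fun n => eLpNorm_congr_ae ?_⟩
  filter_upwards [hGw] with x hx
  rw [hx]

/-! ### Barycentric coordinates -/

theorem sum_fin_three {M : Type*} [AddCommMonoid M] {i j k : Fin 3} (hij : i ≠ j) (hjk : j ≠ k)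
    (hik : i ≠ k) (g : Fin 3 → M) : ∑ n, g n = g i + g j + g k := by
  have : (Finset.univ : Finset (Fin 3)) = {i, j, k} := by
    revert i j k; decide
  rw [this, Finset.sum_insert (by simp [hij, hik]), Finset.sum_insert (by simp [hjk]),
    Finset.sum_singleton, add_assoc]

theorem eq_or_of_fin_three {i j k : Fin 3} (hij : i ≠ j) (hjk : j ≠ k) (hik : i ≠ k) (n : Fin 3) :
    n = i ∨ n = j ∨ n = k := by
  omega

namespace Tri

variable (K : Tri)

/-- The vertices of a triangle as an affine basis of the plane. -/
def basis : AffineBasis (Fin 3) ℝ Plane :=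
  ⟨K.points, K.independent,
    K.independent.affineSpan_eq_top_iff_card_eq_finrank_add_one.2 (by simp)⟩

/-- The barycentric coordinate of the vertex `i`, as an affine function on the plane. -/
def bary (i : Fin 3) : Plane →ᵃ[ℝ] ℝ := K.basis.coord i

theorem bary_point_self (i : Fin 3) : K.bary i (K.points i) = 1 :=
  K.basis.coord_apply_eq i

variable {K} in
theorem bary_point_ne {i j : Fin 3} (h : i ≠ j) : K.bary i (K.points j) = 0 :=
  K.basis.coord_apply_ne h

theorem sum_bary_smul (x : Plane) : ∑ i, K.bary i x • K.points i = x :=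
  K.basis.linear_combination_coord_eq_self x

theorem sum_bary (x : Plane) : ∑ i, K.bary i x = 1 :=
  K.basis.sum_coord_apply_eq_one x

theorem continuous_bary (i : Fin 3) : Continuous (K.bary i) :=
  (K.bary i).continuous_of_finiteDimensional

/-- An affine function is the combination of its vertex values with the barycentric coordinates. -/
theorem affine_apply (f : Plane →ᵃ[ℝ] ℝ) (x : Plane) :
    f x = ∑ i, K.bary i x * f (K.points i) := by
  conv_lhs => rw [← K.basis.affineCombination_coord_eq_self x]
  rw [Finset.map_affineCombination _ _ _ (K.basis.sum_coord_apply_eq_one x),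
    Finset.affineCombination_eq_linear_combination _ _ _ (K.basis.sum_coord_apply_eq_one x)]
  rfl

theorem mem_carrier_iff (x : Plane) : x ∈ K.carrier ↔ ∀ i, 0 ≤ K.bary i x := by
  have := K.basis.convexHull_eq_nonneg_coord
  exact Set.ext_iff.1 this x

theorem mem_interior_carrier_iff (x : Plane) :
    x ∈ interior K.carrier ↔ ∀ i, 0 < K.bary i x := by
  have := K.basis.interior_convexHull
  exact Set.ext_iff.1 this x

/-- The linear Lagrange interpolant at the vertices. -/
def interpolant (u : Plane → ℝ) : Plane →ᵃ[ℝ] ℝ :=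
  u (K.points 0) • K.bary 0 + u (K.points 1) • K.bary 1 + u (K.points 2) • K.bary 2

theorem interpolant_apply (u : Plane → ℝ) (x : Plane) :
    K.interpolant u x = ∑ i, K.bary i x * u (K.points i) := by
  simp [interpolant, Fin.sum_univ_three, mul_comm]

theorem isLagrangeInterpolant_interpolant (u : Plane → ℝ) :
    IsLagrangeInterpolant K u (K.interpolant u) := by
  intro i
  rw [interpolant_apply, Finset.sum_eq_single i (fun j _ hj => by rw [bary_point_ne hj, zero_mul])
    (by simp), bary_point_self, one_mul]

end Tri

/-! ### Conforming triangulations -/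

theorem isCompact_region (𝒯 : Finset Tri) : IsCompact (region 𝒯) :=
  𝒯.isCompact_biUnion fun T _ => T.isCompact_carrier

theorem mem_region {𝒯 : Finset Tri} {x : Plane} : x ∈ region 𝒯 ↔ ∃ T ∈ 𝒯, x ∈ T.carrier := by
  simp [region]

theorem carrier_subset_region {𝒯 : Finset Tri} {T : Tri} (hT : T ∈ 𝒯) : T.carrier ⊆ region 𝒯 :=
  fun _ hx => mem_region.2 ⟨T, hT, hx⟩

namespace IsTriangulation

variable {𝒯 : Finset Tri} {Ω : Set Plane}

theorem isOpen (h : IsTriangulation 𝒯 Ω) : IsOpen Ω := h.interior_region ▸ isOpen_interior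

theorem subset_region (h : IsTriangulation 𝒯 Ω) : Ω ⊆ region 𝒯 :=
  h.interior_region ▸ interior_subset

theorem isBounded (h : IsTriangulation 𝒯 Ω) : Bornology.IsBounded Ω :=
  (isCompact_region 𝒯).isBounded.subset h.subset_region

theorem interior_carrier_subset (h : IsTriangulation 𝒯 Ω) {T : Tri} (hT : T ∈ 𝒯) :
    interior T.carrier ⊆ Ω :=
  h.interior_region ▸ interior_mono (carrier_subset_region hT)

theorem closure_eq (h : IsTriangulation 𝒯 Ω) : closure Ω = region 𝒯 := by
  refine (closure_minimal h.subset_region (isCompact_region 𝒯).isClosed).antisymm fun x hx => ?_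
  obtain ⟨T, hT, hxT⟩ := mem_region.1 hx
  exact closure_mono (h.interior_carrier_subset hT) (T.carrier_subset_closure_interior hxT)

/-- The complement of `Ω` is regular closed: a continuous function which vanishes almost everywhere
outside `Ω` vanishes everywhere there. -/
theorem closure_interior_compl (h : IsTriangulation 𝒯 Ω) : closure (interior Ωᶜ) = Ωᶜ := by
  refine (closure_minimal interior_subset h.isOpen.isClosed_compl).antisymm ?_
  rw [← h.interior_region, ← closure_compl]
  exact closure_mono (interior_maximal (subset_closure) (isCompact_region 𝒯).isClosed.isOpen_compl)

theorem measure_region_diff (h : IsTriangulation 𝒯 Ω) : volume (region 𝒯 \ Ω) = 0 := by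
  refine measure_mono_null (t := ⋃ T ∈ 𝒯, T.carrier \ interior T.carrier) (fun x hx => ?_) ?_
  · obtain ⟨T, hT, hxT⟩ := mem_region.1 hx.1
    exact mem_biUnion hT ⟨hxT, fun hi => hx.2 (h.interior_carrier_subset hT hi)⟩
  · exact (measure_biUnion_null_iff 𝒯.countable_toSet).2 fun T _ =>
      ae_le_set.1 T.interior_carrier_ae_eq.symm.le

/-- By conformity, a triangle which contains a point of another one contains the smallest face of
that triangle through the point. -/
theorem point_mem_range (h : IsTriangulation 𝒯 Ω) {S T : Tri} (hS : S ∈ 𝒯) (hT : T ∈ 𝒯)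
    {x : Plane} (hxS : x ∈ S.carrier) (hxT : x ∈ T.carrier) {i : Fin 3} (hi : T.bary i x ≠ 0) :
    T.points i ∈ range S.points := by
  by_contra hcon
  have hx : x ∈ convexHull ℝ (range S.points ∩ range T.points) :=
    h.conforming S hS T hT ▸ ⟨hxS, hxT⟩
  have hsub : range S.points ∩ range T.points ⊆ T.bary i ⁻¹' {0} := by
    rintro _ ⟨hy, m, rfl⟩
    exact Tri.bary_point_ne fun him => hcon (him ▸ hy)
  exact hi (convexHull_min hsub ((convex_singleton 0).affine_preimage (T.bary i)) hx)

/-- By conformity, distinct triangles do not overlap. -/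
theorem notMem_carrier_of_mem_interior (h : IsTriangulation 𝒯 Ω) {S T : Tri} (hS : S ∈ 𝒯)
    (hT : T ∈ 𝒯) (hST : S ≠ T) {x : Plane} (hx : x ∈ interior T.carrier) : x ∉ S.carrier := by
  intro hxS
  have hsub : range T.points ⊆ range S.points := by
    rintro _ ⟨i, rfl⟩
    exact h.point_mem_range hS hT hxS (interior_subset hx)
      ((T.mem_interior_carrier_iff x).1 hx i).ne'
  refine hST (h.distinct S hS T hT (eq_of_subset_of_ncard_le hsub ?_).symm)
  rw [ncard_range_of_injective S.independent.injective,
    ncard_range_of_injective T.independent.injective]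

/-- If an edge of `T` has an interior point on the boundary, then all triangles that share the edge
lie on the same side of it as `T`. -/
theorem bary_nonneg_of_edge (h : IsTriangulation 𝒯 Ω) {S T : Tri} (hS : S ∈ 𝒯) (hT : T ∈ 𝒯)
    {i j k : Fin 3} (hij : i ≠ j) (hjk : j ≠ k) (hik : i ≠ k) {x : Plane} (hx : x ∉ Ω)
    (hi : 0 < T.bary i x) (hj : 0 < T.bary j x) (hk : T.bary k x = 0)
    (hSi : T.points i ∈ range S.points) (hSj : T.points j ∈ range S.points) (m : Fin 3) :
    0 ≤ T.bary k (S.points m) := by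
  by_contra hneg
  obtain ⟨a, ha⟩ := hSi
  obtain ⟨b, hb⟩ := hSj
  have hka : T.bary k (S.points a) = 0 := by rw [ha]; exact Tri.bary_point_ne hik.symm
  have hkb : T.bary k (S.points b) = 0 := by rw [hb]; exact Tri.bary_point_ne hjk.symm
  have hma : a ≠ m := fun e => hneg (by rw [← e, hka])
  have hmb : b ≠ m := fun e => hneg (by rw [← e, hkb])
  have hab : a ≠ b := fun e => hij (T.independent.injective (by rw [← ha, ← hb, e]))
  have hxS : ∀ n, S.bary n x = T.bary i x * S.bary n (T.points i) +
      T.bary j x * S.bary n (T.points j) := fun n => by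
    rw [T.affine_apply (S.bary n) x, sum_fin_three hij hjk hik, hk, zero_mul, add_zero]
  have hxa : 0 < S.bary a x := by
    rw [hxS, ← ha, ← hb, S.bary_point_self, Tri.bary_point_ne hab]
    linarith
  have hxb : 0 < S.bary b x := by
    rw [hxS, ← ha, ← hb, S.bary_point_self, Tri.bary_point_ne hab.symm]
    linarith
  -- otherwise both triangles together contain a neighbourhood of `x`
  refine hx (h.interior_region ▸ mem_interior_iff_mem_nhds.2 ?_)
  have hnhds : ∀ (K : Tri) (n : Fin 3), 0 < K.bary n x → ∀ᶠ y in 𝓝 x, 0 < K.bary n y :=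
    fun K n hn => (isOpen_lt continuous_const (K.continuous_bary n)).mem_nhds hn
  filter_upwards [hnhds T i hi, hnhds T j hj, hnhds S a hxa, hnhds S b hxb] with y h1 h2 h3 h4
  rcases le_total 0 (T.bary k y) with hky | hky
  · refine carrier_subset_region hT ((T.mem_carrier_iff y).2 fun n => ?_)
    rcases eq_or_of_fin_three hij hjk hik n with rfl | rfl | rfl
    exacts [h1.le, h2.le, hky]
  · refine carrier_subset_region hS ((S.mem_carrier_iff y).2 fun n => ?_)
    rcases eq_or_of_fin_three hab hmb hma n with rfl | rfl | rfl
    · exact h3.le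
    · exact h4.le
    · have e := S.affine_apply (T.bary k) y
      rw [sum_fin_three hab hmb hma, hka, hkb, mul_zero, mul_zero, zero_add, zero_add] at e
      rw [e] at hky
      by_contra hlt
      exact absurd hky (not_le.2 (mul_pos_of_neg_of_neg (not_le.1 hlt) (not_le.1 hneg)))

/-- If an edge of a triangle has an interior point on the boundary, then the whole edge lies on
the boundary. -/
theorem point_notMem_of_edge (h : IsTriangulation 𝒯 Ω) {T : Tri} (hT : T ∈ 𝒯)
    {i j k : Fin 3} (hij : i ≠ j) (hjk : j ≠ k) (hik : i ≠ k) {x : Plane} (hx : x ∉ Ω)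
    (hi : 0 < T.bary i x) (hj : 0 < T.bary j x) (hk : T.bary k x = 0) : T.points i ∉ Ω := by
  have hpt : ∀ {z : Plane}, 0 < T.bary i z → 0 < T.bary j z → T.bary k z = 0 → z ∉ Ω := by
    intro z hzi hzj hzk hz
    have hzT : z ∈ T.carrier := (T.mem_carrier_iff z).2 fun n => by
      rcases eq_or_of_fin_three hij hjk hik n with rfl | rfl | rfl
      exacts [hzi.le, hzj.le, hzk.ge]
    -- leave `T` through the edge
    obtain ⟨γ, hγ⟩ : ∃ γ : ℝ → Plane, γ = fun t => z + t • (T.points i - T.points k) := ⟨_, rfl⟩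
    have hγc : Continuous γ := by rw [hγ]; fun_prop
    have hγ0 : γ 0 = z := by simp [hγ]
    have hγk : ∀ t, T.bary k (γ t) = -t := fun t => by
      have h1 := affine_eq (T.bary k) (γ t) z
      have h2 := affine_eq (T.bary k) (T.points i) (T.points k)
      rw [Tri.bary_point_ne hik.symm, T.bary_point_self] at h2
      rw [h1, hzk, hγ, add_sub_cancel_left, inner_smul_right]
      linear_combination -t * h2
    have hlim : Tendsto γ (𝓝[>] 0) (𝓝 z) := by
      have := hγc.tendsto 0
      rw [hγ0] at this
      exact this.mono_left nhdsWithin_le_nhds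
    have e1 : ∀ᶠ t in 𝓝[>] (0 : ℝ), γ t ∈ region 𝒯 :=
      hlim.eventually (mem_of_superset (h.isOpen.mem_nhds hz) h.subset_region)
    have e2 : ∀ᶠ t in 𝓝[>] (0 : ℝ), ∀ S ∈ 𝒯, z ∉ S.carrier → γ t ∉ S.carrier := by
      refine (Finset.eventually_all 𝒯).2 fun S _ => ?_
      by_cases hzS : z ∈ S.carrier
      · exact Eventually.of_forall fun t hc => absurd hzS hc
      · filter_upwards [hlim.eventually (S.isCompact_carrier.isClosed.isOpen_compl.mem_nhds hzS)]
          with t ht _ using ht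
    obtain ⟨t, ⟨ht1, ht2⟩, ht0⟩ := ((e1.and e2).and self_mem_nhdsWithin).exists
    obtain ⟨S, hS, htS⟩ := mem_region.1 ht1
    have hzS : z ∈ S.carrier := by
      by_contra hc
      exact ht2 S hS hc htS
    have hnn := h.bary_nonneg_of_edge hS hT hij hjk hik hx hi hj hk
      (h.point_mem_range hS hT hzS hzT hzi.ne') (h.point_mem_range hS hT hzS hzT hzj.ne')
    have h1 := S.affine_apply (T.bary k) (γ t)
    have h2 : 0 ≤ T.bary k (γ t) := by
      rw [h1]
      exact Finset.sum_nonneg fun n _ => mul_nonneg ((S.mem_carrier_iff _).1 htS n) (hnn n)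
    rw [hγk] at h2
    exact absurd (mem_Ioi.1 ht0) (by linarith)
  have hcl : Tendsto (fun s : ℝ => AffineMap.lineMap (T.points i) (T.points j) s) (𝓝[>] 0)
      (𝓝 (T.points i)) := by
    have : Continuous fun s : ℝ => AffineMap.lineMap (T.points i) (T.points j) s :=
      AffineMap.lineMap_continuous
    have := this.tendsto 0
    rw [AffineMap.lineMap_apply_zero] at this
    exact this.mono_left nhdsWithin_le_nhds
  refine h.isOpen.isClosed_compl.mem_of_tendsto hcl ?_
  filter_upwards [Ioo_mem_nhdsGT (zero_lt_one' ℝ)] with s hs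
  refine hpt ?_ ?_ ?_
  · rw [AffineMap.apply_lineMap, T.bary_point_self, Tri.bary_point_ne hij]
    simpa [AffineMap.lineMap_apply] using hs.2
  · rw [AffineMap.apply_lineMap, T.bary_point_self, Tri.bary_point_ne hij.symm]
    simpa [AffineMap.lineMap_apply] using hs.1
  · rw [AffineMap.apply_lineMap, Tri.bary_point_ne hik.symm, Tri.bary_point_ne hjk.symm]
    simp

/-- The vertices of the smallest face of a triangle through a boundary point are boundary points:
hence the interpolant of a function vanishing on the boundary vanishes there as well. -/
theorem point_notMem (h : IsTriangulation 𝒯 Ω) {T : Tri} (hT : T ∈ 𝒯) {x : Plane}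
    (hxT : x ∈ T.carrier) (hx : x ∉ Ω) {i : Fin 3} (hi : T.bary i x ≠ 0) : T.points i ∉ Ω := by
  have hnn := (T.mem_carrier_iff x).1 hxT
  obtain ⟨j, k, hij, hjk, hik⟩ : ∃ j k : Fin 3, i ≠ j ∧ j ≠ k ∧ i ≠ k := by
    clear hi
    revert i
    decide
  have hipos := (hnn i).lt_of_ne' hi
  by_cases hj : T.bary j x = 0 <;> by_cases hk : T.bary k x = 0
  · have h1 := T.sum_bary x
    have h2 := T.sum_bary_smul x
    rw [sum_fin_three hij hjk hik, hj, hk, add_zero, add_zero] at h1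
    rw [sum_fin_three hij hjk hik, hj, hk, h1, one_smul, zero_smul, zero_smul, add_zero,
      add_zero] at h2
    rwa [h2]
  · exact h.point_notMem_of_edge hT hik hjk.symm hij hx hipos ((hnn k).lt_of_ne' hk) hj
  · exact h.point_notMem_of_edge hT hij hjk hik hx hipos ((hnn j).lt_of_ne' hj) hk
  · refine absurd (h.interior_carrier_subset hT ((T.mem_interior_carrier_iff x).2 fun n => ?_)) hx
    rcases eq_or_of_fin_three hij hjk hik n with rfl | rfl | rfl
    exacts [hipos, (hnn _).lt_of_ne' hj, (hnn _).lt_of_ne' hk]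

/-! ### The finite element space -/

/-- The extension by zero of a continuous piecewise affine function that vanishes on the boundary
is Lipschitz. -/
theorem exists_lipschitzWith_indicator (h : IsTriangulation 𝒯 Ω) {v : Plane → ℝ}
    (hp : ∀ T ∈ 𝒯, ∃ p : Plane →ᵃ[ℝ] ℝ, EqOn v p T.carrier)
    (h0 : ∀ x ∈ region 𝒯, x ∉ Ω → v x = 0) : ∃ C, LipschitzWith C (Ω.indicator v) := by
  choose! p hp using hp
  have hv : ∀ x ∈ region 𝒯, Ω.indicator v x = v x := fun x hx => by
    by_cases hxΩ : x ∈ Ω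
    · rw [indicator_of_mem hxΩ]
    · rw [indicator_of_notMem hxΩ, h0 x hx hxΩ]
  refine ⟨∑ T ∈ 𝒯, ‖affGrad (p T)‖₊, lipschitzWith_of_finite_closed_cover
    (ι := Option 𝒯) (S := fun o => o.elim Ωᶜ fun T => T.1.carrier) ?_ (fun x => ?_) ?_⟩
  · rintro (_ | T)
    exacts [h.isOpen.isClosed_compl, T.1.isCompact_carrier.isClosed]
  · by_cases hx : x ∈ Ω
    · obtain ⟨T, hT, hxT⟩ := mem_region.1 (h.subset_region hx)
      exact ⟨some ⟨T, hT⟩, hxT⟩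
    · exact ⟨none, hx⟩
  · rintro (_ | T)
    · refine LipschitzOnWith.of_dist_le_mul fun x hx y hy => ?_
      rw [indicator_of_notMem hx, indicator_of_notMem hy, dist_self]
      positivity
    · refine LipschitzOnWith.of_dist_le_mul fun x hx y hy => ?_
      rw [hv x (carrier_subset_region T.2 hx), hv y (carrier_subset_region T.2 hy),
        hp T T.2 hx, hp T T.2 hy]
      refine ((lipschitzWith_affine (p T)).dist_le_mul x y).trans ?_
      gcongr
      exact Finset.single_le_sum (f := fun T => ‖affGrad (p T)‖₊) (fun _ _ => zero_le) T.2

theorem eq_zero_of_memVh (h : IsTriangulation 𝒯 Ω) {v : Plane → ℝ} (hv : MemVh 𝒯 Ω v) :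
    ∀ x ∈ region 𝒯, x ∉ Ω → v x = 0 := fun x hx hxΩ =>
  hv.2.2 x ⟨h.closure_eq ▸ hx, h.isOpen.interior_eq.symm ▸ hxΩ⟩

/-- The nodal interpolant of a function vanishing outside `Ω` belongs to `V_h`. -/
theorem exists_memVh_interpolant (h : IsTriangulation 𝒯 Ω) {U : Plane → ℝ}
    (hU : ∀ x ∉ Ω, U x = 0) :
    ∃ v, MemVh 𝒯 Ω v ∧ ∀ T ∈ 𝒯, EqOn v (T.interpolant U) T.carrier := by
  classical
  obtain ⟨v, hv⟩ : ∃ v : Plane → ℝ, v = fun x =>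
    if hx : ∃ T ∈ 𝒯, x ∈ T.carrier then hx.choose.interpolant U x else 0 := ⟨_, rfl⟩
  -- by conformity, interpolants of neighbours agree: they agree at the vertices of the common face
  have hcompat : ∀ S ∈ 𝒯, ∀ T ∈ 𝒯, ∀ x ∈ S.carrier, x ∈ T.carrier →
      S.interpolant U x = T.interpolant U x := by
    intro S hS T hT x hxS hxT
    have hx : x ∈ convexHull ℝ (range S.points ∩ range T.points) :=
      h.conforming S hS T hT ▸ ⟨hxS, hxT⟩
    have hsub : range S.points ∩ range T.points ⊆
        (S.interpolant U - T.interpolant U) ⁻¹' {0} := by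
      rintro y ⟨⟨a, ha⟩, ⟨b, hb⟩⟩
      have h1 := S.isLagrangeInterpolant_interpolant U a
      have h2 := T.isLagrangeInterpolant_interpolant U b
      rw [ha] at h1
      rw [hb] at h2
      simp [h1, h2]
    have := convexHull_min hsub
      ((convex_singleton 0).affine_preimage (S.interpolant U - T.interpolant U)) hx
    exact sub_eq_zero.1 this
  have heq : ∀ T ∈ 𝒯, EqOn v (T.interpolant U) T.carrier := by
    intro T hT x hx
    have hex : ∃ T ∈ 𝒯, x ∈ T.carrier := ⟨T, hT, hx⟩
    rw [hv]
    simp only [dif_pos hex]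
    exact hcompat _ hex.choose_spec.1 T hT x hex.choose_spec.2 hx
  have hzero : ∀ x ∈ region 𝒯, x ∉ Ω → v x = 0 := by
    intro x hx hxΩ
    obtain ⟨T, hT, hxT⟩ := mem_region.1 hx
    rw [heq T hT hxT, Tri.interpolant_apply]
    refine Finset.sum_eq_zero fun i _ => ?_
    by_cases hi : T.bary i x = 0
    · rw [hi, zero_mul]
    · rw [hU _ (h.point_notMem hT hxT hxΩ hi), mul_zero]
  refine ⟨v, ⟨?_, fun T hT => ⟨_, heq T hT⟩, fun x hx => hzero x (h.closure_eq ▸ hx.1) ?_⟩, heq⟩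
  · obtain ⟨C, hC⟩ := h.exists_lipschitzWith_indicator (fun T hT => ⟨_, heq T hT⟩) hzero
    refine hC.continuous.continuousOn.congr fun x hx => ?_
    by_cases hxΩ : x ∈ Ω
    · rw [indicator_of_mem hxΩ]
    · rw [indicator_of_notMem hxΩ, hzero x (h.closure_eq ▸ hx) hxΩ]
  · have := hx.2
    rwa [h.isOpen.interior_eq] at this

end IsTriangulation

theorem MemVh.sub {𝒯 : Finset Tri} {Ω : Set Plane} {v w : Plane → ℝ} (hv : MemVh 𝒯 Ω v)
    (hw : MemVh 𝒯 Ω w) : MemVh 𝒯 Ω fun x => v x - w x := by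
  refine ⟨hv.1.sub hw.1, fun T hT => ?_, fun x hx => by
    simp only [hv.2.2 x hx, hw.2.2 x hx, sub_zero]⟩
  obtain ⟨p, hp⟩ := hv.2.1 T hT
  obtain ⟨q, hq⟩ := hw.2.1 T hT
  exact ⟨p - q, fun x hx => by simp [hp hx, hq hx]⟩

theorem MemH10.congr {Ω : Set Plane} {v w : Plane → ℝ} (hv : MemH10 Ω v)
    (h : v =ᵐ[volume.restrict Ω] w) : MemH10 Ω w := by
  obtain ⟨⟨h1, h2⟩, φ, hφ, l0, l1⟩ := hv
  refine ⟨⟨(memLp_congr_ae h).1 h1, fun i => ?_⟩, φ, hφ, l0.congr fun n => eLpNorm_congr_ae ?_, ?_⟩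
  · rw [← weakPartial_congr h i]
    obtain ⟨g, hg⟩ := (h2 i).1
    exact ⟨⟨g, hg.congr h EventuallyEq.rfl⟩, (h2 i).2⟩
  · filter_upwards [h] with x hx
    rw [hx]
  · rwa [← weakGrad_congr h]

/-- The finite element space is contained in `H¹₀`. -/
theorem IsTriangulation.memH10_of_memVh {𝒯 : Finset Tri} {Ω : Set Plane}
    (h : IsTriangulation 𝒯 Ω) {v : Plane → ℝ} (hv : MemVh 𝒯 Ω v) : MemH10 Ω v := by
  obtain ⟨C, hC⟩ := h.exists_lipschitzWith_indicator hv.2.1 (h.eq_zero_of_memVh hv)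
  exact (memH10_of_lipschitzWith h.isOpen h.isBounded hC fun x hx =>
    indicator_of_notMem hx v).congr (indicator_ae_eq_restrict h.isOpen.measurableSet)

/-- The weak gradient is local. -/
theorem HasWeakGrad.weakGrad_ae_eq_of_subset {Ω T : Set Plane} (hT : IsOpen T) (hTΩ : T ⊆ Ω)
    {u : Plane → ℝ} {p : ℝ≥0∞} {G : Plane → Plane} (hu : MemW1 p Ω u) (h : HasWeakGrad T u G) :
    weakGrad Ω u =ᵐ[volume.restrict T] G :=
  ((hu.hasWeakGrad.mono hTΩ).weakGrad_ae_eq hT).symm.trans (h.weakGrad_ae_eq hT)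

/-! ### The energy estimate -/

/-- The estimate behind the tempered method, in abstract form: the two spaces carry the gradients
outside and on the band, `u` is the solution, `w` the finite element solution and `c` any
comparison function. The hypothesis is the error equation tested with `w - c`. -/
theorem energy_estimate {E F : Type*} [NormedAddCommGroup E] [InnerProductSpace ℝ E]
    [NormedAddCommGroup F] [InnerProductSpace ℝ F] (u₁ w₁ c₁ : E) (u₂ w₂ c₂ : F) {D : ℝ}
    (hD : 0 < D) (hD1 : D ≤ 1)
    (h : inner ℝ u₁ (w₁ - c₁) + inner ℝ u₂ (w₂ - c₂) =
      inner ℝ w₁ (w₁ - c₁) + D * inner ℝ w₂ (w₂ - c₂)) :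
    ‖u₁ - w₁‖ + √D * ‖u₂ - w₂‖ ≤
      2 * √2 * (‖u₁ - c₁‖ + √D * ‖u₂ - c₂‖) + √2 * ((1 - D) / √D * ‖u₂‖) := by
  have hs : 0 < √D := Real.sqrt_pos.2 hD
  have hsD : √D * √D = D := Real.mul_self_sqrt hD.le
  have hst : √2 * √2 = (2 : ℝ) := Real.mul_self_sqrt zero_le_two
  have ht1 : 1 ≤ √2 := Real.one_le_sqrt.2 one_le_two
  -- the error equation, written for `z = w - c`
  have hz : ‖w₁ - c₁‖ ^ 2 + D * ‖w₂ - c₂‖ ^ 2 =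
      inner ℝ (u₁ - c₁) (w₁ - c₁) + D * inner ℝ (u₂ - c₂) (w₂ - c₂) +
        (1 - D) * inner ℝ u₂ (w₂ - c₂) := by
    rw [← real_inner_self_eq_norm_sq, ← real_inner_self_eq_norm_sq]
    have e1 : inner ℝ (w₁ - c₁) (w₁ - c₁) = inner ℝ w₁ (w₁ - c₁) - inner ℝ c₁ (w₁ - c₁) :=
      inner_sub_left _ _ _
    have e2 : inner ℝ (w₂ - c₂) (w₂ - c₂) = inner ℝ w₂ (w₂ - c₂) - inner ℝ c₂ (w₂ - c₂) :=
      inner_sub_left _ _ _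
    rw [e1, e2, inner_sub_left u₁, inner_sub_left u₂]
    linear_combination -h
  have b1 := real_inner_le_norm (u₁ - c₁) (w₁ - c₁)
  have b2 := mul_le_mul_of_nonneg_left (real_inner_le_norm (u₂ - c₂) (w₂ - c₂)) hD.le
  have b3 := mul_le_mul_of_nonneg_left (real_inner_le_norm u₂ (w₂ - c₂)) (sub_nonneg.2 hD1)
  have t1 := norm_sub_le_norm_sub_add_norm_sub u₁ c₁ w₁
  have t2 := norm_sub_le_norm_sub_add_norm_sub u₂ c₂ w₂
  rw [norm_sub_rev c₁] at t1
  rw [norm_sub_rev c₂] at t2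
  obtain ⟨K, hK⟩ : ∃ K, K = (1 - D) / √D * ‖u₂‖ := ⟨_, rfl⟩
  have hK0 : 0 ≤ K := by
    rw [hK]
    exact mul_nonneg (div_nonneg (sub_nonneg.2 hD1) hs.le) (norm_nonneg _)
  have hK' : (1 - D) * ‖u₂‖ = K * √D := by
    rw [hK]; field_simp
  rw [← hK]
  have n1 := norm_nonneg (u₁ - c₁)
  have n2 := norm_nonneg (u₂ - c₂)
  have na := norm_nonneg (w₁ - c₁)
  have nb := norm_nonneg (w₂ - c₂)
  generalize ‖u₁ - c₁‖ = E1 at *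
  generalize ‖u₂ - c₂‖ = E2 at *
  generalize ‖w₁ - c₁‖ = a at *
  obtain ⟨b, hb⟩ : ∃ b, b = √D * ‖w₂ - c₂‖ := ⟨_, rfl⟩
  have hb0 : 0 ≤ b := hb ▸ mul_nonneg hs.le nb
  have hb2 : D * ‖w₂ - c₂‖ ^ 2 = b ^ 2 := by rw [hb, mul_pow, sq √D, hsD]
  obtain ⟨N, hN⟩ : ∃ N, N = √(a ^ 2 + b ^ 2) := ⟨_, rfl⟩
  have hN0 : 0 ≤ N := hN ▸ Real.sqrt_nonneg _
  have hN2 : N ^ 2 = a ^ 2 + b ^ 2 := by rw [hN, Real.sq_sqrt (by positivity)]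
  have haN : a ≤ N := abs_le_of_sq_le_sq' (by nlinarith) hN0 |>.2
  have hbN : b ≤ N := abs_le_of_sq_le_sq' (by nlinarith) hN0 |>.2
  have hsE : 0 ≤ √D * E2 := mul_nonneg hs.le n2
  have hmain : N ^ 2 ≤ (E1 + √D * E2 + K) * N := by
    have e2 : D * (E2 * ‖w₂ - c₂‖) = √D * E2 * b := by
      rw [hb]; linear_combination -E2 * ‖w₂ - c₂‖ * hsD
    have e3 : (1 - D) * (‖u₂‖ * ‖w₂ - c₂‖) = K * b := by
      rw [hb]; linear_combination ‖w₂ - c₂‖ * hK'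
    have i1 : E1 * a ≤ E1 * N := mul_le_mul_of_nonneg_left haN n1
    have i2 : √D * E2 * b ≤ √D * E2 * N := mul_le_mul_of_nonneg_left hbN hsE
    have i3 : K * b ≤ K * N := mul_le_mul_of_nonneg_left hbN hK0
    rw [hN2, ← hb2, hz]
    linarith
  have hNle : N ≤ E1 + √D * E2 + K := by
    rcases hN0.eq_or_lt with h0 | h0
    · rw [← h0]; positivity
    · refine le_of_mul_le_mul_right ?_ h0
      rw [← sq]; exact hmain
  have hab : a + b ≤ √2 * N := by
    refine abs_le_of_sq_le_sq' ?_ (by positivity) |>.2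
    rw [mul_pow, sq √2, hst, hN2]
    nlinarith [sq_nonneg (a - b)]
  have t3 := mul_le_mul_of_nonneg_left t2 hs.le
  rw [mul_add, ← hb] at t3
  have h6 := mul_le_mul_of_nonneg_left hNle (zero_le_one.trans ht1)
  have h7 : E1 + √D * E2 ≤ √2 * (E1 + √D * E2) :=
    le_mul_of_one_le_left (add_nonneg n1 hsE) ht1
  linarith

theorem inner_toLp {μ : Measure Plane} {f g : Plane → Plane} (hf : MemLp f 2 μ)
    (hg : MemLp g 2 μ) : inner ℝ (hf.toLp f) (hg.toLp g) = ∫ x, inner ℝ (f x) (g x) ∂μ := by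
  rw [L2.inner_def]
  refine integral_congr_ae ?_
  filter_upwards [hf.coeFn_toLp, hg.coeFn_toLp] with x h1 h2
  rw [h1, h2]

theorem integrable_inner_of_memLp {μ : Measure Plane} {f g : Plane → Plane} (hf : MemLp f 2 μ)
    (hg : MemLp g 2 μ) : Integrable (fun x => inner ℝ (f x) (g x)) μ := by
  refine (L2.integrable_inner (𝕜 := ℝ) (hf.toLp f) (hg.toLp g)).congr ?_
  filter_upwards [hf.coeFn_toLp, hg.coeFn_toLp] with x h1 h2
  rw [h1, h2]

theorem norm_toLp_sub {μ : Measure Plane} {f g : Plane → Plane} (hf : MemLp f 2 μ)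
    (hg : MemLp g 2 μ) :
    ‖hf.toLp f - hg.toLp g‖ = (eLpNorm (fun x => f x - g x) 2 μ).toReal := by
  rw [← MemLp.toLp_sub, Lp.norm_toLp]
  rfl

/-- The boundary of the domain is a null set, so that integration over a part of the closed polygon
is integration over a part of the domain. -/
theorem IsTriangulation.restrict_eq_inter {𝒯 : Finset Tri} {Ω B : Set Plane}
    (ht : IsTriangulation 𝒯 Ω) (hB : B ⊆ region 𝒯) :
    volume.restrict B = volume.restrict (Ω ∩ B) := by
  have hnull : volume (B \ (Ω ∩ B)) = 0 :=
    measure_mono_null (t := region 𝒯 \ Ω)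
      (fun x hx => ⟨hB hx.1, fun hxΩ => hx.2 ⟨hxΩ, hx.1⟩⟩) ht.measure_region_diff
  exact Measure.restrict_congr_set ((ae_le_set.2 hnull).antisymm inter_subset_right.eventuallyLE)

/-- The error of the tempered method in terms of the error of a comparison function `c ∈ V_h`. -/
theorem IsTriangulation.error_le {𝒯 : Finset Tri} {Ω B : Set Plane}
    (ht : IsTriangulation 𝒯 Ω) (hBm : MeasurableSet B) (hB : B ⊆ region 𝒯) {f u w c : Plane → ℝ}
    {D : ℝ} (hD : 0 < D) (hD1 : D ≤ 1) (hu : IsWeakSolution Ω f u)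
    (hw : IsTFEMSolution 𝒯 Ω B D f w) (hc : MemVh 𝒯 Ω c) :
    semiW1 2 Ω (Ω \ B) (fun x => u x - w x) + √D * semiW1 2 Ω B (fun x => u x - w x) ≤
      2 * √2 * ((eLpNorm (fun x => weakGrad Ω u x - weakGrad Ω c x) 2
          (volume.restrict (Ω \ B))).toReal +
        √D * (eLpNorm (fun x => weakGrad Ω u x - weakGrad Ω c x) 2 (volume.restrict B)).toReal) +
      √2 * ((1 - D) / √D * semiW1 2 Ω B u) := by
  have hΩ := ht.isOpen
  have hwH := ht.memH10_of_memVh hw.1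
  have hcH := ht.memH10_of_memVh hc
  have hzV := hw.1.sub hc
  have hzH := ht.memH10_of_memVh hzV
  have hgz := (hwH.1.hasWeakGrad.sub hcH.1.hasWeakGrad).weakGrad_ae_eq hΩ
  have hge := (hu.1.1.hasWeakGrad.sub hwH.1.hasWeakGrad).weakGrad_ae_eq hΩ
  have hBΩ := ht.restrict_eq_inter hB
  have hL2 : ∀ {v}, MemW1 2 Ω v → MemLp (weakGrad Ω v) 2 (volume.restrict (Ω \ B)) ∧
      MemLp (weakGrad Ω v) 2 (volume.restrict B) := fun hv =>
    ⟨hv.memLp_weakGrad.mono_measure (Measure.restrict_mono sdiff_subset le_rfl), by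
      rw [hBΩ]
      exact hv.memLp_weakGrad.mono_measure (Measure.restrict_mono inter_subset_left le_rfl)⟩
  obtain ⟨u1, u2⟩ := hL2 hu.1.1
  obtain ⟨w1, w2⟩ := hL2 hwH.1
  obtain ⟨c1, c2⟩ := hL2 hcH.1
  have hgz1 := ae_restrict_of_ae_restrict_of_subset (sdiff_subset (s := Ω) (t := B)) hgz
  have hgz2 : ∀ᵐ x ∂(volume.restrict B), weakGrad Ω (fun x => w x - c x) x =
      weakGrad Ω w x - weakGrad Ω c x := by
    rw [hBΩ]
    exact ae_restrict_of_ae_restrict_of_subset inter_subset_left hgz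
  have hge1 := ae_restrict_of_ae_restrict_of_subset (sdiff_subset (s := Ω) (t := B)) hge
  have hge2 : ∀ᵐ x ∂(volume.restrict B), weakGrad Ω (fun x => u x - w x) x =
      weakGrad Ω u x - weakGrad Ω w x := by
    rw [hBΩ]
    exact ae_restrict_of_ae_restrict_of_subset inter_subset_left hge
  -- the error equation
  have heq : ∫ x in Ω, inner ℝ (weakGrad Ω u x) (weakGrad Ω (fun x => w x - c x) x) =
      ∫ x in Ω, diffusion B D x *
        inner ℝ (weakGrad Ω w x) (weakGrad Ω (fun x => w x - c x) x) :=
    (hu.2 _ hzH).trans (hw.2 _ hzV).symm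
  have hi1 := integrable_inner_of_memLp hu.1.1.memLp_weakGrad hzH.1.memLp_weakGrad
  have hi2 := integrable_inner_of_memLp hwH.1.memLp_weakGrad hzH.1.memLp_weakGrad
  have hdm : Measurable (diffusion B D) := Measurable.ite hBm measurable_const measurable_const
  have hi3 : Integrable (fun x => diffusion B D x *
      inner ℝ (weakGrad Ω w x) (weakGrad Ω (fun x => w x - c x) x)) (volume.restrict Ω) := by
    refine hi2.bdd_mul (c := 1) hdm.aestronglyMeasurable (Eventually.of_forall fun x => ?_)
    rw [diffusion]
    split_ifs
    · rwa [Real.norm_of_nonneg hD.le]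
    · simp
  rw [← integral_inter_add_sdiff hBm hi1, ← integral_inter_add_sdiff hBm hi3, ← hBΩ] at heq
  have hB1 : ∫ x in B, diffusion B D x *
      inner ℝ (weakGrad Ω w x) (weakGrad Ω (fun x => w x - c x) x) =
      D * ∫ x in B, inner ℝ (weakGrad Ω w x) (weakGrad Ω (fun x => w x - c x) x) := by
    rw [← integral_const_mul]
    refine setIntegral_congr_fun hBm fun x hx => ?_
    simp only [diffusion, if_pos hx]
  have hB2 : ∫ x in Ω \ B, diffusion B D x *
      inner ℝ (weakGrad Ω w x) (weakGrad Ω (fun x => w x - c x) x) =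
      ∫ x in Ω \ B, inner ℝ (weakGrad Ω w x) (weakGrad Ω (fun x => w x - c x) x) := by
    refine setIntegral_congr_fun (hΩ.measurableSet.diff hBm) fun x hx => ?_
    simp only [diffusion, if_neg hx.2, one_mul]
  have hrep : ∀ {S : Set Plane} {v : Plane → Plane}, (∀ᵐ x ∂(volume.restrict S),
      weakGrad Ω (fun x => w x - c x) x = weakGrad Ω w x - weakGrad Ω c x) →
      ∫ x in S, inner ℝ (v x) (weakGrad Ω (fun x => w x - c x) x) =
        ∫ x in S, inner ℝ (v x) (weakGrad Ω w x - weakGrad Ω c x) := fun hS => by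
    refine integral_congr_ae ?_
    filter_upwards [hS] with x hx
    rw [hx]
  rw [hB1, hB2, hrep hgz1, hrep hgz1, hrep hgz2, hrep hgz2] at heq
  have key := energy_estimate (u1.toLp _) (w1.toLp _) (c1.toLp _) (u2.toLp _) (w2.toLp _)
    (c2.toLp _) hD hD1 (by
      rw [← MemLp.toLp_sub, ← MemLp.toLp_sub, inner_toLp, inner_toLp, inner_toLp, inner_toLp]
      simp only [Pi.sub_apply]
      linarith)
  rw [norm_toLp_sub, norm_toLp_sub, norm_toLp_sub, norm_toLp_sub, Lp.norm_toLp] at key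
  rw [semiW1, semiW1, eLpNorm_congr_ae hge1, eLpNorm_congr_ae hge2]
  exact key

/-! ### Interpolation on the mesh -/

/-- Restriction to a smaller open set keeps the weak derivatives, almost everywhere. -/
theorem MemW1.mono {p : ℝ≥0∞} {Ω T : Set Plane} (hT : IsOpen T) (hTΩ : T ⊆ Ω) {u : Plane → ℝ}
    (hu : MemW1 p Ω u) : MemW1 p T u ∧
      ∀ i, weakPartial T i u =ᵐ[volume.restrict T] weakPartial Ω i u := by
  have hle := Measure.restrict_mono hTΩ (le_refl (volume : Measure Plane))
  have h : ∀ i, HasWeakPartial T i u (weakPartial Ω i u) := fun i =>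
    (hasWeakPartial_weakPartial (hu.2 i).1).mono hTΩ
  have he := fun i => (h i).weakPartial_ae_eq hT
  exact ⟨⟨hu.1.mono_measure hle, fun i => ⟨⟨_, h i⟩,
    (memLp_congr_ae (he i)).2 ((hu.2 i).2.mono_measure hle)⟩⟩, he⟩

theorem MemW1.congr {p : ℝ≥0∞} {Ω : Set Plane} {u v : Plane → ℝ} (hu : MemW1 p Ω u)
    (h : u =ᵐ[volume.restrict Ω] v) : MemW1 p Ω v := by
  refine ⟨(memLp_congr_ae h).1 hu.1, fun i => ?_⟩
  rw [← weakPartial_congr h i]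
  obtain ⟨g, hg⟩ := (hu.2 i).1
  exact ⟨⟨g, hg.congr h EventuallyEq.rfl⟩, (hu.2 i).2⟩

theorem MemW2.congr {p : ℝ≥0∞} {Ω : Set Plane} {u v : Plane → ℝ} (hu : MemW2 p Ω u)
    (h : u =ᵐ[volume.restrict Ω] v) : MemW2 p Ω v :=
  ⟨hu.1.congr h, fun i => weakPartial_congr h i ▸ hu.2 i⟩

/-- Restriction to a smaller open set keeps the weak Hessian, almost everywhere. -/
theorem MemW2.mono {p : ℝ≥0∞} {Ω T : Set Plane} (hT : IsOpen T) (hTΩ : T ⊆ Ω) {u : Plane → ℝ}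
    (hu : MemW2 p Ω u) : MemW2 p T u ∧ weakHess T u =ᵐ[volume.restrict T] weakHess Ω u := by
  have h1 := hu.1.mono hT hTΩ
  have h2 := fun i => (hu.2 i).mono hT hTΩ
  refine ⟨⟨h1.1, fun i => (h2 i).1.congr (h1.2 i).symm⟩, ?_⟩
  filter_upwards [(h2 0).2 0, (h2 0).2 1, (h2 1).2 0, (h2 1).2 1] with x h00 h01 h10 h11
  ext ⟨i, j⟩
  simp only [weakHess, weakPartial_congr (h1.2 i) j]
  fin_cases i <;> fin_cases j
  exacts [h00, h01, h10, h11]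

theorem MemW2.of_top {Ω : Set Plane} (hb : Bornology.IsBounded Ω) {u : Plane → ℝ}
    (hu : MemW2 ∞ Ω u) (p : ℝ≥0∞) : MemW2 p Ω u := by
  have : IsFiniteMeasure (volume.restrict Ω) :=
    isFiniteMeasure_restrict.2 hb.measure_lt_top.ne
  exact ⟨⟨hu.1.1.mono_exponent le_top, fun i => ⟨(hu.1.2 i).1, (hu.1.2 i).2.mono_exponent le_top⟩⟩,
    fun i => ⟨(hu.2 i).1.mono_exponent le_top, fun j =>
      ⟨((hu.2 i).2 j).1, ((hu.2 i).2 j).2.mono_exponent le_top⟩⟩⟩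

/-- The seminorms of the interpolation error and of the function on an element, in terms of the
weak derivatives on the whole domain. -/
theorem IsTriangulation.semiW_element {𝒯 : Finset Tri} {Ω : Set Plane} (ht : IsTriangulation 𝒯 Ω)
    {T : Tri} (hT : T ∈ 𝒯) {p : ℝ≥0∞} {u c : Plane → ℝ} (hu : MemW2 p Ω u) (hc : MemVh 𝒯 Ω c)
    {q : Plane →ᵃ[ℝ] ℝ} (hq : EqOn c q T.carrier) :
    semiW1 p (interior T.carrier) (interior T.carrier) (fun x => u x - q x) =
        (eLpNorm (fun x => weakGrad Ω u x - weakGrad Ω c x) p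
          (volume.restrict (interior T.carrier))).toReal ∧
      semiW2 p (interior T.carrier) (interior T.carrier) u =
        (eLpNorm (weakHess Ω u) p (volume.restrict (interior T.carrier))).toReal := by
  have hTo : IsOpen (interior T.carrier) := isOpen_interior
  have hTΩ := ht.interior_carrier_subset hT
  have h2 := hu.mono hTo hTΩ
  refine ⟨?_, by rw [semiW2, eLpNorm_congr_ae h2.2]⟩
  rw [semiW1]
  congr 1
  refine eLpNorm_congr_ae ?_
  have hcq : HasWeakGrad (interior T.carrier) c fun _ => affGrad q :=
    (hasWeakGrad_affine _ q).congr ((ae_restrict_iff' hTo.measurableSet).2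
      (Eventually.of_forall fun x hx => (hq (interior_subset hx)).symm))
  have h3 := hcq.weakGrad_ae_eq_of_subset hTo hTΩ (ht.memH10_of_memVh hc).1
  have h4 := h2.1.1.hasWeakGrad.weakGrad_ae_eq_of_subset hTo hTΩ hu.1
  filter_upwards [weakGrad_sub_affine_ae_eq hTo h2.1.1 q, h3, h4] with x e1 e2 e3
  rw [e1, e2, e3]

/-- The interiors of the elements outside a part of the mesh fill the rest of the domain up to a
null set. -/
theorem IsTriangulation.diff_region_ae_eq {𝒯 ℬ : Finset Tri} {Ω : Set Plane}
    (ht : IsTriangulation 𝒯 Ω) (hB : ℬ ⊆ 𝒯) [DecidableEq Tri] :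
    (Ω \ region ℬ : Set Plane) =ᵐ[volume] ⋃ T ∈ 𝒯 \ ℬ, interior T.carrier := by
  refine Filter.EventuallyLE.antisymm (ae_le_set.2 ?_) (Eventually.of_forall fun x hx => ?_)
  · refine measure_mono_null (t := ⋃ T ∈ 𝒯, T.carrier \ interior T.carrier) (fun x hx => ?_)
      ((measure_biUnion_null_iff 𝒯.countable_toSet).2 fun T _ =>
        ae_le_set.1 T.interior_carrier_ae_eq.symm.le)
    obtain ⟨T, hT, hxT⟩ := mem_region.1 (ht.subset_region hx.1.1)
    refine mem_biUnion hT ⟨hxT, fun hi => hx.2 ?_⟩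
    refine mem_biUnion (Finset.mem_coe.2 (Finset.mem_sdiff.2 ⟨hT, fun hTB => ?_⟩)) hi
    exact hx.1.2 (carrier_subset_region hTB hxT)
  · obtain ⟨T, hT, hxT⟩ := mem_iUnion₂.1 (show x ∈ ⋃ T ∈ 𝒯 \ ℬ, interior T.carrier from hx)
    obtain ⟨hT1, hT2⟩ := Finset.mem_sdiff.1 hT
    refine ⟨ht.interior_carrier_subset hT1 hxT, fun hxB => ?_⟩
    obtain ⟨S, hS, hxS⟩ := mem_region.1 hxB
    exact ht.notMem_carrier_of_mem_interior (hB hS) hT1 (fun e => hT2 (e ▸ hS)) hxT hxS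

/-- The squared `L²` norm outside the band is the sum over the elements. -/
theorem IsTriangulation.sq_eLpNorm_diff {𝒯 ℬ : Finset Tri} {Ω : Set Plane}
    (ht : IsTriangulation 𝒯 Ω) (hB : ℬ ⊆ 𝒯) [DecidableEq Tri] {E : Type*} [NormedAddCommGroup E]
    {G : Plane → E} (hG : MemLp G 2 (volume.restrict Ω)) :
    (eLpNorm G 2 (volume.restrict (Ω \ region ℬ))).toReal ^ 2 =
      ∑ T ∈ 𝒯 \ ℬ, (eLpNorm G 2 (volume.restrict (interior T.carrier))).toReal ^ 2 := by
  have hsq : ∀ S : Set Plane, (eLpNorm G 2 (volume.restrict S)).toReal ^ 2 =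
      (∫⁻ x in S, ‖G x‖ₑ ^ 2).toReal := fun S => by
    rw [eLpNorm_eq_lintegral_rpow_enorm_toReal two_ne_zero ENNReal.ofNat_ne_top,
      ← ENNReal.toReal_pow, ← ENNReal.rpow_natCast, ← ENNReal.rpow_mul]
    norm_num
  have hfin : ∀ S ⊆ Ω, ∫⁻ x in S, ‖G x‖ₑ ^ 2 ≠ ⊤ := fun S hS => by
    have h1 := (hG.mono_measure (Measure.restrict_mono hS le_rfl)).eLpNorm_ne_top
    rw [eLpNorm_eq_lintegral_rpow_enorm_toReal two_ne_zero ENNReal.ofNat_ne_top] at h1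
    intro h2
    refine h1 ?_
    have h3 : ∫⁻ x in S, ‖G x‖ₑ ^ (2 : ℝ≥0∞).toReal = ⊤ := by
      rw [← h2]
      norm_num
    rw [h3]
    simp
  rw [hsq, Measure.restrict_congr_set (ht.diff_region_ae_eq hB), lintegral_biUnion_finset,
    ENNReal.toReal_sum]
  · exact Finset.sum_congr rfl fun T _ => (hsq _).symm
  · exact fun T hT => hfin _ (ht.interior_carrier_subset (Finset.mem_sdiff.1 hT).1)
  · intro S hS T hT hST
    refine Set.disjoint_left.2 fun x hxS hxT => ?_
    exact ht.notMem_carrier_of_mem_interior (Finset.mem_sdiff.1 hS).1 (Finset.mem_sdiff.1 hT).1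
      hST hxT (interior_subset hxS)
  · exact fun T _ => isOpen_interior.measurableSet

theorem Tri.longestEdge_pos (T : Tri) : 0 < T.longestEdge := by
  refine lt_of_lt_of_le ?_ (T.dist_le_longestEdge 0 1)
  rw [norm_pos_iff, sub_ne_zero]
  exact T.independent.injective.ne (by decide)

/-- The interpolation error outside the band. -/
theorem IsTriangulation.interpolation_error_diff {𝒯 ℬ : Finset Tri} {Ω : Set Plane}
    (ht : IsTriangulation 𝒯 Ω) (hB : ℬ ⊆ 𝒯) {α₀ CI h : ℝ} (hCI : IsMaxAngleConstant α₀ CI)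
    (hel : ∀ T ∈ 𝒯, T ∉ ℬ → T.longestEdge ≤ h ∧ T.AnglesLE α₀) (hh : 0 < h) {u c : Plane → ℝ}
    (huc : Continuous u) (hu : MemW2 2 Ω u) (hc : MemVh 𝒯 Ω c)
    (hcu : ∀ T ∈ 𝒯, EqOn c (T.interpolant u) T.carrier) :
    (eLpNorm (fun x => weakGrad Ω u x - weakGrad Ω c x) 2
      (volume.restrict (Ω \ region ℬ))).toReal ≤ CI * h * semiW2 2 Ω (Ω \ region ℬ) u := by
  classical
  have hcH := ht.memH10_of_memVh hc
  obtain ⟨a, ha⟩ : ∃ a : Tri → ℝ, a = fun T => (eLpNorm (fun x => weakGrad Ω u x - weakGrad Ω c x) 2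
    (volume.restrict (interior T.carrier))).toReal := ⟨_, rfl⟩
  obtain ⟨b, hb⟩ : ∃ b : Tri → ℝ, b = fun T => (eLpNorm (weakHess Ω u) 2
    (volume.restrict (interior T.carrier))).toReal := ⟨_, rfl⟩
  have ha0 : ∀ T, 0 ≤ a T := fun T => ha ▸ ENNReal.toReal_nonneg
  have hb0 : ∀ T, 0 ≤ b T := fun T => hb ▸ ENNReal.toReal_nonneg
  have hab : ∀ T ∈ 𝒯 \ ℬ, a T ≤ CI * T.longestEdge * b T := fun T hT => by
    obtain ⟨hT1, hT2⟩ := Finset.mem_sdiff.1 hT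
    have h1 := ht.semiW_element hT1 hu hc (hcu T hT1)
    have h2 := hCI T u (T.interpolant u) (hel T hT1 hT2).2
      (hu.mono isOpen_interior (ht.interior_carrier_subset hT1)).1 huc.continuousOn
      (T.isLagrangeInterpolant_interpolant u)
    rw [h1.1, h1.2] at h2
    rw [ha, hb]
    exact h2
  have hsa := ht.sq_eLpNorm_diff hB (hu.1.memLp_weakGrad.sub hcH.1.memLp_weakGrad)
  have hsb := ht.sq_eLpNorm_diff hB hu.memLp_weakHess
  rw [semiW2]
  have hA0 : 0 ≤ (eLpNorm (fun x => weakGrad Ω u x - weakGrad Ω c x) 2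
      (volume.restrict (Ω \ region ℬ))).toReal := ENNReal.toReal_nonneg
  have hB0 : 0 ≤ (eLpNorm (weakHess Ω u) 2 (volume.restrict (Ω \ region ℬ))).toReal :=
    ENNReal.toReal_nonneg
  change (eLpNorm (fun x => weakGrad Ω u x - weakGrad Ω c x) 2
    (volume.restrict (Ω \ region ℬ))).toReal ^ 2 = ∑ T ∈ 𝒯 \ ℬ, (eLpNorm (fun x =>
      weakGrad Ω u x - weakGrad Ω c x) 2 (volume.restrict (interior T.carrier))).toReal ^ 2 at hsa
  generalize (eLpNorm (fun x => weakGrad Ω u x - weakGrad Ω c x) 2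
    (volume.restrict (Ω \ region ℬ))).toReal = A at *
  generalize (eLpNorm (weakHess Ω u) 2 (volume.restrict (Ω \ region ℬ))).toReal = B at *
  have hsa' : A ^ 2 = ∑ T ∈ 𝒯 \ ℬ, a T ^ 2 := by rw [hsa, ha]
  have hsb' : B ^ 2 = ∑ T ∈ 𝒯 \ ℬ, b T ^ 2 := by rw [hsb, hb]
  have hAB : A ^ 2 ≤ (CI * h * B) ^ 2 := by
    rw [hsa', mul_pow, hsb', Finset.mul_sum]
    refine Finset.sum_le_sum fun T hT => ?_
    rw [← mul_pow]
    refine (pow_le_pow_left₀ (ha0 T) (hab T hT) 2).trans ?_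
    obtain ⟨hT1, hT2⟩ := Finset.mem_sdiff.1 hT
    simp only [mul_pow]
    have h3 := pow_le_pow_left₀ T.longestEdge_pos.le (hel T hT1 hT2).1 2
    gcongr
  rcases le_or_gt 0 CI with hC | hC
  · exact abs_le_of_sq_le_sq' hAB (by positivity) |>.2
  · -- a negative constant is possible only if all Hessians vanish
    have hb1 : ∀ T ∈ 𝒯 \ ℬ, b T = 0 := fun T hT => by
      by_contra hne
      have h1 := (hb0 T).lt_of_ne' hne
      have h2 := mul_pos T.longestEdge_pos h1
      have h3 := (ha0 T).trans (hab T hT)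
      nlinarith
    have hB1 : B = 0 := by
      have : B ^ 2 = 0 := by
        rw [hsb']
        exact Finset.sum_eq_zero fun T hT => by rw [hb1 T hT, zero_pow two_ne_zero]
      exact pow_eq_zero_iff two_ne_zero |>.1 this
    rw [hB1, mul_zero] at hAB ⊢
    rw [zero_pow two_ne_zero] at hAB
    exact (pow_eq_zero_iff two_ne_zero |>.1 (le_antisymm hAB (sq_nonneg A))).le

/-! ### The band -/

/-- The area of a set contained in a rotated rectangle is at most the area of the rectangle. -/
theorem volume_rectangle_le {S : Set Plane} {L H : ℝ} (hL : 0 ≤ L) {a e n : Plane}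
    (he : ‖e‖ = 1) (hn : ‖n‖ = 1) (hen : inner ℝ e n = 0)
    (hS : ∀ x ∈ S, ∃ s ∈ Icc (0 : ℝ) L, ∃ t ∈ Icc (0 : ℝ) H, x = a + s • e + t • n) :
    volume S ≤ ENNReal.ofReal (L * H) := by
  have hon : Orthonormal ℝ ![e, n] := by
    rw [orthonormal_iff_ite]
    intro i j
    fin_cases i <;> fin_cases j <;> simp [he, hn, hen, real_inner_comm]
  obtain ⟨b, hb⟩ := Orthonormal.exists_orthonormalBasis_extension_of_card_eq (ι := Fin 2)
    (𝕜 := ℝ) (E := Plane) (by simp) (v := ![e, n]) (s := univ)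
    (hon.comp _ Subtype.val_injective)
  have hb0 : b 0 = e := hb 0 (mem_univ _)
  have hb1 : b 1 = n := hb 1 (mem_univ _)
  have hmp : MeasurePreserving (fun x : Plane => b.repr (x - a)) volume volume :=
    b.measurePreserving_repr.comp (measurePreserving_sub_right volume a)
  have hne : inner ℝ n e = 0 := by rw [real_inner_comm, hen]
  have hsub : S ⊆ (fun x : Plane => b.repr (x - a)) ⁻¹'
      {y : Plane | y 0 ∈ Icc 0 L ∧ y 1 ∈ Icc 0 H} := by
    intro x hx
    obtain ⟨s, hs, t, ht, rfl⟩ := hS x hx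
    have h1 : a + s • e + t • n - a = s • e + t • n := by abel
    refine ⟨?_, ?_⟩
    · simp only [h1]
      rw [b.repr_apply_apply, hb0, inner_add_right, inner_smul_right, inner_smul_right,
        real_inner_self_eq_norm_sq, he, hen]
      simpa using hs
    · simp only [h1]
      rw [b.repr_apply_apply, hb1, inner_add_right, inner_smul_right, inner_smul_right,
        real_inner_self_eq_norm_sq, hn, hne]
      simpa using ht
  have hm : MeasurableSet {y : Plane | y 0 ∈ Icc 0 L ∧ y 1 ∈ Icc 0 H} :=
    ((by fun_prop : Measurable fun y : Plane => y 0) measurableSet_Icc).inter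
      ((by fun_prop : Measurable fun y : Plane => y 1) measurableSet_Icc)
  refine (measure_mono hsub).trans ?_
  rw [hmp.measure_preimage hm.nullMeasurableSet]
  have := setLIntegral_rectangle (I := Icc 0 L) (J := Icc 0 H) measurableSet_Icc measurableSet_Icc
    (F := fun _ => 1) measurable_const
  simp only [lintegral_const, one_mul, Measure.restrict_apply MeasurableSet.univ, univ_inter,
    Real.volume_Icc, sub_zero] at this
  rw [this, ENNReal.ofReal_mul hL]

theorem toReal_eLpNorm_two_le {E : Type*} [NormedAddCommGroup E] {B : Set Plane} {G : Plane → E}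
    {M V : ℝ} (hM : 0 ≤ M) (hG : ∀ᵐ x ∂(volume.restrict B), ‖G x‖ ≤ M) (hV : 0 ≤ V)
    (hB : volume B ≤ ENNReal.ofReal V) :
    (eLpNorm G 2 (volume.restrict B)).toReal ≤ M * √V := by
  refine ENNReal.toReal_le_of_le_ofReal (by positivity) ?_
  refine (eLpNorm_le_of_ae_bound hG).trans ?_
  rw [Measure.restrict_apply_univ, mul_comm M, ENNReal.ofReal_mul (Real.sqrt_nonneg V),
    Real.sqrt_eq_rpow, ← ENNReal.ofReal_rpow_of_nonneg hV (by norm_num)]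
  have h2 : (2 : ℝ≥0∞).toReal⁻¹ = 1 / 2 := by norm_num
  rw [h2]
  exact mul_le_mul_left (ENNReal.rpow_le_rpow hB (by norm_num)) _

namespace Tri

variable {T : Tri}

theorem minAltitude_le (i : Fin 3) : T.minAltitude ≤ Affine.Simplex.height T i :=
  ciInf_le (finite_range _).bddBelow i

/-- A triangle with longest edge `ℓ` and smallest altitude `a` has Jacobian `ℓ a`. -/
theorem abs_det_eq : |T.det| = T.longestEdge * T.minAltitude := by
  obtain ⟨i, j, k, hij, hjk, hik, hlong, -, -⟩ := T.exists_longest_edge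
  have h1 := T.height_mul_edge hij hjk hik
  have h2 : T.points j - T.points k = T.edge i j - T.edge i k := by simp [edge]
  rw [h2, hlong] at h1
  refine le_antisymm ?_ ?_
  · obtain ⟨m, hm⟩ := exists_eq_ciInf_of_finite (f := fun i => Affine.Simplex.height T i)
    obtain ⟨a, b, ham, hab, hmb⟩ : ∃ a b : Fin 3, m ≠ a ∧ a ≠ b ∧ m ≠ b := by
      clear hm
      revert m
      decide
    have h3 := T.height_mul_edge ham hab hmb
    have h4 : Affine.Simplex.height T m = T.minAltitude := hm
    rw [← h3, h4, mul_comm]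
    refine mul_le_mul_of_nonneg_right (T.dist_le_longestEdge a b) ?_
    rw [← h4]
    exact (Affine.Simplex.height_pos T m).le
  · rw [← h1, mul_comm]
    exact mul_le_mul_of_nonneg_right (minAltitude_le i) T.longestEdge_pos.le

/-- From `4 R |K| = a b c` and `2 |K| = h_K H`: the circumradius of a band triangle is at most
`h² / (2 H)`, however degenerate the triangle is. -/
theorem circumradius_le {h H : ℝ} (hl : T.longestEdge ≤ h) (hH : T.minAltitude = H)
    (hH0 : 0 < H) : Affine.Simplex.circumradius T ≤ h ^ 2 / (2 * H) := by
  obtain ⟨i, j, k, hij, hjk, hik, hlong, h1, h2⟩ := T.exists_longest_edge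
  have h3 := T.two_mul_circumradius_mul_det hij hjk hik
  have hpos := T.longestEdge_pos
  rw [abs_det_eq, hlong, hH] at h3
  have h4 : 2 * Affine.Simplex.circumradius T * H = ‖T.edge i j‖ * ‖T.edge i k‖ :=
    mul_right_cancel₀ hpos.ne' (by linear_combination h3)
  have h5 : ‖T.edge i j‖ * ‖T.edge i k‖ ≤ h * h :=
    mul_le_mul (h1.trans hl) (h2.trans hl) (norm_nonneg _) (hpos.le.trans hl)
  rw [le_div_iff₀ (by positivity)]
  linarith

end Tri

theorem region_mono {𝒯 ℬ : Finset Tri} (h : ℬ ⊆ 𝒯) : region ℬ ⊆ region 𝒯 :=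
  biUnion_subset_biUnion_left h

theorem ae_region_of_ae_interior {ℬ : Finset Tri} {P : Plane → Prop}
    (h : ∀ T ∈ ℬ, ∀ᵐ x ∂(volume.restrict (interior T.carrier)), P x) :
    ∀ᵐ x ∂(volume.restrict (region ℬ)), P x := by
  rw [region, ae_restrict_biUnion_finset_iff]
  intro T hT
  rw [← Measure.restrict_congr_set T.interior_carrier_ae_eq]
  exact h T hT

/-- The interpolation error on the band. -/
theorem IsTriangulation.interpolation_error_band {𝒯 ℬ : Finset Tri} {Ω : Set Plane}
    (ht : IsTriangulation 𝒯 Ω) (hB : ℬ ⊆ 𝒯) {C L H h : ℝ} (hC : IsCircumradiusConstant C)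
    (hC0 : 0 ≤ C) (hL : 0 ≤ L) (hH : 0 < H) (hband : IsBand ℬ L H h) {u c : Plane → ℝ}
    (huc : Continuous u) (hu : MemW2 ∞ Ω u) (hc : MemVh 𝒯 Ω c)
    (hcu : ∀ T ∈ 𝒯, EqOn c (T.interpolant u) T.carrier) :
    (eLpNorm (fun x => weakGrad Ω u x - weakGrad Ω c x) 2 (volume.restrict (region ℬ))).toReal ≤
      C * (h ^ 2 / (2 * H)) * semiW2 ∞ Ω (region ℬ) u * √(L * H) := by
  have hu2 : 0 ≤ semiW2 ∞ Ω (region ℬ) u := ENNReal.toReal_nonneg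
  obtain ⟨a, e, n, he, hn, hen, hrect⟩ := hband.subset_rectangle
  refine toReal_eLpNorm_two_le (by positivity) (ae_region_of_ae_interior fun T hT => ?_)
    (by positivity) (volume_rectangle_le hL he hn hen hrect)
  have hT' := hB hT
  have hTΩ := ht.interior_carrier_subset hT'
  have h1 := ht.semiW_element hT' hu hc (hcu T hT')
  have huT := (hu.mono isOpen_interior hTΩ).1
  have h2 := hC T u (T.interpolant u) huT huc.continuousOn
    (T.isLagrangeInterpolant_interpolant u)
  rw [h1.1, h1.2] at h2
  have hcL : MemLp (weakGrad Ω c) ∞ (volume.restrict (interior T.carrier)) := by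
    have h3 := (hasWeakGrad_affine (interior T.carrier) (T.interpolant u)).congr
      ((ae_restrict_iff' isOpen_interior.measurableSet).2 (Eventually.of_forall fun x hx =>
        (hcu T hT' (interior_subset hx)).symm))
    refine (memLp_congr_ae (h3.weakGrad_ae_eq_of_subset isOpen_interior hTΩ
      (ht.memH10_of_memVh hc).1)).2 ?_
    exact memLp_top_const _
  have huL : MemLp (weakGrad Ω u) ∞ (volume.restrict (interior T.carrier)) :=
    hu.1.memLp_weakGrad.mono_measure (Measure.restrict_mono hTΩ le_rfl)
  have hsub : interior T.carrier ⊆ region ℬ :=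
    interior_subset.trans (carrier_subset_region hT)
  have hHess : (eLpNorm (weakHess Ω u) ∞ (volume.restrict (interior T.carrier))).toReal ≤
      semiW2 ∞ Ω (region ℬ) u := by
    refine ENNReal.toReal_mono ?_ (eLpNorm_mono_measure _ (Measure.restrict_mono hsub le_rfl))
    have hle : volume.restrict (region ℬ) ≤ volume.restrict Ω := by
      rw [ht.restrict_eq_inter (region_mono hB)]
      exact Measure.restrict_mono inter_subset_left le_rfl
    exact (hu.memLp_weakHess.mono_measure hle).eLpNorm_ne_top
  have hR0 := Affine.Simplex.circumradius_nonneg T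
  have hR := Tri.circumradius_le (hband.longestEdge_le T hT) (hband.minAltitude_eq T hT) hH
  filter_upwards [ae_norm_le_eLpNorm_top (huL.sub hcL).eLpNorm_ne_top] with x hx
  refine (hx.trans h2).trans ?_
  gcongr

/-- A function whose gradient vanishes on the band has a vanishing Hessian there. -/
theorem IsTriangulation.semiW1_pos {𝒯 ℬ : Finset Tri} {Ω : Set Plane}
    (ht : IsTriangulation 𝒯 Ω) (hB : ℬ ⊆ 𝒯) {u : Plane → ℝ} (hu : MemW2 ∞ Ω u)
    (hG : ∀ᵐ x ∂(volume.restrict (region ℬ)), ‖weakGrad Ω u x‖ ≤ semiW1 ∞ Ω (region ℬ) u)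
    (h2 : 0 < semiW2 ∞ Ω (region ℬ) u) : 0 < semiW1 ∞ Ω (region ℬ) u := by
  refine lt_of_le_of_ne ENNReal.toReal_nonneg fun h0 => h2.ne' ?_
  have hz : weakHess Ω u =ᵐ[volume.restrict (region ℬ)] 0 := by
    refine ae_region_of_ae_interior fun T hT => ?_
    have hTΩ := ht.interior_carrier_subset (hB hT)
    have hG' := ae_restrict_of_ae_restrict_of_subset
      (interior_subset.trans (carrier_subset_region hT)) hG
    have hij : ∀ i j, weakPartial Ω j (weakPartial Ω i u)
        =ᵐ[volume.restrict (interior T.carrier)] fun _ => 0 := fun i j => by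
      have h1 : weakPartial Ω i u =ᵐ[volume.restrict (interior T.carrier)] fun _ => 0 := by
        filter_upwards [hG'] with x hx
        rw [← h0] at hx
        have := PiLp.norm_apply_le (weakGrad Ω u x) i
        exact norm_le_zero_iff.1 (this.trans hx)
      have h3 := (hasWeakPartial_weakPartial ((hu.2 i).2 j).1).mono hTΩ
      have h4 := hasWeakPartial_of_contDiff (u := fun _ => (0 : ℝ)) contDiff_const
        (interior T.carrier) j
      simp only [fderiv_fun_const, Pi.zero_apply, zero_apply] at h4
      exact (h3.congr h1 EventuallyEq.rfl).ae_unique isOpen_interior h4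
    filter_upwards [hij 0 0, hij 0 1, hij 1 0, hij 1 1] with x h00 h01 h10 h11
    ext ⟨i, j⟩
    fin_cases i <;> fin_cases j
    exacts [h00, h01, h10, h11]
  rw [semiW2, eLpNorm_congr_ae hz]
  simp

/-! ### The choice of the diffusion coefficient -/

theorem rpow_quarter_sq : ((6 : ℝ) ^ (1 / 4 : ℝ)) ^ 2 = √6 := by
  rw [← Real.rpow_natCast, ← Real.rpow_mul (by norm_num), Real.sqrt_eq_rpow]
  norm_num

/-- The two contributions of the band, the interpolation error and the perturbation of the
equation, are both of order `h` for the chosen diffusion coefficient: the first one is proportional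
to `√D` and the second one to `1 / √D`, and `D` balances them unless it is cut off at `1`. -/
theorem band_contribution_le {C Cc L H h u1 u2 D : ℝ} (hC0 : 0 ≤ C) (hC : C ≤ Cc) (hC4 : C ≤ 4)
    (hCc : 2 / 3 ≤ Cc) (hL : 0 < L) (hH : 0 < H) (hh : 0 < h) (hu1 : 0 < u1) (hu2 : 0 < u2)
    (hD : D = min (H / h ^ 2 * (u1 / u2) * √(2 / (3 * Cc))) 1) :
    2 * √2 * (√D * (C * (h ^ 2 / (2 * H)) * u2 * √(L * H))) +
        √2 * ((1 - D) / √D * (u1 * √(L * H))) ≤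
      2 * √2 * (6 : ℝ) ^ (1 / 4 : ℝ) * √(Cc * L) * √(u1 * u2) * h := by
  have hCc0 : 0 < Cc := by linarith
  obtain ⟨σ, hσ⟩ : ∃ σ, σ = √(2 / (3 * Cc)) := ⟨_, rfl⟩
  have hσ0 : 0 < σ := hσ ▸ Real.sqrt_pos.2 (by positivity)
  have hσ2 : σ ^ 2 * (3 * Cc) = 2 := by
    rw [hσ, Real.sq_sqrt (by positivity)]
    field_simp
  obtain ⟨q, hq⟩ : ∃ q, q = (6 : ℝ) ^ (1 / 4 : ℝ) := ⟨_, rfl⟩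
  have hq0 : 0 < q := hq ▸ by positivity
  have hq4 : (q ^ 2) ^ 2 = 6 := by rw [hq, rpow_quarter_sq, Real.sq_sqrt (by norm_num)]
  obtain ⟨a, ha⟩ : ∃ a, a = H / h ^ 2 * (u1 / u2) * σ := ⟨_, rfl⟩
  have ha0 : 0 < a := by rw [ha]; positivity
  rw [← hσ, ← ha] at hD
  rw [← hq]
  have hD0 : 0 < D := hD ▸ lt_min ha0 one_pos
  -- the numerical inequalities behind the two contributions
  -- (`C ^ 4 ≤ 4 * Cc ^ 3` for the first one, `1 ≤ 4 * Cc` for the second one)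
  have n1 : C ^ 2 * σ ≤ q ^ 2 * Cc := by
    refine abs_le_of_sq_le_sq' ?_ (by positivity) |>.2
    have e1 : C ^ 2 ≤ Cc * 4 := by nlinarith
    have e2 : C ^ 2 * C ^ 2 ≤ (Cc * 4) * (Cc * Cc) := by
      refine mul_le_mul e1 ?_ (sq_nonneg _) (by positivity)
      nlinarith
    have e3 : (C ^ 2 * σ) ^ 2 * (3 * Cc) ≤ (q ^ 2 * Cc) ^ 2 * (3 * Cc) := by
      rw [mul_pow, mul_assoc, hσ2, mul_pow, hq4]
      nlinarith [pow_pos hCc0 3]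
    exact le_of_mul_le_mul_right e3 (by positivity)
  have n2 : 1 ≤ q ^ 2 * Cc * σ := by
    refine abs_le_of_sq_le_sq' ?_ (by positivity) |>.2
    rw [mul_pow, mul_pow, hq4]
    nlinarith
  obtain ⟨R, hR⟩ : ∃ R, R = q * √(Cc * L) * √(u1 * u2) * h := ⟨_, rfl⟩
  have hR0 : 0 ≤ R := by rw [hR]; positivity
  have hR2 : R ^ 2 = q ^ 2 * (Cc * L) * (u1 * u2) * h ^ 2 := by
    rw [hR, mul_pow, mul_pow, mul_pow, Real.sq_sqrt (by positivity), Real.sq_sqrt (by positivity)]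
  have A : √D * (C * (h ^ 2 / (2 * H)) * u2 * √(L * H)) ≤ R / 2 := by
    refine abs_le_of_sq_le_sq' ?_ (by positivity) |>.2
    rw [div_pow, hR2, mul_pow, mul_pow, Real.sq_sqrt hD0.le, Real.sq_sqrt (by positivity)]
    calc D * ((C * (h ^ 2 / (2 * H)) * u2) ^ 2 * (L * H))
        ≤ a * ((C * (h ^ 2 / (2 * H)) * u2) ^ 2 * (L * H)) := by
          gcongr
          exact hD ▸ min_le_left _ _
      _ = C ^ 2 * σ * (L * (u1 * u2) * h ^ 2 / 4) := by
          rw [ha]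
          field_simp
          ring
      _ ≤ q ^ 2 * Cc * (L * (u1 * u2) * h ^ 2 / 4) := by gcongr
      _ = q ^ 2 * (Cc * L) * (u1 * u2) * h ^ 2 / 2 ^ 2 := by ring
  have Bd : (1 - D) / √D * (u1 * √(L * H)) ≤ R := by
    rcases le_total a 1 with h1 | h1
    · rw [min_eq_left h1] at hD
      refine le_trans (b := 1 / √D * (u1 * √(L * H))) ?_ ?_
      · gcongr
        linarith
      · refine abs_le_of_sq_le_sq' ?_ hR0 |>.2
        rw [hR2, mul_pow, mul_pow, div_pow, Real.sq_sqrt hD0.le, Real.sq_sqrt (by positivity), hD,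
          one_pow]
        calc 1 / a * (u1 ^ 2 * (L * H)) = 1 / σ * (L * (u1 * u2) * h ^ 2) := by
              rw [ha]
              field_simp
          _ ≤ q ^ 2 * Cc * (L * (u1 * u2) * h ^ 2) := by
              gcongr
              rwa [div_le_iff₀ hσ0]
          _ = q ^ 2 * (Cc * L) * (u1 * u2) * h ^ 2 := by ring
    · rw [min_eq_right h1] at hD
      rw [hD, sub_self, zero_div, zero_mul]
      exact hR0
  have hs : 0 ≤ √(2 : ℝ) := Real.sqrt_nonneg 2
  have h1 := mul_le_mul_of_nonneg_left A (mul_nonneg zero_le_two hs)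
  have h2 := mul_le_mul_of_nonneg_left Bd hs
  have h3 : 2 * √2 * q * √(Cc * L) * √(u1 * u2) * h = 2 * √2 * R := by rw [hR]; ring
  rw [h3]
  linarith

/-- Bounding the Jacobian from below is the same as reducing the diffusion coefficient. -/
theorem jacobian_div_max {H h Cc u1 u2 : ℝ} (hH : 0 < H) (hh : 0 < h) (hCc : 0 < Cc)
    (hu1 : 0 < u1) (hu2 : 0 < u2) :
    h * H / max (h * H) (h ^ 3 * (u2 / u1) * √(3 * Cc / 2)) =
      min (H / h ^ 2 * (u1 / u2) * √(2 / (3 * Cc))) 1 := by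
  have hs : 0 < √(3 * Cc / 2) := Real.sqrt_pos.2 (by positivity)
  have hinv : √(2 / (3 * Cc)) = 1 / √(3 * Cc / 2) := by
    rw [one_div, ← Real.sqrt_inv, inv_div]
  have hJ : 0 < h ^ 3 * (u2 / u1) * √(3 * Cc / 2) := by positivity
  have hq : H / h ^ 2 * (u1 / u2) * √(2 / (3 * Cc)) =
      h * H / (h ^ 3 * (u2 / u1) * √(3 * Cc / 2)) := by
    rw [hinv]
    field_simp
  have hhH : 0 < h * H := by positivity
  rw [hq]
  rcases le_total (h * H) (h ^ 3 * (u2 / u1) * √(3 * Cc / 2)) with h1 | h1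
  · rw [max_eq_right h1, min_eq_left ((div_le_one hJ).2 h1)]
  · rw [max_eq_left h1, min_eq_right ((one_le_div hJ).2 h1), div_self hhH.ne']

/-! ### The error estimate of the tempered method -/

/-- A circumradius constant may be replaced by a smaller one which is at most `4`. For large `Cc`
the interpolation error would otherwise not be dominated by a multiple of `√Cc`. -/
theorem IsCircumradiusConstant.exists_le_four {Cc : ℝ} (h : IsCircumradiusConstant Cc) :
    ∃ C, IsCircumradiusConstant C ∧ C ≤ Cc ∧ C ≤ 4 := by
  rcases le_total Cc 4 with h4 | h4
  exacts [⟨Cc, h, le_rfl, h4⟩, ⟨4, isCircumradiusConstant_four, h4, le_rfl⟩]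

/-- The seminorm on the band is finite, so its real value bounds the gradient almost everywhere. -/
theorem IsTriangulation.ae_norm_weakGrad_le {𝒯 ℬ : Finset Tri} {Ω : Set Plane}
    (ht : IsTriangulation 𝒯 Ω) (hB : ℬ ⊆ 𝒯) {u : Plane → ℝ} (hu : MemW1 ∞ Ω u) :
    ∀ᵐ x ∂(volume.restrict (region ℬ)), ‖weakGrad Ω u x‖ ≤ semiW1 ∞ Ω (region ℬ) u := by
  have hle : volume.restrict (region ℬ) ≤ volume.restrict Ω := by
    rw [ht.restrict_eq_inter (region_mono hB)]
    exact Measure.restrict_mono inter_subset_left le_rfl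
  exact ae_norm_le_eLpNorm_top (hu.memLp_weakGrad.mono_measure hle).eLpNorm_ne_top

/-- The error estimate: the solution is compared with its nodal interpolant. -/
theorem IsTriangulation.tempered_error_le {𝒯 ℬ : Finset Tri} {Ω : Set Plane}
    (ht : IsTriangulation 𝒯 Ω) (hB : ℬ ⊆ 𝒯) {Cc α₀ CI L H h : ℝ} {f u w : Plane → ℝ}
    (hCc : IsCircumradiusConstant Cc) (hCI : IsMaxAngleConstant α₀ CI) (hL : 0 < L) (hH : 0 < H)
    (hh : 0 < h) (hband : IsBand ℬ L H h)
    (hel : ∀ T ∈ 𝒯, T ∉ ℬ → T.longestEdge ≤ h ∧ T.AnglesLE α₀)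
    (hu : IsWeakSolution Ω f u) (hu2 : MemW2 ∞ Ω u) (hpos : 0 < semiW2 ∞ Ω (region ℬ) u)
    (hw : IsTFEMSolution 𝒯 Ω (region ℬ) (optD Ω (region ℬ) u Cc H h) f w) :
    semiW1 2 Ω (Ω \ region ℬ) (fun x => u x - w x) +
        √(optD Ω (region ℬ) u Cc H h) * semiW1 2 Ω (region ℬ) (fun x => u x - w x) ≤
      (2 * √2 * CI * semiW2 2 Ω (Ω \ region ℬ) u +
        2 * √2 * (6 : ℝ) ^ (1 / 4 : ℝ) * √(Cc * L) *
          √(semiW1 ∞ Ω (region ℬ) u * semiW2 ∞ Ω (region ℬ) u)) * h := by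
  have hG := ht.ae_norm_weakGrad_le hB hu2.1
  have hu1pos := ht.semiW1_pos hB hu2 hG hpos
  obtain ⟨C, hC, hCCc, hC4⟩ := hCc.exists_le_four
  have hC23 := hC.two_thirds_le
  have hCc23 := hCc.two_thirds_le
  have hCcpos : 0 < Cc := by linarith
  -- the representative of the solution which is continuous up to the boundary
  obtain ⟨K, U, hUlip, hUu, hU0⟩ := hu.1.exists_lipschitzWith ht.isOpen ht.closure_interior_compl
    hu2.1
  have hgrad : weakGrad Ω U = weakGrad Ω u := weakGrad_congr hUu
  have hhess : weakHess Ω U = weakHess Ω u := weakHess_congr hUu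
  have hU2 : MemW2 ∞ Ω U := hu2.congr hUu.symm
  obtain ⟨c, hc, hcU⟩ := ht.exists_memVh_interpolant hU0
  have hD0 : 0 < optD Ω (region ℬ) u Cc H h := by
    refine lt_min ?_ one_pos
    have : 0 < √(2 / (3 * Cc)) := Real.sqrt_pos.2 (by positivity)
    positivity
  have hBm : MeasurableSet (region ℬ) := (isCompact_region ℬ).measurableSet
  have e1 := ht.error_le hBm (region_mono hB) hD0 (min_le_right _ _) hu hw hc
  have e2 := ht.interpolation_error_diff hB hCI hel hh hUlip.continuous
    (hU2.of_top ht.isBounded 2) hc hcU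
  have e3 := ht.interpolation_error_band hB hC (by linarith) hL.le hH hband hUlip.continuous hU2
    hc hcU
  simp only [semiW2, hgrad, hhess] at e2 e3
  have e4 : semiW1 2 Ω (region ℬ) u ≤ semiW1 ∞ Ω (region ℬ) u * √(L * H) := by
    obtain ⟨a, e, n, he, hn, hen, hrect⟩ := hband.subset_rectangle
    exact toReal_eLpNorm_two_le hu1pos.le hG (by positivity)
      (volume_rectangle_le hL.le he hn hen hrect)
  have e5 := band_contribution_le (by linarith : 0 ≤ C) hCCc hC4 hCc23 hL hH hh hu1pos hpos
    (rfl : optD Ω (region ℬ) u Cc H h = _)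
  have hD1 : 0 ≤ 1 - optD Ω (region ℬ) u Cc H h := sub_nonneg.2 (min_le_right _ _)
  have hsD := Real.sqrt_nonneg (optD Ω (region ℬ) u Cc H h)
  have hs2 : 0 ≤ √(2 : ℝ) := Real.sqrt_nonneg 2
  have i2 := mul_le_mul_of_nonneg_left e2 (mul_nonneg zero_le_two hs2)
  have i3 := mul_le_mul_of_nonneg_left (mul_le_mul_of_nonneg_left e3 hsD)
    (mul_nonneg zero_le_two hs2)
  have i4 := mul_le_mul_of_nonneg_left (mul_le_mul_of_nonneg_left e4 (div_nonneg hD1 hsD)) hs2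
  simp only [semiW2] at e5 ⊢
  linarith

/-- On a band triangle with longest edge `h` the Jacobian is `h` times the width of the band. -/
theorem IsTriangulation.jacobian_ratio_eq {𝒯 ℬ : Finset Tri} {Ω : Set Plane}
    (ht : IsTriangulation 𝒯 Ω) (hB : ℬ ⊆ 𝒯) {Cc L H h : ℝ} {u : Plane → ℝ}
    (hCc : IsCircumradiusConstant Cc) (hH : 0 < H) (hh : 0 < h) (hband : IsBand ℬ L H h)
    (hu2 : MemW2 ∞ Ω u) (hpos : 0 < semiW2 ∞ Ω (region ℬ) u) {T : Tri} (hT : T ∈ ℬ)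
    (hlong : T.longestEdge = h) :
    T.jacobian / max T.jacobian
        (h ^ 3 * (semiW2 ∞ Ω (region ℬ) u / semiW1 ∞ Ω (region ℬ) u) * √(3 * Cc / 2)) =
      optD Ω (region ℬ) u Cc H h := by
  have hu1pos := ht.semiW1_pos hB hu2 (ht.ae_norm_weakGrad_le hB hu2.1) hpos
  rw [Tri.jacobian_eq, Tri.abs_det_eq, hlong, hband.minAltitude_eq T hT]
  exact jacobian_div_max hH hh (by linarith [hCc.two_thirds_le]) hu1pos hpos

end TFEM

end

theorem mainTheorem1 :
    (∃ Cc : ℝ, TFEM.IsCircumradiusConstant Cc) ∧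
    (∀ α₀ : ℝ, α₀ < Real.pi → ∃ CI : ℝ, TFEM.IsMaxAngleConstant α₀ CI) ∧
    ∀ (Cc α₀ CI : ℝ), TFEM.IsCircumradiusConstant Cc →
      α₀ < Real.pi → TFEM.IsMaxAngleConstant α₀ CI →
      ∀ (Ω : Set TFEM.Plane) (𝒯 ℬ : Finset TFEM.Tri) (L hbar h : ℝ) (f u w : TFEM.Plane → ℝ),
        0 < L → 0 < hbar → 0 < h →
        TFEM.IsTriangulation 𝒯 Ω →
        ℬ ⊆ 𝒯 → TFEM.IsBand ℬ L hbar h →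
        (∀ T ∈ 𝒯, T ∉ ℬ → T.longestEdge ≤ h ∧ T.AnglesLE α₀) →
        MemLp f 2 (volume.restrict Ω) →
        TFEM.IsWeakSolution Ω f u → TFEM.MemW2 ∞ Ω u →
        0 < TFEM.semiW2 ∞ Ω (TFEM.region ℬ) u →
        TFEM.IsTFEMSolution 𝒯 Ω (TFEM.region ℬ)
          (TFEM.optD Ω (TFEM.region ℬ) u Cc hbar h) f w →
        (TFEM.semiW1 2 Ω (Ω \ TFEM.region ℬ) (fun x => u x - w x) +
            √(TFEM.optD Ω (TFEM.region ℬ) u Cc hbar h) *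
              TFEM.semiW1 2 Ω (TFEM.region ℬ) (fun x => u x - w x) ≤
          (2 * √2 * CI * TFEM.semiW2 2 Ω (Ω \ TFEM.region ℬ) u +
            2 * √2 * (6 : ℝ) ^ (1 / 4 : ℝ) * √(Cc * L) *
              √(TFEM.semiW1 ∞ Ω (TFEM.region ℬ) u * TFEM.semiW2 ∞ Ω (TFEM.region ℬ) u)) * h) ∧
        (∀ T ∈ ℬ, T.longestEdge = h →
          T.jacobian / max T.jacobian
              (h ^ 3 * (TFEM.semiW2 ∞ Ω (TFEM.region ℬ) u / TFEM.semiW1 ∞ Ω (TFEM.region ℬ) u) *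
                √(3 * Cc / 2)) =
            TFEM.optD Ω (TFEM.region ℬ) u Cc hbar h) := by
  refine ⟨⟨4, TFEM.isCircumradiusConstant_four⟩,
    fun α₀ hα => TFEM.exists_isMaxAngleConstant hα, ?_⟩
  intro Cc α₀ CI hCc _ hCI Ω 𝒯 ℬ L hbar h f u w hL hH hh ht hB hband hel _ hu hu2 hpos hw
  exact ⟨ht.tempered_error_le hB hCc hCI hL hH hh hband hel hu hu2 hpos hw,
    fun T hT hlong => ht.jacobian_ratio_eq hB hCc hH hh hband hu2 hpos hT hlong⟩
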